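/- Consider an episodic nonstationary linear MDP with measurable state space $\mathcal S$, finite action set $\mathcal A$, $K$ episodes of $H\ge 1$ steps, and a known measurable feature map $\phi:\mathcal S\times\mathcal A\to\mathbb R^d$, $d\ge1$. In step $h$ of episode $k$ the transition kernel is $P^k_h(B\mid x,a)=\langle\phi(x,a),\mu_{h,k}(B)\rangle$ with unknown signed measures $\mu_{h,k}=(\mu^1_{h,k},\dots,\mu^d_{h,k})$ on $\mathcal S$, and the reward is $r^k_h(x,a)=\langle\phi(x,a),\theta_{h,k}\rangle\in[0,1]$ with unknown $\theta_{h,k}\in\mathbb R^d$. For a $d$-tuple $\nu$ of signed measures write $\|\nu\|=\|(|\nu^1|(\mathcal S),\dots,|\nu^d|(\mathcal S))\|_2$, where $|\nu^i|$ is the total variation. Assume $\|\phi(x,a)\|_2\le 1$, $\|\theta_{h,k}\|_2\le\sqrt d$ and $\|\mu_{h,k}\|\le\sqrt d$. The initial state $s^k_1$ of each episode is arbitrary (possibly chosen by an adversary who knows the past), and $s^k_{h+1}\sim P^k_h(\cdot\mid s^k_h,a^k_h)$. Let $W$ be a positive multiple of $H$. The episodes are divided into consecutive epochs of $W/H$ episodes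 (the last one may be shorter). For an epoch $\mathcal E$ with first episode $\tau$, put $$B_{\theta,\mathcal E}=\sum_{k\in\mathcal E,\,k>\tau}\sum_{h=1}^H\|\theta_{h,k}-\theta_{h,k-1}\|_2,\qquad B_{\mu,\mathcal E}=\sum_{k\in\mathcal E,\,k>\tau}\sum_{h=1}^H\|\mu_{h,k}-\mu_{h,k-1}\|.$$ In episode $k$ of $\mathcal E$, LSVI-UCB-Restart sets $V^k_{H+1}=0$ and computes for $h=H,\dots,1$, with $\phi^l_h=\phi(s^l_h,a^l_h)$ and $\|v\|_{M}=\sqrt{v^\top M v}$, $$\Lambda^k_h=I+\sum_{l=\tau}^{k-1}\phi^l_h(\phi^l_h)^\top,\quad w^k_h=(\Lambda^k_h)^{-1}\sum_{l=\tau}^{k-1}\phi^l_h\,[r^l_h(s^l_h,a^l_h)+V^k_{h+1}(s^l_{h+1})],$$ $$Q^k_h(x,a)=\min\{\langle w^k_h,\phi(x,a)\rangle+\beta_k\|\phi(x,a)\|_{(\Lambda^k_h)^{-1}},\,H\},\qquad V^k_h(x)=\max_a Q^k_h(x,a),$$ and then follows a policy $\pi^k$ that is greedy with respect to $Q^k_1,\dots,Q^k_H$.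 With known local variation the bonus coefficient is, for $p\in(0,1)$, $$\beta_k=c\,dH\sqrt{\log(2dW/p)}+B_{\theta,\mathcal E}\sqrt{d(k-\tau)}+B_{\mu,\mathcal E}H\sqrt{d(k-\tau)}.$$ Theorem. There is an absolute constant $c_0>0$ such that for every $c\ge c_0$ there are constants $C>0$ and $m\in\mathbb N$, depending only on $c$, such that for every such MDP, every such $W$, every $p\in(0,1)$ and every epoch $\mathcal E$, with probability at least $1-p$, $$\sum_{k\in\mathcal E}\bigl[V^*_{1,k}(s^k_1)-V^{\pi^k}_{1,k}(s^k_1)\bigr]\le C\,\log^m(2dW/p)\,\bigl(H^{3/2}d^{3/2}W^{1/2}+B_{\theta,\mathcal E}\,dW+B_{\mu,\mathcal E}\,dHW\bigr),$$ where $V^\pi_{1,k}(x)$ is the expected total reward of episode $k$ under the policy $\pi$ from initial state $x$, and $V^*_{1,k}=\sup_\pi V^\pi_{1,k}$ over all (measurable) policies. -/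

import Mathlib

open MeasureTheory ProbabilityTheory
open scoped Matrix

/-- The Euclidean norm `‖ |ν|(S) ‖₂` of the vector `(|ν₁|(S), …, |ν_d|(S))` of total variations of
a `d`-tuple of signed measures. -/
noncomputable def tvNorm {S : Type*} [MeasurableSpace S] {d : ℕ}
    (ν : Fin d → SignedMeasure S) : ℝ :=
  ‖WithLp.toLp 2 (fun i => (ν i).totalVariation.real Set.univ)‖

/-- A nonstationary episodic linear MDP with `K` episodes of `H` steps and a `d`-dimensional
feature map. Episodes are numbered `0, …, K - 1` and steps `0, …, H - 1`; data at other indices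
is irrelevant. -/
structure LinearMDP (S A : Type*) [MeasurableSpace S] [MeasurableSpace A] (d H K : ℕ) where
  /-- the known feature map -/
  φ : S → A → EuclideanSpace ℝ (Fin d)
  /-- `θ k h`, the unknown reward parameter of step `h` of episode `k` -/
  θ : ℕ → ℕ → EuclideanSpace ℝ (Fin d)
  /-- `μ k h`, the unknown signed measures of step `h` of episode `k` -/
  μ : ℕ → ℕ → Fin d → SignedMeasure S
  /-- `P k h`, the transition kernel of step `h` of episode `k` -/
  P : ℕ → ℕ → Kernel (S × A) S
  measurable_φ : Measurable (Function.uncurry φ)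
  markov : ∀ k < K, ∀ h < H, IsMarkovKernel (P k h)
  transition_eq : ∀ k < K, ∀ h < H, ∀ (x : S) (a : A) (B : Set S), MeasurableSet B →
    (P k h (x, a)).real B = ∑ i, φ x a i * μ k h i B
  reward_mem : ∀ k < K, ∀ h < H, ∀ (x : S) (a : A), inner ℝ (φ x a) (θ k h) ∈ Set.Icc (0 : ℝ) 1
  norm_φ_le : ∀ (x : S) (a : A), ‖φ x a‖ ≤ 1
  norm_θ_le : ∀ k < K, ∀ h < H, ‖θ k h‖ ≤ Real.sqrt d
  norm_μ_le : ∀ k < K, ∀ h < H, tvNorm (μ k h) ≤ Real.sqrt d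

namespace LinearMDP

variable {S A : Type*} [MeasurableSpace S] [MeasurableSpace A] {d H K : ℕ}

/-- The (deterministic) reward function of step `h` of episode `k`. -/
noncomputable def reward (M : LinearMDP S A d H K) (k h : ℕ) (x : S) (a : A) : ℝ :=
  inner ℝ (M.φ x a) (M.θ k h)

/-! ### Value functions -/

/-- The law of the state at step `h + n` of episode `k`, when the state at step `h` is `x` and
the actions are chosen by the policy `π` (`π i` being used at step `i`). -/
noncomputable def stateLaw (M : LinearMDP S A d H K) (k : ℕ) (π : ℕ → S → A) :
    ℕ → ℕ → S → Measure S
  | _, 0, x => Measure.dirac x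
  | h, n + 1, x => (M.P k h (x, π h x)).bind (fun y => M.stateLaw k π (h + 1) n y)

/-- `V^π_{h,k}(x)`: the expected total reward collected from step `h` to the end of episode `k`,
when the state at step `h` is `x` and the policy is `π`. -/
noncomputable def value (M : LinearMDP S A d H K) (k : ℕ) (π : ℕ → S → A) (h : ℕ) (x : S) : ℝ :=
  ∑ n ∈ Finset.range (H - h),
    ∫ y, M.reward k (h + n) y (π (h + n) y) ∂(M.stateLaw k π h n x)

/-- `V^*_{h,k}(x)`: the supremum of `V^π_{h,k}(x)` over all (measurable) policies `π`. -/
noncomputable def optValue (M : LinearMDP S A d H K) (k h : ℕ) (x : S) : ℝ :=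
  ⨆ π : {π : ℕ → S → A // ∀ i, Measurable (π i)}, M.value k π.1 h x

/-! ### Epochs and local variation: `L` is the number of episodes of an epoch -/

/-- The set of episodes of the epoch that starts with episode `τ`. -/
def epoch (K L τ : ℕ) : Finset ℕ := Finset.Ico τ (min (τ + L) K)

/-- The first episode of the epoch which contains episode `k`. -/
def epochStart (L k : ℕ) : ℕ := k / L * L

/-- `B_{θ,ℰ}`: the variation of `θ` within the epoch that starts with episode `τ`. -/
noncomputable def localVarθ (M : LinearMDP S A d H K) (L τ : ℕ) : ℝ :=
  ∑ k ∈ (epoch K L τ).erase τ, ∑ h ∈ Finset.range H, ‖M.θ k h - M.θ (k - 1) h‖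

/-- `B_{μ,ℰ}`: the variation of `μ` within the epoch that starts with episode `τ`. -/
noncomputable def localVarμ (M : LinearMDP S A d H K) (L τ : ℕ) : ℝ :=
  ∑ k ∈ (epoch K L τ).erase τ, ∑ h ∈ Finset.range H, tvNorm (M.μ k h - M.μ (k - 1) h)

/-! ### The algorithm LSVI-UCB-Restart

Here `s l h` and `a l h` are the state and the action of step `h` of episode `l`. What the
algorithm computes in episode `k` depends only on the episodes `l` with `τ ≤ l < k`, where `τ` is
the first episode of the current epoch. -/

/-- The regularized Gram matrix `Λ^k_h = I + ∑_{l=τ}^{k-1} φ(s^l_h, a^l_h) φ(s^l_h, a^l_h)ᵀ`. -/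
noncomputable def gram (M : LinearMDP S A d H K) (s : ℕ → ℕ → S) (a : ℕ → ℕ → A) (τ k h : ℕ) :
    Matrix (Fin d) (Fin d) ℝ :=
  1 + ∑ l ∈ Finset.Ico τ k,
    Matrix.vecMulVec (M.φ (s l h) (a l h)).ofLp (M.φ (s l h) (a l h)).ofLp

/-- The ridge regression estimate `w^k_h`, where `V` estimates the value function of the next
step. -/
noncomputable def weight (M : LinearMDP S A d H K) (s : ℕ → ℕ → S) (a : ℕ → ℕ → A) (τ k h : ℕ)
    (V : S → ℝ) : Fin d → ℝ :=
  (M.gram s a τ k h)⁻¹ *ᵥ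
    ∑ l ∈ Finset.Ico τ k,
      (M.reward l h (s l h) (a l h) + V (s l (h + 1))) • (M.φ (s l h) (a l h)).ofLp

/-- The weighted norm `‖v‖_Λ = √(vᵀ Λ v)`. -/
noncomputable def weightedNorm (Λ : Matrix (Fin d) (Fin d) ℝ) (v : Fin d → ℝ) : ℝ :=
  Real.sqrt (v ⬝ᵥ (Λ *ᵥ v))

/-- The optimistic action-value estimate of step `h`, computed from the estimate `V` of the value
function of the next step, with bonus coefficient `β`. -/
noncomputable def qStep (M : LinearMDP S A d H K) (s : ℕ → ℕ → S) (a : ℕ → ℕ → A) (β : ℝ)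
    (τ k h : ℕ) (V : S → ℝ) (x : S) (b : A) : ℝ :=
  min (M.weight s a τ k h V ⬝ᵥ (M.φ x b).ofLp
    + β * weightedNorm (M.gram s a τ k h)⁻¹ (M.φ x b).ofLp) H

/-- The value function estimate when `n` steps remain, that is, at step `H - n`. -/
noncomputable def estVRemaining (M : LinearMDP S A d H K) (s : ℕ → ℕ → S) (a : ℕ → ℕ → A) (β : ℝ)
    (τ k : ℕ) : ℕ → S → ℝ
  | 0 => fun _ => 0
  | n + 1 => fun x => ⨆ b : A,
      M.qStep s a β τ k (H - (n + 1)) (M.estVRemaining s a β τ k n) x b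

/-- The value function estimate `V^k_h(x) = max_b Q^k_h(x, b)`, with `V^k_H = 0`. -/
noncomputable def estV (M : LinearMDP S A d H K) (s : ℕ → ℕ → S) (a : ℕ → ℕ → A) (β : ℝ)
    (τ k h : ℕ) : S → ℝ :=
  M.estVRemaining s a β τ k (H - h)

/-- The action-value function estimate `Q^k_h`. -/
noncomputable def estQ (M : LinearMDP S A d H K) (s : ℕ → ℕ → S) (a : ℕ → ℕ → A) (β : ℝ)
    (τ k h : ℕ) : S → A → ℝ :=
  M.qStep s a β τ k h (M.estV s a β τ k (h + 1))

/-- The bonus coefficient for known local variation,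
`β_k = c d H √(log (2dW/p)) + B_{θ,ℰ} √(d (k - τ)) + B_{μ,ℰ} H √(d (k - τ))`,
where `ℰ` is the epoch of `k`, `τ` is its first episode, and epochs consist of `W / H`
episodes. -/
noncomputable def bonus (M : LinearMDP S A d H K) (W : ℕ) (c p : ℝ) (k : ℕ) : ℝ :=
  c * d * H * Real.sqrt (Real.log (2 * d * W / p))
    + M.localVarθ (W / H) (epochStart (W / H) k)
        * Real.sqrt (d * ((k : ℝ) - epochStart (W / H) k))
    + M.localVarμ (W / H) (epochStart (W / H) k) * H
        * Real.sqrt (d * ((k : ℝ) - epochStart (W / H) k))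

/-- The random states `s k h` (`h ≤ H`, where `s k H` is the state that is reached after the last
step) and the random policies `π k` of the episodes `k < K` arise from running LSVI-UCB-Restart
with known local variation on the MDP `M`.

`F (k * (H + 1) + h)` is the information that is available when the state of step `h` of episode
`k` has been observed. The initial states `s k 0` are arbitrary: they may be fixed, random, or
chosen by an adversary who knows the past. -/
structure IsRun {Ω : Type*} {mΩ : MeasurableSpace Ω} (M : LinearMDP S A d H K) (W : ℕ) (c p : ℝ)
    (Pr : Measure Ω) (F : Filtration ℕ mΩ)
    (s : ℕ → ℕ → Ω → S) (π : ℕ → ℕ → Ω → S → A) : Prop where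
  /-- the states are observed in the order of the steps -/
  adapted : ∀ k < K, ∀ h ≤ H, Measurable[F (k * (H + 1) + h)] (s k h)
  /-- the policy of episode `k` is determined at the beginning of the episode -/
  measurable_policy : ∀ k < K, ∀ h < H,
    Measurable[(F (k * (H + 1))).prod inferInstance] (fun q : Ω × S => π k h q.1 q.2)
  /-- the policy is greedy with respect to the estimate `Q^k_h` (ties are broken in any way) -/
  greedy : ∀ k < K, ∀ h < H, ∀ (ω : Ω) (x : S) (b : A),
    M.estQ (fun l i => s l i ω) (fun l i => π l i ω (s l i ω)) (M.bonus W c p k)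
        (epochStart (W / H) k) k h x b
      ≤ M.estQ (fun l i => s l i ω) (fun l i => π l i ω (s l i ω)) (M.bonus W c p k)
        (epochStart (W / H) k) k h x (π k h ω x)
  /-- given the past, the next state is drawn from `P k h` at the current state and action -/
  transition : ∀ k < K, ∀ h < H, ∀ B : Set S, MeasurableSet B →
    Pr[(s k (h + 1) ⁻¹' B).indicator (fun _ => (1 : ℝ)) | F (k * (H + 1) + h)]
      =ᵐ[Pr] fun ω => (M.P k h (s k h ω, π k h ω (s k h ω))).real B

/-- The dynamic regret `∑_{k ∈ ℰ} (V^*_{1,k}(s^k_1) - V^{π^k}_{1,k}(s^k_1))` within the epoch that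
starts with episode `τ` (epochs have `L` episodes); the first step has index `0`. -/
noncomputable def epochRegret {Ω : Type*} (M : LinearMDP S A d H K) (L τ : ℕ)
    (s : ℕ → ℕ → Ω → S) (π : ℕ → ℕ → Ω → S → A) (ω : Ω) : ℝ :=
  ∑ k ∈ epoch K L τ,
    (M.optValue k 0 (s k 0 ω) - M.value k (fun h => π k h ω) 0 (s k 0 ω))

end LinearMDP

/-! If one of the two local variations exceeds 1, the bound is trivial: an epoch has at most W/H
episodes of regret at most H, so its regret is at most W, which the variation terms already
dominate. Otherwise both variations are at most 1, the bonus coefficient is polynomially bounded in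
X = 2dW/p, and optimistic least squares applies.

The Bellman backup of a bounded function is linear in φ (`inner_backupParam`), so the ridge estimate
errs by a regularization bias, by the drift of the parameters within the epoch, and by martingale
noise (`abs_weight_dotProduct_sub_le`). Since the weighted norms of n features sum to at most √(dn),
the drift costs precisely the two variation terms of the bonus. The noise is delicate because the
value estimate is built from the same data. It is controlled uniformly: value functions are
approximated from a finite grid of parameters, directions from a finite grid of vectors; each grid
point has its own exponential supermartingale (`lintegral_exp_trajGridExponent_le_one`), and a union
bound follows. Evaluating the exponent near the direction Λ⁻¹S/H², where S is the noise vector,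
turns these scalar bounds into a self-normalized one (`sq_weightedNorm_sum_le_of_grid`).

Outside an event of probability p/2 the Bellman error is thus below the bonus, and backward
induction over the steps shows that the estimates dominate the value of every policy
(`optimism_of_gridExponent_le`). The regret of an episode is then at most twice the bonuses along
its trajectory plus martingale differences (`optValue_sub_value_le`). The bonuses are summed by the
elliptical potential lemma (`sum_weightedNorm_Ico_le`), the differences by one more exponential
supermartingale, which costs the other p/2 (`measure_sum_noise_trajGap_gt_le`). -/

/-! ### Ridge-regularized Gram matrices -/

section RidgeGram

variable {ι : Type*} {d : ℕ}

theorem real_dotProduct_self_nonneg (x : Fin d → ℝ) : 0 ≤ x ⬝ᵥ x :=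
  Finset.sum_nonneg fun _ _ => mul_self_nonneg _

/-- Factoring A = BᵀB reduces this to Cauchy–Schwarz for Bx and By. -/
theorem abs_dotProduct_mulVec_le_weightedNorm {A : Matrix (Fin d) (Fin d) ℝ} (hA : A.PosSemidef)
    (x y : Fin d → ℝ) :
    |x ⬝ᵥ (A *ᵥ y)| ≤ LinearMDP.weightedNorm A x * LinearMDP.weightedNorm A y := by
  open scoped MatrixOrder Matrix.Norms.L2Operator in
  obtain ⟨B, rfl⟩ := CStarAlgebra.nonneg_iff_eq_star_mul_self.mp hA.nonneg
  have key : ∀ u v : Fin d → ℝ, u ⬝ᵥ ((star B * B) *ᵥ v) = (B *ᵥ u) ⬝ᵥ (B *ᵥ v) := by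
    intro u v
    rw [Matrix.star_eq_conjTranspose, Matrix.conjTranspose_eq_transpose_of_trivial,
      ← Matrix.mulVec_mulVec, Matrix.dotProduct_mulVec, Matrix.vecMul_transpose]
  unfold LinearMDP.weightedNorm
  rw [key, key, key, ← Real.sqrt_mul (real_dotProduct_self_nonneg (B *ᵥ x))]
  apply Real.abs_le_sqrt
  have := Finset.sum_mul_sq_le_sq_mul_sq Finset.univ (B *ᵥ x) (B *ᵥ y)
  simpa [dotProduct, sq] using this

/-- The regularized Gram matrix of a finite family of vectors. -/
noncomputable def ridgeGram (I : Finset ι) (v : ι → Fin d → ℝ) : Matrix (Fin d) (Fin d) ℝ :=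
  1 + ∑ l ∈ I, Matrix.vecMulVec (v l) (v l)

theorem ridgeGram_posDef (I : Finset ι) (v : ι → Fin d → ℝ) : (ridgeGram I v).PosDef := by
  refine Matrix.PosDef.add_posSemidef Matrix.PosDef.one (Matrix.posSemidef_sum _ fun l _ => ?_)
  simpa using Matrix.posSemidef_vecMulVec_self_star (v l)

theorem ridgeGram_isUnit_det (I : Finset ι) (v : ι → Fin d → ℝ) : IsUnit (ridgeGram I v).det :=
  (Matrix.isUnit_iff_isUnit_det _).mp (ridgeGram_posDef I v).isUnit

theorem ridgeGram_inv_posSemidef (I : Finset ι) (v : ι → Fin d → ℝ) :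
    (ridgeGram I v)⁻¹.PosSemidef :=
  (ridgeGram_posDef I v).inv.posSemidef

theorem ridgeGram_mulVec (I : Finset ι) (v : ι → Fin d → ℝ) (x : Fin d → ℝ) :
    ridgeGram I v *ᵥ x = x + ∑ l ∈ I, (v l ⬝ᵥ x) • v l := by
  rw [ridgeGram, Matrix.add_mulVec, Matrix.one_mulVec, Matrix.sum_mulVec]
  congr 1
  refine Finset.sum_congr rfl fun l _ => ?_
  rw [Matrix.vecMulVec_mulVec]
  ext i
  simp [mul_comm]

theorem dotProduct_ridgeGram_mulVec (I : Finset ι) (v : ι → Fin d → ℝ) (x : Fin d → ℝ) :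
    x ⬝ᵥ (ridgeGram I v *ᵥ x) = x ⬝ᵥ x + ∑ l ∈ I, (x ⬝ᵥ v l) ^ 2 := by
  rw [ridgeGram_mulVec, dotProduct_add, dotProduct_sum]
  congr 1
  refine Finset.sum_congr rfl fun l _ => ?_
  rw [dotProduct_smul, dotProduct_comm (v l) x, smul_eq_mul, sq]

theorem ridgeGram_mulVec_inv_mulVec (I : Finset ι) (v : ι → Fin d → ℝ) (x : Fin d → ℝ) :
    ridgeGram I v *ᵥ ((ridgeGram I v)⁻¹ *ᵥ x) = x := by
  rw [Matrix.mulVec_mulVec, Matrix.mul_nonsing_inv _ (ridgeGram_isUnit_det I v),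
    Matrix.one_mulVec]

theorem ridgeGram_inv_mulVec_mulVec (I : Finset ι) (v : ι → Fin d → ℝ) (x : Fin d → ℝ) :
    (ridgeGram I v)⁻¹ *ᵥ (ridgeGram I v *ᵥ x) = x := by
  rw [Matrix.mulVec_mulVec, Matrix.nonsing_inv_mul _ (ridgeGram_isUnit_det I v),
    Matrix.one_mulVec]

/-- With `u = Λ⁻¹ x`, the quadratic form `xᵀ Λ⁻¹ x` is `|u|² + ∑ ⟨u, v l⟩²`. -/
theorem dotProduct_ridgeGram_inv (I : Finset ι) (v : ι → Fin d → ℝ) (x : Fin d → ℝ) :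
    x ⬝ᵥ ((ridgeGram I v)⁻¹ *ᵥ x) =
      ((ridgeGram I v)⁻¹ *ᵥ x) ⬝ᵥ ((ridgeGram I v)⁻¹ *ᵥ x)
        + ∑ l ∈ I, (((ridgeGram I v)⁻¹ *ᵥ x) ⬝ᵥ v l) ^ 2 := by
  rw [← dotProduct_ridgeGram_mulVec, ridgeGram_mulVec_inv_mulVec, dotProduct_comm]

/-- With u = Λ⁻¹x, the preceding identity gives |u|² ≤ ⟨x, u⟩; expanding |x - u|² ≥ 0 does the rest.
-/
theorem dotProduct_self_ridgeGram_inv_mulVec_le (I : Finset ι) (v : ι → Fin d → ℝ)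
    (x : Fin d → ℝ) :
    ((ridgeGram I v)⁻¹ *ᵥ x) ⬝ᵥ ((ridgeGram I v)⁻¹ *ᵥ x) ≤ x ⬝ᵥ x := by
  set u := (ridgeGram I v)⁻¹ *ᵥ x with hu
  have h1 : u ⬝ᵥ u ≤ x ⬝ᵥ u := by
    rw [hu, dotProduct_ridgeGram_inv, ← hu]
    have : 0 ≤ ∑ l ∈ I, (u ⬝ᵥ v l) ^ 2 := Finset.sum_nonneg fun _ _ => sq_nonneg _
    linarith
  have h2 : 0 ≤ (x - u) ⬝ᵥ (x - u) := real_dotProduct_self_nonneg _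
  rw [sub_dotProduct, dotProduct_sub, dotProduct_sub, dotProduct_comm u x] at h2
  linarith

theorem dotProduct_ridgeGram_inv_le (I : Finset ι) (v : ι → Fin d → ℝ) (x : Fin d → ℝ) :
    x ⬝ᵥ ((ridgeGram I v)⁻¹ *ᵥ x) ≤ x ⬝ᵥ x := by
  have h1 := dotProduct_self_ridgeGram_inv_mulVec_le I v x
  set u := (ridgeGram I v)⁻¹ *ᵥ x with hu
  have h2 : 0 ≤ (x - u) ⬝ᵥ (x - u) := real_dotProduct_self_nonneg _
  rw [sub_dotProduct, dotProduct_sub, dotProduct_sub, dotProduct_comm u x] at h2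
  linarith

theorem weightedNorm_nonneg (A : Matrix (Fin d) (Fin d) ℝ) (x : Fin d → ℝ) :
    0 ≤ LinearMDP.weightedNorm A x := Real.sqrt_nonneg _

theorem sq_weightedNorm_ridgeGram_inv (I : Finset ι) (v : ι → Fin d → ℝ) (x : Fin d → ℝ) :
    LinearMDP.weightedNorm (ridgeGram I v)⁻¹ x ^ 2 = x ⬝ᵥ ((ridgeGram I v)⁻¹ *ᵥ x) := by
  refine Real.sq_sqrt ?_
  simpa using (ridgeGram_inv_posSemidef I v).dotProduct_mulVec_nonneg x

theorem weightedNorm_ridgeGram_inv_le (I : Finset ι) (v : ι → Fin d → ℝ) (x : Fin d → ℝ) :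
    LinearMDP.weightedNorm (ridgeGram I v)⁻¹ x ≤ Real.sqrt (x ⬝ᵥ x) :=
  Real.sqrt_le_sqrt (dotProduct_ridgeGram_inv_le I v x)

/-- The sum is tr(Λ⁻¹(Λ - I)) = d - tr Λ⁻¹. -/
theorem sum_sq_weightedNorm_ridgeGram_inv_le (I : Finset ι) (v : ι → Fin d → ℝ) :
    ∑ l ∈ I, LinearMDP.weightedNorm (ridgeGram I v)⁻¹ (v l) ^ 2 ≤ d := by
  have h : ∀ l ∈ I, LinearMDP.weightedNorm (ridgeGram I v)⁻¹ (v l) ^ 2 =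
      ((ridgeGram I v)⁻¹ * Matrix.vecMulVec (v l) (v l)).trace := by
    intro l _
    rw [sq_weightedNorm_ridgeGram_inv, Matrix.mul_vecMulVec, Matrix.trace_vecMulVec,
      dotProduct_comm]
  rw [Finset.sum_congr rfl h, ← Matrix.trace_sum, ← Matrix.mul_sum]
  have h2 : ∑ l ∈ I, Matrix.vecMulVec (v l) (v l) = ridgeGram I v - 1 := by
    rw [ridgeGram]; abel
  rw [h2, Matrix.mul_sub, Matrix.nonsing_inv_mul _ (ridgeGram_isUnit_det I v), Matrix.mul_one,
    Matrix.trace_sub, Matrix.trace_one, Fintype.card_fin]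
  have := (ridgeGram_inv_posSemidef I v).trace_nonneg
  linarith

/-- Cauchy–Schwarz; this is the origin of the factor √(d(k - τ)) in the drift part of the bonus. -/
theorem sum_weightedNorm_ridgeGram_inv_le (I : Finset ι) (v : ι → Fin d → ℝ) :
    ∑ l ∈ I, LinearMDP.weightedNorm (ridgeGram I v)⁻¹ (v l) ≤ Real.sqrt (d * I.card) := by
  apply Real.le_sqrt_of_sq_le
  have h := sq_sum_le_card_mul_sum_sq (s := I)
    (f := fun l => LinearMDP.weightedNorm (ridgeGram I v)⁻¹ (v l))
  have h2 := sum_sq_weightedNorm_ridgeGram_inv_le I v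
  calc _ ≤ _ := h
    _ ≤ (I.card : ℝ) * d := by gcongr
    _ = _ := mul_comm _ _

/-- The effect on a prediction of a bounded perturbation of the regression targets. -/
theorem abs_dotProduct_ridgeGram_inv_sum_smul_le (I : Finset ι) (v : ι → Fin d → ℝ)
    (x : Fin d → ℝ) (e : ι → ℝ) {b : ℝ} (hb : ∀ l ∈ I, |e l| ≤ b) (hb0 : 0 ≤ b) :
    |x ⬝ᵥ ((ridgeGram I v)⁻¹ *ᵥ ∑ l ∈ I, e l • v l)| ≤
      b * Real.sqrt (d * I.card) * LinearMDP.weightedNorm (ridgeGram I v)⁻¹ x := by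
  set N := LinearMDP.weightedNorm (ridgeGram I v)⁻¹
  rw [Matrix.mulVec_sum, dotProduct_sum]
  calc _ ≤ ∑ l ∈ I, |x ⬝ᵥ ((ridgeGram I v)⁻¹ *ᵥ (e l • v l))| := Finset.abs_sum_le_sum_abs _ _
    _ ≤ ∑ l ∈ I, b * (N x * N (v l)) := by
      refine Finset.sum_le_sum fun l hl => ?_
      rw [Matrix.mulVec_smul, dotProduct_smul, smul_eq_mul, abs_mul]
      exact mul_le_mul (hb l hl)
        (abs_dotProduct_mulVec_le_weightedNorm (ridgeGram_inv_posSemidef I v) _ _)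
        (abs_nonneg _) hb0
    _ = b * N x * ∑ l ∈ I, N (v l) := by
      rw [Finset.mul_sum]; exact Finset.sum_congr rfl fun _ _ => by ring
    _ ≤ b * N x * Real.sqrt (d * I.card) := by
      gcongr
      · exact mul_nonneg hb0 (weightedNorm_nonneg _ _)
      · exact sum_weightedNorm_ridgeGram_inv_le I v
    _ = _ := by ring

theorem dotProduct_self_le_one_of_apply {x : Fin d → ℝ} (hx : x ⬝ᵥ x ≤ 1) (i : Fin d) :
    |x i| ≤ 1 := by
  rw [abs_le_one_iff_mul_self_le_one]
  refine le_trans ?_ hx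
  exact Finset.single_le_sum (f := fun i => x i * x i) (fun j _ => mul_self_nonneg (x j))
    (Finset.mem_univ i)

theorem abs_apply_le_sqrt_dotProduct_self (x : Fin d → ℝ) (i : Fin d) :
    |x i| ≤ Real.sqrt (x ⬝ᵥ x) := by
  apply Real.abs_le_sqrt
  rw [sq]
  exact Finset.single_le_sum (f := fun i => x i * x i) (fun j _ => mul_self_nonneg (x j))
    (Finset.mem_univ i)

/-- Keeps the bonus matrices Λ⁻¹ in a bounded box, so that a finite grid covers them. -/
theorem abs_ridgeGram_inv_apply_le (I : Finset ι) (v : ι → Fin d → ℝ) (i j : Fin d) :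
    |(ridgeGram I v)⁻¹ i j| ≤ 1 := by
  have h := dotProduct_self_ridgeGram_inv_mulVec_le I v (Pi.single j 1)
  have h2 : (Pi.single j (1 : ℝ) : Fin d → ℝ) ⬝ᵥ Pi.single j 1 = 1 := by simp
  have := dotProduct_self_le_one_of_apply (h.trans_eq h2) i
  simpa [Matrix.mulVec_single_one] using this

/-! ### The elliptical potential lemma -/

theorem ridgeGram_det_pos (I : Finset ι) (v : ι → Fin d → ℝ) : 0 < (ridgeGram I v).det :=
  (ridgeGram_posDef I v).det_pos

/-- The matrix determinant lemma for a rank-one update. -/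
theorem ridgeGram_det_insert [DecidableEq ι] (I : Finset ι) (v : ι → Fin d → ℝ) {l : ι} (hl : l ∉ I) :
    (ridgeGram (insert l I) v).det =
      (ridgeGram I v).det * (1 + LinearMDP.weightedNorm (ridgeGram I v)⁻¹ (v l) ^ 2) := by
  have h : ridgeGram (insert l I) v =
      ridgeGram I v + Matrix.replicateCol Unit (v l) * Matrix.replicateRow Unit (v l) := by
    rw [ridgeGram, ridgeGram, Finset.sum_insert hl, Matrix.vecMulVec_eq Unit]
    abel
  rw [h, Matrix.det_add_replicateCol_mul_replicateRow (ridgeGram_isUnit_det I v),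
    sq_weightedNorm_ridgeGram_inv]
  congr 1
  rw [Matrix.det_unique, Matrix.add_apply, Matrix.one_apply_eq, Matrix.mul_assoc,
    ← Matrix.replicateCol_mulVec, Matrix.replicateRow_mul_replicateCol_apply]

/-- Every eigenvalue is at most the trace. This is crude, but only the logarithm of the determinant
matters. -/
theorem ridgeGram_det_le (I : Finset ι) (v : ι → Fin d → ℝ) (hv : ∀ l ∈ I, v l ⬝ᵥ v l ≤ 1) :
    (ridgeGram I v).det ≤ (d + I.card) ^ d := by
  have hH := (ridgeGram_posDef I v).isHermitian
  have htr : (ridgeGram I v).trace ≤ d + I.card := by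
    rw [ridgeGram, Matrix.trace_add, Matrix.trace_one, Fintype.card_fin, Matrix.trace_sum]
    have : ∑ l ∈ I, (Matrix.vecMulVec (v l) (v l)).trace ≤ ∑ l ∈ I, (1 : ℝ) :=
      Finset.sum_le_sum fun l hl => by rw [Matrix.trace_vecMulVec]; exact hv l hl
    simp only [Finset.sum_const, nsmul_eq_mul, mul_one] at this
    linarith
  have hnn : ∀ i, 0 ≤ hH.eigenvalues i := fun i =>
    (ridgeGram_posDef I v).posSemidef.eigenvalues_nonneg i
  have hle : ∀ i, hH.eigenvalues i ≤ d + I.card := by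
    intro i
    refine le_trans ?_ htr
    rw [hH.trace_eq_sum_eigenvalues]
    exact Finset.single_le_sum (f := fun i => hH.eigenvalues i) (fun j _ => hnn j)
      (Finset.mem_univ i)
  rw [hH.det_eq_prod_eigenvalues]
  calc _ ≤ ∏ _i : Fin d, ((d : ℝ) + I.card) :=
        Finset.prod_le_prod (fun i _ => hnn i) (fun i _ => hle i)
    _ = _ := by simp

/-- By the rank-one update formula, log det grows by log(1 + q) with each vector, so the logarithms
telescope from det I = 1. -/
theorem sum_sq_weightedNorm_Ico_le (v : ℕ → Fin d → ℝ) (hv : ∀ l, v l ⬝ᵥ v l ≤ 1) (τ n : ℕ)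
    (hτ : τ ≤ n) :
    ∑ k ∈ Finset.Ico τ n, LinearMDP.weightedNorm (ridgeGram (Finset.Ico τ k) v)⁻¹ (v k) ^ 2 ≤
      2 * Real.log (ridgeGram (Finset.Ico τ n) v).det := by
  induction n, hτ using Nat.le_induction with
  | base => simp [ridgeGram]
  | succ n hn ih =>
    have hnot : n ∉ Finset.Ico τ n := by simp
    rw [Finset.sum_Ico_succ_top hn]
    have hins : Finset.Ico τ (n + 1) = insert n (Finset.Ico τ n) := by
      ext; simp only [Finset.mem_Ico, Finset.mem_insert]; omega
    rw [hins, ridgeGram_det_insert _ _ hnot]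
    set q := LinearMDP.weightedNorm (ridgeGram (Finset.Ico τ n) v)⁻¹ (v n) ^ 2 with hq
    have hq0 : 0 ≤ q := sq_nonneg _
    have hq1 : q ≤ 1 := by
      rw [hq, sq_weightedNorm_ridgeGram_inv]
      exact (dotProduct_ridgeGram_inv_le _ _ _).trans (hv n)
    rw [Real.log_mul (ridgeGram_det_pos _ _).ne' (by positivity)]
    -- Since q ≤ 1, q/2 ≤ q/(1 + q) = 1 - 1/(1 + q) ≤ log(1 + q).
    have hlog : q ≤ 2 * Real.log (1 + q) := by
      have h := Real.one_sub_inv_le_log_of_pos (x := 1 + q) (by positivity)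
      have h3 : q / 2 ≤ 1 - (1 + q)⁻¹ := by
        rw [show 1 - (1 + q)⁻¹ = q / (1 + q) by field_simp; ring]
        gcongr
        linarith
      linarith
    linarith

theorem sum_weightedNorm_Ico_le (v : ℕ → Fin d → ℝ) (hv : ∀ l, v l ⬝ᵥ v l ≤ 1) {τ n : ℕ}
    (hτ : τ ≤ n) :
    ∑ k ∈ Finset.Ico τ n, LinearMDP.weightedNorm (ridgeGram (Finset.Ico τ k) v)⁻¹ (v k) ≤
      Real.sqrt ((n - τ : ℕ) * (2 * (d * Real.log (d + (n - τ : ℕ))))) := by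
  apply Real.le_sqrt_of_sq_le
  have h := sq_sum_le_card_mul_sum_sq (s := Finset.Ico τ n)
    (f := fun k => LinearMDP.weightedNorm (ridgeGram (Finset.Ico τ k) v)⁻¹ (v k))
  rw [Nat.card_Ico] at h
  refine h.trans ?_
  gcongr
  refine (sum_sq_weightedNorm_Ico_le v hv τ n hτ).trans ?_
  gcongr
  have h2 := ridgeGram_det_le (Finset.Ico τ n) v (fun l _ => hv l)
  rw [Nat.card_Ico] at h2
  calc _ ≤ Real.log (((d : ℝ) + (n - τ : ℕ)) ^ d) := Real.log_le_log (ridgeGram_det_pos _ _) h2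
    _ = _ := by rw [Real.log_pow]

end RidgeGram

/-! ### Integrals against signed measures -/

section SignedIntegral

variable {S : Type*} [MeasurableSpace S]

theorem integrable_of_abs_le {m : Measure S} [IsFiniteMeasure m] {f : S → ℝ} (hf : Measurable f)
    {b : ℝ} (hb : ∀ x, |f x| ≤ b) : Integrable f m :=
  Integrable.of_bound hf.aestronglyMeasurable b (Filter.Eventually.of_forall hb)

/-- A linear relation between finite measures is inherited by the integrals of bounded functions. -/
theorem sum_mul_integral_eq_zero {ι : Type*} (I : Finset ι) (c : ι → ℝ) (m : ι → Measure S)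
    [∀ i, IsFiniteMeasure (m i)]
    (h : ∀ B, MeasurableSet B → ∑ i ∈ I, c i * (m i).real B = 0) {f : S → ℝ} (hf : Measurable f)
    {b : ℝ} (hb : ∀ x, |f x| ≤ b) : ∑ i ∈ I, c i * ∫ x, f x ∂(m i) = 0 := by
  have hc : ∀ i, c i = ((c i).toNNReal : ℝ) - ((-c i).toNNReal : ℝ) := fun i => by
    rw [Real.coe_toNNReal', Real.coe_toNNReal', max_zero_sub_max_neg_zero_eq_self]
  -- Moving the negative coefficients to the other side turns the relation into an equality of two
  -- genuine measures, which can be integrated.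
  have heq : ∑ i ∈ I, (c i).toNNReal • m i = ∑ i ∈ I, (-c i).toNNReal • m i := by
    ext B hB
    rw [← measureReal_eq_measureReal_iff]
    have h1 := h B hB
    have hsum : ∀ a : ι → NNReal,
        (∑ i ∈ I, a i • m i).real B = ∑ i ∈ I, (a i : ℝ) * (m i).real B := by
      intro a
      rw [measureReal_def, Measure.finsetSum_apply, ENNReal.toReal_sum]
      · refine Finset.sum_congr rfl fun i _ => ?_
        simp [measureReal_def]
      · intro i _
        exact measure_ne_top _ _
    rw [hsum, hsum, ← sub_eq_zero, ← Finset.sum_sub_distrib, ← h1]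
    refine Finset.sum_congr rfl fun i _ => ?_
    rw [← sub_mul, ← hc]
  have hint : ∀ a : ι → NNReal, ∫ x, f x ∂(∑ i ∈ I, a i • m i) =
      ∑ i ∈ I, (a i : ℝ) * ∫ x, f x ∂(m i) := by
    intro a
    rw [integral_finsetSum_measure fun i _ => integrable_of_abs_le hf hb]
    refine Finset.sum_congr rfl fun i _ => ?_
    rw [integral_smul_nnreal_measure]; rfl
  have h2 := congrArg (fun m => ∫ x, f x ∂m) heq
  simp only [hint] at h2
  rw [← sub_eq_zero, ← Finset.sum_sub_distrib] at h2
  rw [← h2]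
  refine Finset.sum_congr rfl fun i _ => ?_
  rw [← sub_mul, ← hc]

/-- The integral of a bounded measurable function against a signed measure. -/
noncomputable def signedIntegral (ν : SignedMeasure S) (f : S → ℝ) : ℝ :=
  ∫ x, f x ∂ν.toJordanDecomposition.posPart - ∫ x, f x ∂ν.toJordanDecomposition.negPart

/-- The Jordan decomposition is not additive, but the six Jordan parts involved satisfy a linear
relation on sets, and hence on integrals. -/
theorem signedIntegral_sub (ν₁ ν₂ : SignedMeasure S) {f : S → ℝ} (hf : Measurable f)
    {b : ℝ} (hb : ∀ x, |f x| ≤ b) :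
    signedIntegral (ν₁ - ν₂) f = signedIntegral ν₁ f - signedIntegral ν₂ f := by
  let m : Fin 6 → Measure S :=
    ![(ν₁ - ν₂).toJordanDecomposition.posPart, (ν₁ - ν₂).toJordanDecomposition.negPart,
      ν₁.toJordanDecomposition.posPart, ν₁.toJordanDecomposition.negPart,
      ν₂.toJordanDecomposition.posPart, ν₂.toJordanDecomposition.negPart]
  have hm : ∀ i, IsFiniteMeasure (m i) := by
    intro i; fin_cases i <;> simp [m] <;> infer_instance
  have h := sum_mul_integral_eq_zero Finset.univ ![1, -1, -1, 1, 1, -1] m ?_ hf hb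
  · simp only [Fin.sum_univ_six] at h
    simp only [m, Matrix.cons_val] at h
    simp only [signedIntegral]
    linarith
  · intro B hB
    have h0 := (ν₁ - ν₂).apply_eq_posPart_real_sub_negPart_real hB
    have h1 := ν₁.apply_eq_posPart_real_sub_negPart_real hB
    have h2 := ν₂.apply_eq_posPart_real_sub_negPart_real hB
    have h3 : (ν₁ - ν₂) B = ν₁ B - ν₂ B := by simp
    simp only [Fin.sum_univ_six, m, Matrix.cons_val]
    linarith

theorem abs_signedIntegral_le (ν : SignedMeasure S) {f : S → ℝ}
    {b : ℝ} (hb : ∀ x, |f x| ≤ b) :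
    |signedIntegral ν f| ≤ b * ν.totalVariation.real Set.univ := by
  have h : ∀ m : Measure S, IsFiniteMeasure m → |∫ x, f x ∂m| ≤ b * m.real Set.univ := by
    intro m _
    simpa using norm_integral_le_of_norm_le_const (μ := m) (f := f) (C := b)
      (Filter.Eventually.of_forall hb)
  rw [SignedMeasure.totalVariation, measureReal_add_apply, mul_add]
  exact (abs_sub _ _).trans (add_le_add (h _ inferInstance) (h _ inferInstance))

/-- A finite measure which is a linear combination of signed measures. -/
theorem integral_eq_sum_mul_signedIntegral {d : ℕ} (m : Measure S) [IsFiniteMeasure m]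
    (c : Fin d → ℝ) (ν : Fin d → SignedMeasure S)
    (h : ∀ B, MeasurableSet B → m.real B = ∑ i, c i * ν i B) {f : S → ℝ} (hf : Measurable f)
    {b : ℝ} (hb : ∀ x, |f x| ≤ b) :
    ∫ x, f x ∂m = ∑ i, c i * signedIntegral (ν i) f := by
  let m' : Unit ⊕ Fin d ⊕ Fin d → Measure S := Sum.elim (fun _ => m)
    (Sum.elim (fun i => (ν i).toJordanDecomposition.posPart)
      (fun i => (ν i).toJordanDecomposition.negPart))
  have : ∀ i, IsFiniteMeasure (m' i) := by
    rintro (_ | _ | _) <;> simp only [m', Sum.elim_inl, Sum.elim_inr] <;> infer_instance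
  have key := sum_mul_integral_eq_zero Finset.univ
    (Sum.elim (fun _ => 1) (Sum.elim (fun i => - c i) c)) m' ?_ hf hb
  · simp only [Fintype.sum_sum_type, Sum.elim_inl, Sum.elim_inr, m', Finset.univ_unique,
      Finset.sum_const, Finset.card_singleton, one_smul, one_mul] at key
    simp only [signedIntegral, mul_sub, Finset.sum_sub_distrib]
    simp only [neg_mul, Finset.sum_neg_distrib] at key
    linarith
  · intro B hB
    simp only [Fintype.sum_sum_type, Sum.elim_inl, Sum.elim_inr, m', Finset.univ_unique,
      Finset.sum_const, Finset.card_singleton, one_smul, one_mul]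
    rw [h B hB]
    simp only [(ν _).apply_eq_posPart_real_sub_negPart_real hB, mul_sub, Finset.sum_sub_distrib,
      neg_mul, Finset.sum_neg_distrib]
    ring

/-- The vector of the integrals of `f` against a tuple of signed measures. -/
noncomputable def signedIntegralVec {d : ℕ} (ν : Fin d → SignedMeasure S) (f : S → ℝ) :
    EuclideanSpace ℝ (Fin d) :=
  WithLp.toLp 2 fun i => signedIntegral (ν i) f

theorem norm_signedIntegralVec_le {d : ℕ} (ν : Fin d → SignedMeasure S) {f : S → ℝ}
    {b : ℝ} (hb0 : 0 ≤ b) (hb : ∀ x, |f x| ≤ b) : ‖signedIntegralVec ν f‖ ≤ b * tvNorm ν := by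
  have h : b * tvNorm ν = ‖b • (WithLp.toLp 2 (fun i => (ν i).totalVariation.real Set.univ) :
      EuclideanSpace ℝ (Fin d))‖ := by
    rw [norm_smul, Real.norm_of_nonneg hb0, tvNorm]
  rw [h, EuclideanSpace.norm_eq, EuclideanSpace.norm_eq]
  refine Real.sqrt_le_sqrt (Finset.sum_le_sum fun i _ => ?_)
  gcongr
  refine (abs_signedIntegral_le (ν i) hb).trans ?_
  simpa using le_abs_self (b * (ν i).totalVariation.real Set.univ)

theorem signedIntegralVec_sub {d : ℕ} (ν₁ ν₂ : Fin d → SignedMeasure S) {f : S → ℝ}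
    (hf : Measurable f) {b : ℝ} (hb : ∀ x, |f x| ≤ b) :
    signedIntegralVec (ν₁ - ν₂) f = signedIntegralVec ν₁ f - signedIntegralVec ν₂ f := by
  ext i
  exact signedIntegral_sub (ν₁ i) (ν₂ i) hf hb

end SignedIntegral

/-! ### Exponential supermartingales -/

section Concentration

open scoped ENNReal

/-- If `κ (X ω)` is the conditional distribution of `Y` given `X`, then `Y` can be integrated out. -/
theorem lintegral_comp_eq_lintegral_kernel {Ω Ω' S : Type*} [MeasurableSpace Ω]
    [MeasurableSpace Ω'] [MeasurableSpace S] {Pr : Measure Ω} [IsProbabilityMeasure Pr]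
    {X : Ω → Ω'} (hX : Measurable X) {Y : Ω → S} (hY : Measurable Y)
    (κ : Kernel Ω' S) [IsMarkovKernel κ]
    (h : ∀ A B, MeasurableSet A → MeasurableSet B →
      Pr (X ⁻¹' A ∩ Y ⁻¹' B) = ∫⁻ ω in X ⁻¹' A, κ (X ω) B ∂Pr)
    {G : Ω' × S → ℝ≥0∞} (hG : Measurable G) :
    ∫⁻ ω, G (X ω, Y ω) ∂Pr = ∫⁻ ω, ∫⁻ y, G (X ω, y) ∂κ (X ω) ∂Pr := by
  have := Measure.isProbabilityMeasure_map (μ := Pr) hX.aemeasurable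
  have := Measure.isProbabilityMeasure_map (μ := Pr) (hX.prodMk hY).aemeasurable
  have heq : Pr.map (fun ω => (X ω, Y ω)) = (Pr.map X) ⊗ₘ κ := by
    refine Measure.ext_prod fun {A B} hA hB => ?_
    rw [Measure.map_apply (hX.prodMk hY) (hA.prod hB), Measure.compProd_apply_prod hA hB,
      setLIntegral_map hA (κ.measurable_coe hB) hX, ← h A B hA hB]
    rfl
  rw [← lintegral_map hG (hX.prodMk hY), heq, Measure.lintegral_compProd hG,
    lintegral_map _ hX]
  exact hG.lintegral_kernel_prod_right'

/-- **Hoeffding's lemma** for a function bounded by `u`, as a bound for a lower integral. -/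
theorem lintegral_exp_sub_integral_le_one {S : Type*} [MeasurableSpace S] (ν : Measure S)
    [IsProbabilityMeasure ν] {g : S → ℝ} (hg : Measurable g) {u : ℝ} (hu : ∀ y, |g y| ≤ u) :
    ∫⁻ y, ENNReal.ofReal (Real.exp (g y - ∫ z, g z ∂ν - u ^ 2 / 2)) ∂ν ≤ 1 := by
  have hsub := hasSubgaussianMGF_of_mem_Icc (μ := ν) (X := g) (a := -u) (b := u)
    hg.aemeasurable (Filter.Eventually.of_forall fun y => abs_le.mp (hu y))
  have hint := hsub.integrable_exp_mul 1
  have hmgf := hsub.mgf_le 1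
  -- An interval of length 2u has sub-Gaussian variance proxy (2u/2)² = u².
  have hc : (((‖u - -u‖₊ / 2) ^ 2 : NNReal) : ℝ) = u ^ 2 := by
    push_cast
    rw [Real.norm_eq_abs, div_pow, sq_abs]
    ring
  rw [hc, mgf] at hmgf
  simp only [one_mul, one_pow, mul_one] at hmgf hint
  have hfac : ∀ y, Real.exp (g y - ∫ z, g z ∂ν - u ^ 2 / 2) =
      Real.exp (g y - ∫ z, g z ∂ν) * Real.exp (-(u ^ 2 / 2)) := fun y => by
    rw [← Real.exp_add]; ring_nf
  simp_rw [hfac]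
  rw [← ofReal_integral_eq_lintegral_ofReal (hint.mul_const _)
    (Filter.Eventually.of_forall fun y => by positivity), integral_mul_const]
  rw [← ENNReal.ofReal_one]
  apply ENNReal.ofReal_le_ofReal
  calc _ ≤ Real.exp (u ^ 2 / 2) * Real.exp (-(u ^ 2 / 2)) := by gcongr
    _ = 1 := by rw [← Real.exp_add]; simp

/-- The increment of an exponential supermartingale. -/
theorem lintegral_mul_exp_le_of_kernel {Ω Ω' S : Type*} [MeasurableSpace Ω]
    [MeasurableSpace Ω'] [MeasurableSpace S] {Pr : Measure Ω} [IsProbabilityMeasure Pr]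
    {X : Ω → Ω'} (hX : Measurable X) {Y : Ω → S} (hY : Measurable Y)
    (κ : Kernel Ω' S) [IsMarkovKernel κ]
    (h : ∀ A B, MeasurableSet A → MeasurableSet B →
      Pr (X ⁻¹' A ∩ Y ⁻¹' B) = ∫⁻ ω in X ⁻¹' A, κ (X ω) B ∂Pr)
    {g : Ω' × S → ℝ} (hg : Measurable g) {u : Ω' → ℝ} (hu : Measurable u)
    (hgu : ∀ x y, |g (x, y)| ≤ u x) {G : Ω' → ℝ≥0∞} (hG : Measurable G) :
    ∫⁻ ω, G (X ω) * ENNReal.ofReal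
        (Real.exp (g (X ω, Y ω) - ∫ y, g (X ω, y) ∂κ (X ω) - u (X ω) ^ 2 / 2)) ∂Pr
      ≤ ∫⁻ ω, G (X ω) ∂Pr := by
  have hI : Measurable fun x => ∫ y, g (x, y) ∂κ x :=
    (hg.stronglyMeasurable.integral_kernel_prod_right' (κ := κ)).measurable
  have hm : Measurable fun q : Ω' × S => G q.1 * ENNReal.ofReal
      (Real.exp (g q - ∫ y, g (q.1, y) ∂κ q.1 - u q.1 ^ 2 / 2)) := by
    have := hI.comp (measurable_fst : Measurable (Prod.fst : Ω' × S → Ω'))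
    have h2 := hG.comp (measurable_fst : Measurable (Prod.fst : Ω' × S → Ω'))
    have h3 := hu.comp (measurable_fst : Measurable (Prod.fst : Ω' × S → Ω'))
    exact h2.mul (((hg.sub this).sub ((h3.pow_const 2).div_const 2)).exp.ennreal_ofReal)
  rw [lintegral_comp_eq_lintegral_kernel hX hY κ h hm]
  refine lintegral_mono fun ω => ?_
  have hgω : Measurable fun y => g (X ω, y) := hg.comp measurable_prodMk_left
  simp only
  rw [lintegral_const_mul]
  · calc _ ≤ G (X ω) * 1 := by
          gcongr
          exact lintegral_exp_sub_integral_le_one (κ (X ω)) hgω (hgu (X ω))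
      _ = _ := mul_one _
  · exact ((hgω.sub_const _).sub_const _).exp.ennreal_ofReal

/-- The increment of an exponential supermartingale, for a sub-σ-algebra. -/
theorem lintegral_mul_exp_le_of_condExp {Ω S T : Type*} {m mΩ : MeasurableSpace Ω} (hm : m ≤ mΩ)
    [MeasurableSpace S] [MeasurableSpace T] {Pr : @Measure Ω mΩ} [IsProbabilityMeasure Pr]
    {Y : Ω → S} (hY : Measurable[mΩ] Y) (P : Kernel T S) [IsMarkovKernel P] {Z : Ω → T}
    (hZ : Measurable[m] Z)
    (h : ∀ B, MeasurableSet B → Pr[(Y ⁻¹' B).indicator (fun _ => (1 : ℝ)) | m]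
      =ᵐ[Pr] fun ω => (P (Z ω)).real B)
    {g : Ω × S → ℝ} (hg : Measurable[m.prod inferInstance] g) {u : Ω → ℝ} (hu : Measurable[m] u)
    (hgu : ∀ x y, |g (x, y)| ≤ u x) {G : Ω → ℝ≥0∞} (hG : Measurable[m] G) :
    ∫⁻ ω, G ω * ENNReal.ofReal
        (Real.exp (g (ω, Y ω) - ∫ y, g (ω, y) ∂P (Z ω) - u ω ^ 2 / 2)) ∂Pr
      ≤ ∫⁻ ω, G ω ∂Pr := by
  -- The identity from (Ω, mΩ) to (Ω, m) serves as the conditioning variable, so that ω ↦ P (Z ω)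
  -- becomes a kernel from (Ω, m).
  have hXm : @Measurable Ω Ω mΩ m id := fun s hs => hm s hs
  refine @lintegral_mul_exp_le_of_kernel Ω Ω S mΩ m _ Pr _ id hXm Y hY
    (P.comap Z hZ) (Kernel.IsMarkovKernel.comap P hZ)
    ?_ g hg u hu hgu G hG
  intro A B hA hB
  have hYB : MeasurableSet[mΩ] (Y ⁻¹' B) := hY hB
  have hint : Integrable ((Y ⁻¹' B).indicator (fun _ => (1 : ℝ))) Pr :=
    (integrable_const _).indicator hYB
  have h1 := setIntegral_condExp hm hint hA
  rw [setIntegral_congr_ae (hm A hA) ((h B hB).mono fun ω hω _ => hω),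
    setIntegral_indicator hYB, setIntegral_const, smul_eq_mul, mul_one] at h1
  simp only [Set.preimage_id, id]
  have h2 : Pr (A ∩ Y ⁻¹' B) = ENNReal.ofReal (∫ ω in A, (P (Z ω)).real B ∂Pr) := by
    rw [h1, measureReal_def, ENNReal.ofReal_toReal (measure_ne_top _ _)]
  have hmeas : Measurable[mΩ] fun ω => (P (Z ω)) B := by
    have h3 : Measurable[m] fun ω => (P (Z ω)) B := (P.measurable_coe hB).comp hZ
    exact h3.mono hm le_rfl
  rw [h2, ofReal_integral_eq_lintegral_ofReal]
  · refine lintegral_congr fun ω => ?_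
    rw [measureReal_def, ENNReal.ofReal_toReal (measure_ne_top _ _)]
    rfl
  · refine Integrable.of_bound hmeas.ennreal_toReal.aestronglyMeasurable 1
      (Filter.Eventually.of_forall fun ω => ?_)
    rw [Real.norm_of_nonneg measureReal_nonneg]
    exact measureReal_le_one
  · exact Filter.Eventually.of_forall fun ω => measureReal_nonneg

/-- A product of conditionally bounded exponential increments, arranged in rows of length `H`. -/
theorem lintegral_exp_sum_sum_le_one {Ω : Type*} {mΩ : MeasurableSpace Ω} {Pr : Measure Ω}
    [IsProbabilityMeasure Pr] (F : Filtration ℕ mΩ) {H K : ℕ} (D : ℕ → ℕ → Ω → ℝ)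
    (hD : ∀ k < K, ∀ h < H, Measurable[F (k * (H + 1) + h + 1)] (D k h))
    (hstep : ∀ k < K, ∀ h < H, ∀ G : Ω → ℝ≥0∞, Measurable[F (k * (H + 1) + h)] G →
      ∫⁻ ω, G ω * ENNReal.ofReal (Real.exp (D k h ω)) ∂Pr ≤ ∫⁻ ω, G ω ∂Pr)
    {τ n : ℕ} (hn : n ≤ K) :
    ∫⁻ ω, ENNReal.ofReal (Real.exp
      (∑ k ∈ Finset.Ico τ n, ∑ h ∈ Finset.range H, D k h ω)) ∂Pr ≤ 1 := by
  have hrow : ∀ k < K, ∀ j ≤ H,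
      Measurable[F (k * (H + 1) + j)] fun ω => ∑ h ∈ Finset.range j, D k h ω := by
    intro k hk j hj
    refine Finset.measurable_fun_sum (m := F (k * (H + 1) + j)) _ fun h hh => ?_
    have hlt := Finset.mem_range.mp hh
    exact (hD k hk h (by omega)).mono (F.mono (by omega)) le_rfl
  rcases le_total n τ with hle | hle
  · simp [Finset.Ico_eq_empty_of_le hle]
  induction n, hle using Nat.le_induction with
  | base => simp
  | succ n hτn ih =>
    have ih := ih (by omega)
    have hpast : Measurable[F (n * (H + 1))] fun ω =>
        ∑ k ∈ Finset.Ico τ n, ∑ h ∈ Finset.range H, D k h ω := by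
      refine Finset.measurable_fun_sum (m := F (n * (H + 1))) _ fun k hk => ?_
      have hlt := (Finset.mem_Ico.mp hk).2
      refine (hrow k (by omega) H le_rfl).mono (F.mono ?_) le_rfl
      nlinarith
    have key : ∀ j ≤ H, ∫⁻ ω, ENNReal.ofReal (Real.exp
        (∑ k ∈ Finset.Ico τ n, ∑ h ∈ Finset.range H, D k h ω
          + ∑ h ∈ Finset.range j, D n h ω)) ∂Pr ≤ 1 := by
      intro j
      induction j with
      | zero => intro _; simpa using ih
      | succ j ihj =>
        intro hj
        refine le_trans ?_ (ihj (by omega))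
        have hG : Measurable[F (n * (H + 1) + j)] fun ω => ENNReal.ofReal (Real.exp
            (∑ k ∈ Finset.Ico τ n, ∑ h ∈ Finset.range H, D k h ω
              + ∑ h ∈ Finset.range j, D n h ω)) := by
          have h1 := hpast.mono (F.mono (show n * (H + 1) ≤ n * (H + 1) + j by omega)) le_rfl
          have h2 := hrow n (by omega) j (by omega)
          exact (Measurable.add h1 h2).exp.ennreal_ofReal
        refine le_trans (le_of_eq ?_) (hstep n (by omega) j (by omega) _ hG)
        refine lintegral_congr fun ω => ?_
        rw [Finset.sum_range_succ, ← add_assoc, Real.exp_add, ENNReal.ofReal_mul (by positivity)]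
    have := key H le_rfl
    refine le_trans (le_of_eq ?_) this
    refine lintegral_congr fun ω => ?_
    rw [Finset.sum_Ico_succ_top hτn]

/-- A union of Chernoff bounds. -/
theorem measure_exists_lt_le_of_lintegral_exp_le_one {Ω ι : Type*} [MeasurableSpace Ω]
    {Pr : Measure Ω} (I : Finset ι) (Z : ι → Ω → ℝ)
    (hZ : ∀ i ∈ I, Measurable (Z i))
    (hint : ∀ i ∈ I, ∫⁻ ω, ENNReal.ofReal (Real.exp (Z i ω)) ∂Pr ≤ 1) {t δ : ℝ}
    (hδ : I.card * Real.exp (-t) ≤ δ) :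
    Pr {ω | ∃ i ∈ I, t < Z i ω} ≤ ENNReal.ofReal δ := by
  have h1 : ∀ i ∈ I, Pr {ω | t < Z i ω} ≤ ENNReal.ofReal (Real.exp (-t)) := by
    intro i hi
    have hmark := meas_ge_le_lintegral_div (μ := Pr)
      (f := fun ω => ENNReal.ofReal (Real.exp (Z i ω)))
      (hZ i hi).exp.ennreal_ofReal.aemeasurable (ε := ENNReal.ofReal (Real.exp t))
      (by simp [Real.exp_pos]) ENNReal.ofReal_ne_top
    calc Pr {ω | t < Z i ω}
        ≤ Pr {ω | ENNReal.ofReal (Real.exp t) ≤ ENNReal.ofReal (Real.exp (Z i ω))} := by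
          refine measure_mono fun ω hω => ?_
          exact ENNReal.ofReal_le_ofReal (Real.exp_le_exp.mpr (le_of_lt hω))
      _ ≤ _ := hmark
      _ ≤ 1 / ENNReal.ofReal (Real.exp t) := by gcongr; exact hint i hi
      _ = _ := by
        rw [Real.exp_neg, ENNReal.ofReal_inv_of_pos (Real.exp_pos t), one_div]
  have h2 : {ω | ∃ i ∈ I, t < Z i ω} = ⋃ i ∈ I, {ω | t < Z i ω} := by
    ext ω; simp
  rw [h2]
  calc _ ≤ ∑ i ∈ I, Pr {ω | t < Z i ω} := measure_biUnion_finset_le _ _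
    _ ≤ ∑ _i ∈ I, ENNReal.ofReal (Real.exp (-t)) := Finset.sum_le_sum h1
    _ = ENNReal.ofReal (I.card * Real.exp (-t)) := by
      rw [Finset.sum_const, nsmul_eq_mul, ENNReal.ofReal_mul (by positivity),
        ENNReal.ofReal_natCast]
    _ ≤ _ := ENNReal.ofReal_le_ofReal hδ

end Concentration

namespace LinearMDP

/-! ### Value functions: Bellman equation, bounds, measurability -/

section Value

variable {S A : Type*} [MeasurableSpace S] [MeasurableSpace A] {d H K : ℕ}
  (M : LinearMDP S A d H K) {k : ℕ} {π : ℕ → S → A}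

theorem measurable_reward (k h : ℕ) : Measurable fun q : S × A => M.reward k h q.1 q.2 :=
  M.measurable_φ.inner_const

theorem measurable_reward_policy {h : ℕ} (hπ : Measurable (π h)) :
    Measurable fun x => M.reward k h x (π h x) :=
  (M.measurable_reward k h).comp (measurable_id.prodMk hπ)

theorem reward_nonneg (hk : k < K) {h : ℕ} (hh : h < H) (x : S) (a : A) : 0 ≤ M.reward k h x a :=
  (M.reward_mem k hk h hh x a).1

theorem reward_le_one (hk : k < K) {h : ℕ} (hh : h < H) (x : S) (a : A) : M.reward k h x a ≤ 1 :=
  (M.reward_mem k hk h hh x a).2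

theorem abs_reward_le_one (hk : k < K) {h : ℕ} (hh : h < H) (x : S) (a : A) :
    |M.reward k h x a| ≤ 1 :=
  abs_le.mpr ⟨by linarith [M.reward_nonneg hk hh x a], M.reward_le_one hk hh x a⟩

theorem measurable_stateLaw (hπ : ∀ i < H, Measurable (π i)) (n : ℕ) :
    ∀ h, h + n ≤ H → Measurable (M.stateLaw k π h n) := by
  induction n with
  | zero => intro h _; exact Measure.measurable_dirac
  | succ n ih =>
    intro h hh
    have h1 : Measurable fun x => M.P k h (x, π h x) :=
      (M.P k h).measurable.comp (measurable_id.prodMk (hπ h (by omega)))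
    exact (Measure.measurable_bind' (ih (h + 1) (by omega))).comp h1

theorem isProbabilityMeasure_stateLaw (hk : k < K) (hπ : ∀ i < H, Measurable (π i)) (n : ℕ) :
    ∀ h, h + n ≤ H → ∀ x, IsProbabilityMeasure (M.stateLaw k π h n x) := by
  induction n with
  | zero => intro h _ x; exact Measure.dirac.isProbabilityMeasure
  | succ n ih =>
    intro h hh x
    have := M.markov k hk h (by omega)
    exact isProbabilityMeasure_bind
      (M.measurable_stateLaw hπ n (h + 1) (by omega)).aemeasurable
      (Filter.Eventually.of_forall (ih (h + 1) (by omega)))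

theorem integral_stateLaw_succ (hk : k < K) (hπ : ∀ i < H, Measurable (π i)) {h n : ℕ}
    (hn : h + (n + 1) ≤ H) (x : S) {f : S → ℝ} (hf : Measurable f) {b : ℝ}
    (hb : ∀ y, |f y| ≤ b) :
    ∫ y, f y ∂M.stateLaw k π h (n + 1) x =
      ∫ z, (∫ y, f y ∂M.stateLaw k π (h + 1) n z) ∂M.P k h (x, π h x) := by
  let η : Kernel S S := ⟨M.stateLaw k π (h + 1) n, M.measurable_stateLaw hπ n (h + 1) (by omega)⟩
  have hη : IsMarkovKernel η :=
    ⟨fun y => M.isProbabilityMeasure_stateLaw hk hπ n (h + 1) (by omega) y⟩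
  have := M.markov k hk h (by omega)
  have h1 : M.stateLaw k π h (n + 1) x = (η ∘ₖ M.P k h) (x, π h x) := by
    rw [Kernel.comp_apply]; rfl
  rw [h1, Kernel.integral_comp (integrable_of_abs_le hf hb)]
  rfl

theorem measurable_integral_stateLaw (hk : k < K) (hπ : ∀ i < H, Measurable (π i)) {h n : ℕ}
    (hn : h + n ≤ H) {f : S → ℝ} (hf : Measurable f) :
    Measurable fun x => ∫ y, f y ∂M.stateLaw k π h n x := by
  let η : Kernel S S := ⟨M.stateLaw k π h n, M.measurable_stateLaw hπ n h hn⟩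
  have hη : IsMarkovKernel η := ⟨fun y => M.isProbabilityMeasure_stateLaw hk hπ n h hn y⟩
  exact (hf.stronglyMeasurable.integral_kernel (κ := η)).measurable

theorem value_self : M.value k π H = fun _ => 0 := by
  ext x; simp [value]

theorem measurable_value (hk : k < K) (hπ : ∀ i < H, Measurable (π i)) (h : ℕ) :
    Measurable (M.value k π h) := by
  refine Finset.measurable_fun_sum _ fun n hn => ?_
  have := Finset.mem_range.mp hn
  exact M.measurable_integral_stateLaw hk hπ (by omega)
    (M.measurable_reward_policy (hπ _ (by omega)))

theorem value_nonneg (hk : k < K) (h : ℕ) (x : S) : 0 ≤ M.value k π h x := by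
  refine Finset.sum_nonneg fun n hn => integral_nonneg fun y => ?_
  have := Finset.mem_range.mp hn
  exact M.reward_nonneg hk (by omega) _ _

theorem value_le (hk : k < K) (hπ : ∀ i < H, Measurable (π i)) (h : ℕ) (x : S) :
    M.value k π h x ≤ H := by
  have h1 : M.value k π h x ≤ ∑ _n ∈ Finset.range (H - h), (1 : ℝ) := by
    refine Finset.sum_le_sum fun n hn => ?_
    have := Finset.mem_range.mp hn
    have := M.isProbabilityMeasure_stateLaw hk hπ n h (by omega) x
    have h2 := norm_integral_le_of_norm_le_const (μ := M.stateLaw k π h n x)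
      (f := fun y => M.reward k (h + n) y (π (h + n) y)) (C := 1)
      (Filter.Eventually.of_forall fun y => M.abs_reward_le_one hk (by omega) _ _)
    simp only [probReal_univ, mul_one] at h2
    exact (le_abs_self _).trans h2
  refine h1.trans ?_
  simp

theorem abs_value_le (hk : k < K) (hπ : ∀ i < H, Measurable (π i)) (h : ℕ) (x : S) :
    |M.value k π h x| ≤ H :=
  abs_le.mpr ⟨by linarith [M.value_nonneg (π := π) hk h x, (Nat.cast_nonneg H : (0 : ℝ) ≤ H)],
    M.value_le hk hπ h x⟩

/-- The Bellman equation. -/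
theorem value_eq (hk : k < K) (hπ : ∀ i < H, Measurable (π i)) {h : ℕ} (hh : h < H) (x : S) :
    M.value k π h x = M.reward k h x (π h x)
      + ∫ y, M.value k π (h + 1) y ∂M.P k h (x, π h x) := by
  have := M.markov k hk h hh
  obtain ⟨m, hm⟩ : ∃ m, H - h = m + 1 := ⟨H - h - 1, by omega⟩
  have hm' : H - (h + 1) = m := by omega
  rw [value, hm, Finset.sum_range_succ', add_comm]
  congr 1
  · exact integral_dirac' _ _ (M.measurable_reward_policy (hπ _ (by omega))).stronglyMeasurable
  · simp only [value, hm']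
    rw [integral_finsetSum]
    · refine Finset.sum_congr rfl fun n hn => ?_
      have hlt := Finset.mem_range.mp hn
      rw [M.integral_stateLaw_succ hk hπ (by omega) x
        (M.measurable_reward_policy (hπ _ (by omega)))
        (fun y => M.abs_reward_le_one hk (by omega) _ _)]
      rw [show h + (n + 1) = h + 1 + n by ring]
    · intro n hn
      have hlt := Finset.mem_range.mp hn
      refine integrable_of_abs_le (b := 1) (M.measurable_integral_stateLaw hk hπ (by omega)
        (M.measurable_reward_policy (hπ _ (by omega)))) fun z => ?_
      have := M.isProbabilityMeasure_stateLaw hk hπ n (h + 1) (by omega) z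
      simpa using norm_integral_le_of_norm_le_const (μ := M.stateLaw k π (h + 1) n z)
        (f := fun y => M.reward k (h + 1 + n) y (π (h + 1 + n) y)) (C := 1)
        (Filter.Eventually.of_forall fun y => M.abs_reward_le_one hk (by omega) _ _)

/-- Values of random policies are jointly measurable. -/
theorem measurable_value_uncurry {Ω : Type*} [MeasurableSpace Ω] (hk : k < K)
    {p : ℕ → Ω → S → A} (hp : ∀ i < H, Measurable fun q : Ω × S => p i q.1 q.2) (n : ℕ) :
    ∀ h, h + n = H → Measurable fun q : Ω × S => M.value k (fun i => p i q.1) h q.2 := by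
  have hsec : ∀ ω, ∀ i < H, Measurable (p i ω) := fun ω i hi =>
    (hp i hi).comp measurable_prodMk_left
  induction n with
  | zero =>
    intro h hh
    obtain rfl : h = H := by omega
    simp only [value_self]
    exact measurable_const
  | succ n ih =>
    intro h hh
    have := M.markov k hk h (by omega)
    have heq : (fun q : Ω × S => M.value k (fun i => p i q.1) h q.2) = fun q =>
        M.reward k h q.2 (p h q.1 q.2)
          + ∫ y, M.value k (fun i => p i q.1) (h + 1) y ∂M.P k h (q.2, p h q.1 q.2) := by
      ext q
      exact M.value_eq hk (hsec q.1) (by omega) q.2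
    rw [heq]
    have hZ : Measurable fun q : Ω × S => (q.2, p h q.1 q.2) :=
      measurable_snd.prodMk (hp h (by omega))
    refine ((M.measurable_reward k h).comp hZ).add ?_
    have hf : Measurable fun r : (Ω × S) × S => M.value k (fun i => p i r.1.1) (h + 1) r.2 :=
      (ih (h + 1) (by omega)).comp ((measurable_fst.comp measurable_fst).prodMk measurable_snd)
    exact (hf.stronglyMeasurable.integral_kernel_prod_right'
      (κ := (M.P k h).comap _ hZ)).measurable

end Value

end LinearMDP

/-! ### Measurability of matrix inverses, entry by entry -/

section MatrixMeasurable

variable {Ω : Type*} [MeasurableSpace Ω] {d : ℕ}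

theorem measurable_matrix_det {G : Ω → Matrix (Fin d) (Fin d) ℝ}
    (hG : ∀ i j, Measurable fun ω => G ω i j) : Measurable fun ω => (G ω).det := by
  simp only [Matrix.det_apply]
  refine Finset.measurable_fun_sum _ fun σ _ => ?_
  exact (Finset.measurable_fun_prod _ fun i _ => hG _ _).const_smul _

/-- Cramer's rule. Singular matrices need no exception, since the inverse of a zero determinant is
zero by convention. -/
theorem measurable_matrix_inv_apply {G : Ω → Matrix (Fin d) (Fin d) ℝ}
    (hG : ∀ i j, Measurable fun ω => G ω i j) (i j : Fin d) :
    Measurable fun ω => (G ω)⁻¹ i j := by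
  simp only [Matrix.inv_def, Ring.inverse_eq_inv', Matrix.smul_apply, smul_eq_mul,
    Matrix.adjugate_apply]
  refine (measurable_matrix_det hG).inv.mul (measurable_matrix_det fun i' j' => ?_)
  simp only [Matrix.updateRow_apply]
  split_ifs
  · exact measurable_const
  · exact hG _ _

theorem measurable_weightedNorm {G : Ω → Matrix (Fin d) (Fin d) ℝ}
    (hG : ∀ i j, Measurable fun ω => G ω i j) {v : Ω → Fin d → ℝ}
    (hv : ∀ i, Measurable fun ω => v ω i) :
    Measurable fun ω => LinearMDP.weightedNorm (G ω) (v ω) := by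
  refine Measurable.sqrt ?_
  simp only [dotProduct, Matrix.mulVec]
  refine Finset.measurable_fun_sum _ fun i _ => (hv i).mul ?_
  exact Finset.measurable_fun_sum _ fun j _ => (hG i j).mul (hv j)

end MatrixMeasurable

/-! ### Continuity of finite suprema and of the square root -/

section FiniteSup

theorem abs_ciSup_sub_ciSup_le {A : Type*} [Finite A] [Nonempty A] {f g : A → ℝ} {e : ℝ}
    (h : ∀ b, |f b - g b| ≤ e) : |(⨆ b, f b) - ⨆ b, g b| ≤ e := by
  have hf : BddAbove (Set.range f) := Set.Finite.bddAbove (Set.finite_range f)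
  have hg : BddAbove (Set.range g) := Set.Finite.bddAbove (Set.finite_range g)
  rw [abs_sub_le_iff]
  constructor
  · rw [sub_le_iff_le_add]
    refine ciSup_le fun b => ?_
    have := (abs_sub_le_iff.mp (h b)).1
    linarith [le_ciSup hg b]
  · rw [sub_le_iff_le_add]
    refine ciSup_le fun b => ?_
    have := (abs_sub_le_iff.mp (h b)).2
    linarith [le_ciSup hf b]

/-- The bonus is only 1/2-Hölder in its matrix. No sign condition is imposed, because a grid matrix
need not be positive semidefinite. -/
theorem abs_sqrt_sub_sqrt_le (a b : ℝ) : |Real.sqrt a - Real.sqrt b| ≤ Real.sqrt |a - b| := by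
  have key : ∀ a b : ℝ, Real.sqrt a - Real.sqrt b ≤ Real.sqrt |a - b| := by
    intro a b
    rw [sub_le_iff_le_add]
    rcases le_total b 0 with hb | hb
    · rw [Real.sqrt_eq_zero_of_nonpos hb, add_zero]
      exact Real.sqrt_le_sqrt ((by linarith : a ≤ a - b).trans (le_abs_self _))
    · refine Real.sqrt_le_iff.mpr ⟨by positivity, ?_⟩
      rw [add_sq, Real.sq_sqrt (abs_nonneg _), Real.sq_sqrt hb]
      have h1 := le_abs_self (a - b)
      have h2 : 0 ≤ 2 * Real.sqrt |a - b| * Real.sqrt b := by positivity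
      linarith
  rw [abs_sub_le_iff]
  exact ⟨key a b, by rw [abs_sub_comm]; exact key b a⟩

end FiniteSup

namespace LinearMDP

/-! ### Measurability of the algorithm's estimates -/

section Estimates

variable {S A : Type*} [MeasurableSpace S] [MeasurableSpace A] {d H K : ℕ}
  (M : LinearMDP S A d H K)

theorem measurable_φ_apply (i : Fin d) : Measurable fun q : S × A => (M.φ q.1 q.2).ofLp i :=
  (EuclideanSpace.proj (𝕜 := ℝ) i).measurable.comp M.measurable_φ

theorem dotProduct_φ_self_le (x : S) (a : A) : (M.φ x a).ofLp ⬝ᵥ (M.φ x a).ofLp ≤ 1 := by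
  have h := M.norm_φ_le x a
  rw [EuclideanSpace.norm_eq, Real.sqrt_le_one] at h
  simpa [dotProduct, sq] using h

theorem abs_φ_apply_le (x : S) (a : A) (i : Fin d) : |(M.φ x a).ofLp i| ≤ 1 :=
  dotProduct_self_le_one_of_apply (M.dotProduct_φ_self_le x a) i

theorem gram_eq_ridgeGram (s : ℕ → ℕ → S) (a : ℕ → ℕ → A) (τ k h : ℕ) :
    M.gram s a τ k h = ridgeGram (Finset.Ico τ k) fun l => (M.φ (s l h) (a l h)).ofLp := rfl

section Joint

variable {Ω : Type*} [MeasurableSpace Ω] {s : ℕ → ℕ → Ω → S} {a : ℕ → ℕ → Ω → A} {τ k : ℕ}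

theorem measurable_gram_apply {h : ℕ} (hs : ∀ l ∈ Finset.Ico τ k, Measurable (s l h))
    (ha : ∀ l ∈ Finset.Ico τ k, Measurable (a l h)) (i j : Fin d) :
    Measurable fun ω => M.gram (fun l i => s l i ω) (fun l i => a l i ω) τ k h i j := by
  simp only [gram, Matrix.add_apply, Matrix.sum_apply, Matrix.vecMulVec_apply]
  refine measurable_const.add (Finset.measurable_fun_sum _ fun l hl => ?_)
  have hq := (hs l hl).prodMk (ha l hl)
  exact ((M.measurable_φ_apply i).comp hq).mul ((M.measurable_φ_apply j).comp hq)

theorem measurable_weight_apply {h : ℕ} (hs : ∀ l ∈ Finset.Ico τ k, Measurable (s l h))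
    (hs' : ∀ l ∈ Finset.Ico τ k, Measurable (s l (h + 1)))
    (ha : ∀ l ∈ Finset.Ico τ k, Measurable (a l h)) {V : Ω → S → ℝ}
    (hV : Measurable fun q : Ω × S => V q.1 q.2) (i : Fin d) :
    Measurable fun ω => M.weight (fun l i => s l i ω) (fun l i => a l i ω) τ k h (V ω) i := by
  simp only [weight, Matrix.mulVec, dotProduct, Finset.sum_apply, Pi.smul_apply, smul_eq_mul]
  refine Finset.measurable_fun_sum _ fun j _ => Measurable.mul ?_ ?_
  · exact measurable_matrix_inv_apply (M.measurable_gram_apply hs ha) i j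
  · refine Finset.measurable_fun_sum _ fun l hl => ?_
    have hq := (hs l hl).prodMk (ha l hl)
    refine Measurable.mul (Measurable.add ((M.measurable_reward l h).comp hq) ?_)
      ((M.measurable_φ_apply j).comp hq)
    exact hV.comp (measurable_id.prodMk (hs' l hl))

/-- Joint measurability is needed because the estimate, itself random, is evaluated at random
states. -/
theorem measurable_estVRemaining [Finite A]
    (hs : ∀ l ∈ Finset.Ico τ k, ∀ h ≤ H, Measurable (s l h))
    (ha : ∀ l ∈ Finset.Ico τ k, ∀ h < H, Measurable (a l h)) (β : ℝ) (n : ℕ) (hn : n ≤ H) :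
    Measurable fun q : Ω × S =>
      M.estVRemaining (fun l i => s l i q.1) (fun l i => a l i q.1) β τ k n q.2 := by
  induction n with
  | zero => exact measurable_const
  | succ n ih =>
    refine Measurable.iSup fun b => ?_
    simp only [qStep]
    have hs1 : ∀ l ∈ Finset.Ico τ k, Measurable (s l (H - (n + 1))) := fun l hl =>
      hs l hl _ (by omega)
    have hs2 : ∀ l ∈ Finset.Ico τ k, Measurable (s l (H - (n + 1) + 1)) := fun l hl =>
      hs l hl _ (by omega)
    have ha1 : ∀ l ∈ Finset.Ico τ k, Measurable (a l (H - (n + 1))) := fun l hl =>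
      ha l hl _ (by omega)
    have hφ : ∀ i, Measurable fun q : Ω × S => (M.φ q.2 b).ofLp i := fun i =>
      (M.measurable_φ_apply i).comp (measurable_snd.prodMk measurable_const)
    refine Measurable.min (Measurable.add ?_ (Measurable.const_mul ?_ _)) measurable_const
    · simp only [dotProduct]
      refine Finset.measurable_fun_sum _ fun i _ => Measurable.mul ?_ (hφ i)
      exact (M.measurable_weight_apply hs1 hs2 ha1 (V := fun ω =>
        M.estVRemaining (fun l i => s l i ω) (fun l i => a l i ω) β τ k n)
        (ih (by omega)) i).comp measurable_fst
    · refine measurable_weightedNorm (fun i j => ?_) hφ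
      exact (measurable_matrix_inv_apply (M.measurable_gram_apply hs1 ha1) i j).comp measurable_fst

end Joint

/-- A fixed trajectory is a random one over a one-point space. -/
theorem measurable_estV [Finite A] (s : ℕ → ℕ → S) (a : ℕ → ℕ → A) (β : ℝ) (τ k h : ℕ) :
    Measurable (M.estV s a β τ k h) := by
  have h := M.measurable_estVRemaining (Ω := Unit) (s := fun l i _ => s l i)
    (a := fun l i _ => a l i) (τ := τ) (k := k) (fun _ _ _ _ => measurable_const)
    (fun _ _ _ _ => measurable_const) β (H - h) (Nat.sub_le _ _)
  have h2 : Measurable fun x : S => ((), x) := measurable_const.prodMk measurable_id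
  exact h.comp h2

theorem estV_self (s : ℕ → ℕ → S) (a : ℕ → ℕ → A) (β : ℝ) (τ k : ℕ) (x : S) :
    M.estV s a β τ k H x = 0 := by
  simp [estV, estVRemaining]

theorem estV_eq_iSup (s : ℕ → ℕ → S) (a : ℕ → ℕ → A) (β : ℝ) (τ k : ℕ) {h : ℕ} (hh : h < H)
    (x : S) : M.estV s a β τ k h x = ⨆ b, M.estQ s a β τ k h x b := by
  obtain ⟨n, hn⟩ : ∃ n, H - h = n + 1 := ⟨H - h - 1, by omega⟩
  have h1 : H - (n + 1) = h := by omega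
  have h2 : H - (h + 1) = n := by omega
  simp only [estV, estQ, hn, estVRemaining, h1, h2]

/-! ### The parametric class which contains the value function estimates -/

/-- The clipped optimistic value function with weight vector `w` and bonus matrix `B`. -/
noncomputable def classValue (β : ℝ) (w : Fin d → ℝ) (B : Matrix (Fin d) (Fin d) ℝ) (x : S) : ℝ :=
  max 0 (⨆ b : A, min (w ⬝ᵥ (M.φ x b).ofLp + β * weightedNorm B (M.φ x b).ofLp) H)

theorem measurable_classValue [Finite A] (β : ℝ) (w : Fin d → ℝ) (B : Matrix (Fin d) (Fin d) ℝ) :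
    Measurable (M.classValue β w B) := by
  refine measurable_const.max (Measurable.iSup fun b => ?_)
  have hφ : ∀ i, Measurable fun x : S => (M.φ x b).ofLp i := fun i =>
    (M.measurable_φ_apply i).comp (measurable_id.prodMk measurable_const)
  refine Measurable.min (Measurable.add ?_ (Measurable.const_mul ?_ _)) measurable_const
  · simp only [dotProduct]
    exact Finset.measurable_fun_sum _ fun i _ => (hφ i).const_mul _
  · exact measurable_weightedNorm (G := fun _ : S => B) (v := fun x : S => (M.φ x b).ofLp)
      (fun i j => measurable_const) hφ

theorem classValue_nonneg (β : ℝ) (w : Fin d → ℝ) (B : Matrix (Fin d) (Fin d) ℝ) (x : S) :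
    0 ≤ M.classValue β w B x := le_max_left _ _

theorem classValue_le [Finite A] [Nonempty A] (β : ℝ) (w : Fin d → ℝ)
    (B : Matrix (Fin d) (Fin d) ℝ) (x : S) : M.classValue β w B x ≤ H :=
  max_le (Nat.cast_nonneg H) (ciSup_le fun _ => min_le_right _ _)

/-- Clipping and suprema are 1-Lipschitz, so it suffices to perturb the linear term, by at most dε,
and the quadratic form, by at most d²ε; the square root turns the latter into d√ε. -/
theorem abs_classValue_sub_le [Finite A] [Nonempty A] {β : ℝ} (hβ : 0 ≤ β) {w w' : Fin d → ℝ}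
    {B B' : Matrix (Fin d) (Fin d) ℝ} {ε : ℝ} (hw : ∀ i, |w i - w' i| ≤ ε)
    (hB : ∀ i j, |B i j - B' i j| ≤ ε) (x : S) :
    |M.classValue β w B x - M.classValue β w' B' x| ≤ d * ε + β * (d * Real.sqrt ε) := by
  refine (abs_max_sub_max_le_max _ _ _ _).trans ?_
  have hbound : ∀ b : A,
      |min (w ⬝ᵥ (M.φ x b).ofLp + β * weightedNorm B (M.φ x b).ofLp) (H : ℝ)
        - min (w' ⬝ᵥ (M.φ x b).ofLp + β * weightedNorm B' (M.φ x b).ofLp) H|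
        ≤ d * ε + β * (d * Real.sqrt ε) := by
    intro b
    set v := (M.φ x b).ofLp
    have hv : ∀ i, |v i| ≤ 1 := M.abs_φ_apply_le x b
    have h1 : |w ⬝ᵥ v - w' ⬝ᵥ v| ≤ d * ε := by
      rw [← sub_dotProduct]
      calc _ ≤ ∑ i, |(w - w') i * v i| := Finset.abs_sum_le_sum_abs _ _
        _ ≤ ∑ _i : Fin d, ε := by
          refine Finset.sum_le_sum fun i _ => ?_
          rw [abs_mul]
          calc _ ≤ |(w - w') i| * 1 := by gcongr; exact hv i
            _ ≤ ε := by rw [mul_one]; exact hw i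
        _ = _ := by simp
    have h2 : |weightedNorm B v - weightedNorm B' v| ≤ d * Real.sqrt ε := by
      refine (abs_sqrt_sub_sqrt_le _ _).trans ?_
      rw [← Real.sqrt_sq (Nat.cast_nonneg d : (0 : ℝ) ≤ d), ← Real.sqrt_mul (by positivity)]
      refine Real.sqrt_le_sqrt ?_
      rw [← dotProduct_sub, ← Matrix.sub_mulVec]
      calc _ ≤ ∑ i, |v i * ((B - B') *ᵥ v) i| := Finset.abs_sum_le_sum_abs _ _
        _ ≤ ∑ _i : Fin d, ∑ _j : Fin d, ε := by
          refine Finset.sum_le_sum fun i _ => ?_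
          rw [abs_mul]
          calc _ ≤ 1 * |((B - B') *ᵥ v) i| := by gcongr; exact hv i
            _ = |((B - B') *ᵥ v) i| := one_mul _
            _ ≤ ∑ j, |(B - B') i j * v j| := by
              rw [Matrix.mulVec, dotProduct]
              exact Finset.abs_sum_le_sum_abs _ _
            _ ≤ _ := by
              refine Finset.sum_le_sum fun j _ => ?_
              rw [abs_mul]
              calc _ ≤ |(B - B') i j| * 1 := by gcongr; exact hv j
                _ ≤ ε := by rw [mul_one]; exact hB i j
        _ = _ := by simp; ring
    refine (abs_min_sub_min_le_max _ _ _ _).trans ?_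
    rw [sub_self, abs_zero, max_eq_left (abs_nonneg _)]
    calc _ = |(w ⬝ᵥ v - w' ⬝ᵥ v) + β * (weightedNorm B v - weightedNorm B' v)| := by ring_nf
      _ ≤ |w ⬝ᵥ v - w' ⬝ᵥ v| + |β * (weightedNorm B v - weightedNorm B' v)| := abs_add_le _ _
      _ ≤ _ := by
        rw [abs_mul, abs_of_nonneg hβ]
        gcongr
  have h0 : 0 ≤ d * ε + β * (d * Real.sqrt ε) :=
    (abs_nonneg _).trans (hbound (Classical.arbitrary A))
  rw [sub_self, abs_zero]
  exact max_le h0 (abs_ciSup_sub_ciSup_le hbound)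

end Estimates

end LinearMDP

/-! ### Ridge regression with bounded targets -/

section RidgeBounded

variable {ι : Type*} {d : ℕ}

theorem dotProduct_sum_smul (I : Finset ι) (v : ι → Fin d → ℝ) (e : ι → ℝ) (u : Fin d → ℝ) :
    u ⬝ᵥ ∑ l ∈ I, e l • v l = ∑ l ∈ I, e l * (u ⬝ᵥ v l) := by
  rw [dotProduct_sum]
  exact Finset.sum_congr rfl fun l _ => by rw [dotProduct_smul, smul_eq_mul]

/-- With S = ∑ e l • v l, both sides equal SᵀΛ⁻¹S. -/
theorem ridge_energy_eq (I : Finset ι) (v : ι → Fin d → ℝ) (e : ι → ℝ) :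
    ((ridgeGram I v)⁻¹ *ᵥ ∑ l ∈ I, e l • v l) ⬝ᵥ ((ridgeGram I v)⁻¹ *ᵥ ∑ l ∈ I, e l • v l)
        + ∑ l ∈ I, (((ridgeGram I v)⁻¹ *ᵥ ∑ l ∈ I, e l • v l) ⬝ᵥ v l) ^ 2 =
      ∑ l ∈ I, e l * (((ridgeGram I v)⁻¹ *ᵥ ∑ l ∈ I, e l • v l) ⬝ᵥ v l) := by
  rw [← dotProduct_ridgeGram_inv, ← dotProduct_sum_smul, dotProduct_comm]

/-- In the energy identity, e·g ≤ b²/4 + g² absorbs the sum of squares on the left. -/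
theorem ridge_dotProduct_self_le (I : Finset ι) (v : ι → Fin d → ℝ) (e : ι → ℝ) {b : ℝ}
    (he : ∀ l ∈ I, |e l| ≤ b) :
    ((ridgeGram I v)⁻¹ *ᵥ ∑ l ∈ I, e l • v l) ⬝ᵥ ((ridgeGram I v)⁻¹ *ᵥ ∑ l ∈ I, e l • v l) ≤
      I.card * (b ^ 2 / 4) := by
  have h := ridge_energy_eq I v e
  set u := (ridgeGram I v)⁻¹ *ᵥ ∑ l ∈ I, e l • v l
  have h2 : ∑ l ∈ I, e l * (u ⬝ᵥ v l) ≤ ∑ l ∈ I, (b ^ 2 / 4 + (u ⬝ᵥ v l) ^ 2) := by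
    refine Finset.sum_le_sum fun l hl => ?_
    have h3 : e l ^ 2 ≤ b ^ 2 := sq_le_sq' (abs_le.mp (he l hl)).1 (abs_le.mp (he l hl)).2
    nlinarith [sq_nonneg (e l / 2 - u ⬝ᵥ v l)]
  rw [Finset.sum_add_distrib, Finset.sum_const, nsmul_eq_mul] at h2
  linarith

theorem ridge_sum_sq_le (I : Finset ι) (v : ι → Fin d → ℝ) (e : ι → ℝ) {b : ℝ}
    (he : ∀ l ∈ I, |e l| ≤ b) :
    ∑ l ∈ I, (((ridgeGram I v)⁻¹ *ᵥ ∑ l ∈ I, e l • v l) ⬝ᵥ v l) ^ 2 ≤ I.card * b ^ 2 := by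
  have h := ridge_energy_eq I v e
  set u := (ridgeGram I v)⁻¹ *ᵥ ∑ l ∈ I, e l • v l
  have hu := real_dotProduct_self_nonneg u
  have h2 : ∑ l ∈ I, e l * (u ⬝ᵥ v l) ≤ ∑ l ∈ I, (b ^ 2 / 2 + (u ⬝ᵥ v l) ^ 2 / 2) := by
    refine Finset.sum_le_sum fun l hl => ?_
    have h3 : e l ^ 2 ≤ b ^ 2 := sq_le_sq' (abs_le.mp (he l hl)).1 (abs_le.mp (he l hl)).2
    nlinarith [sq_nonneg (e l - u ⬝ᵥ v l)]
  rw [Finset.sum_add_distrib, Finset.sum_const, nsmul_eq_mul, ← Finset.sum_div] at h2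
  linarith

theorem exists_int_grid_approx {ε R : ℝ} (hε : 0 < ε) {N : ℕ} (hN : R / ε + 1 ≤ N) {x : ℝ}
    (hx : |x| ≤ R) : ∃ z : ℤ, |z| ≤ N ∧ |x - ε * z| ≤ ε := by
  refine ⟨round (x / ε), ?_, ?_⟩
  · have h1 := abs_sub_round (x / ε)
    have h2 : |x / ε| ≤ R / ε := by rw [abs_div, abs_of_pos hε]; gcongr
    have h3 : |((round (x / ε) : ℤ) : ℝ)| ≤ N := by
      have := abs_sub_abs_le_abs_sub ((round (x / ε) : ℤ) : ℝ) (x / ε)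
      rw [abs_sub_comm] at this
      linarith
    exact_mod_cast h3
  · have h1 := abs_sub_round (x / ε)
    have h2 : x - ε * (round (x / ε) : ℤ) = ε * (x / ε - (round (x / ε) : ℤ)) := by
      field_simp
    rw [h2, abs_mul, abs_of_pos hε]
    nlinarith

theorem abs_dotProduct_le_of_abs_le {x v : Fin d → ℝ} {ε : ℝ} (hx : ∀ i, |x i| ≤ ε)
    (hv : ∀ i, |v i| ≤ 1) : |x ⬝ᵥ v| ≤ d * ε := by
  calc _ ≤ ∑ i, |x i * v i| := Finset.abs_sum_le_sum_abs _ _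
    _ ≤ ∑ _i : Fin d, ε := by
      refine Finset.sum_le_sum fun i _ => ?_
      rw [abs_mul]
      calc _ ≤ |x i| * 1 := by gcongr; exact hv i
        _ ≤ ε := by rw [mul_one]; exact hx i
    _ = _ := by simp

/-- A self-normalized bound from exponential tail bounds for the directions of a grid. -/
theorem sq_weightedNorm_sum_le_of_grid (I : Finset ι) (v : ι → Fin d → ℝ) (e : ι → ℝ) {b ε t : ℝ}
    (hb : 1 ≤ b) (he : ∀ l ∈ I, |e l| ≤ b) (hv : ∀ l, v l ⬝ᵥ v l ≤ 1) (hε : 0 < ε) {N : ℕ}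
    (hN : I.card / ε + 1 ≤ N)
    (hsmall : I.card * (d * ε) * (b + b * I.card + b ^ 2 * (d * ε) / 2) ≤ 1)
    (hgrid : ∀ z : Fin d → ℤ, (∀ i, |z i| ≤ N) →
      ∑ l ∈ I, (((fun i => ε * (z i : ℝ)) ⬝ᵥ v l) * e l
        - (|(fun i => ε * (z i : ℝ)) ⬝ᵥ v l| * b) ^ 2 / 2) ≤ t) :
    LinearMDP.weightedNorm (ridgeGram I v)⁻¹ (∑ l ∈ I, e l • v l) ^ 2 ≤ 2 * b ^ 2 * (t + 1) := by
  have hb0 : 0 < b := by linarith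
  rw [sq_weightedNorm_ridgeGram_inv, dotProduct_comm, dotProduct_sum_smul]
  have hE := ridge_energy_eq I v e
  have hU := ridge_dotProduct_self_le I v e he
  have hQ := ridge_sum_sq_le I v e he
  set u := (ridgeGram I v)⁻¹ *ᵥ ∑ l ∈ I, e l • v l with hu
  set q := ∑ l ∈ I, e l * (u ⬝ᵥ v l) with hq
  set n : ℝ := (I.card : ℝ) with hn
  have hn0 : 0 ≤ n := Nat.cast_nonneg _
  have hnn : n ≤ n ^ 2 := by
    rw [hn, ← Nat.cast_pow, Nat.cast_le]; exact Nat.le_self_pow (by norm_num) _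
  have huu := real_dotProduct_self_nonneg u
  -- The direction u/b² balances the linear term against the variance penalty. Its coordinates are
  -- at most n, hence the grid radius n/ε + 1, the 1 being room for rounding.
  have hx : ∀ i, |u i / b ^ 2| ≤ n := by
    intro i
    rw [abs_div, abs_of_pos (by positivity : 0 < b ^ 2), div_le_iff₀ (by positivity)]
    refine (abs_apply_le_sqrt_dotProduct_self u i).trans ?_
    rw [Real.sqrt_le_left (by positivity)]
    have h1 : 1 ≤ b ^ 2 := one_le_pow₀ hb
    calc u ⬝ᵥ u ≤ n * (b ^ 2 / 4) := hU
      _ ≤ n ^ 2 * (b ^ 2) ^ 2 := by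
        have : b ^ 2 / 4 ≤ (b ^ 2) ^ 2 := by nlinarith
        gcongr
      _ = _ := by ring
  choose z hz hzx using fun i => exists_int_grid_approx hε hN (hx i)
  have hg := hgrid z hz
  set y : Fin d → ℝ := fun i => ε * (z i : ℝ) with hy
  set ρ : ℝ := d * ε with hρ
  have hρ0 : 0 ≤ ρ := by positivity
  -- Rounding u/b² to the grid point y changes its inner product with v l by at most ρ = dε. The
  -- total loss is at most 1 by `hsmall`; this is the 1 in t + 1.
  have hterm : ∀ l ∈ I, e l * (u ⬝ᵥ v l) / b ^ 2 - (u ⬝ᵥ v l) ^ 2 / (2 * b ^ 2)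
      - ρ * (b + b * n + b ^ 2 * ρ / 2) ≤
      (y ⬝ᵥ v l) * e l - (|y ⬝ᵥ v l| * b) ^ 2 / 2 := by
    intro l hl
    have hr : |(fun i => u i / b ^ 2 - y i) ⬝ᵥ v l| ≤ ρ :=
      abs_dotProduct_le_of_abs_le hzx (dotProduct_self_le_one_of_apply (hv l))
    have hr2 : (fun i => u i / b ^ 2 - y i) ⬝ᵥ v l = (u ⬝ᵥ v l) / b ^ 2 - y ⬝ᵥ v l := by
      have : (fun i => u i / b ^ 2 - y i) = (b ^ 2)⁻¹ • u - y := by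
        ext i; simp [div_eq_inv_mul]
      rw [this, sub_dotProduct, smul_dotProduct, smul_eq_mul, div_eq_inv_mul]
    rw [hr2] at hr
    set g := u ⬝ᵥ v l with hg
    have hgn : |g| ≤ b * n := by
      apply abs_le_of_sq_le_sq _ (by positivity)
      calc g ^ 2 ≤ ∑ l ∈ I, (u ⬝ᵥ v l) ^ 2 :=
            Finset.single_le_sum (f := fun l => (u ⬝ᵥ v l) ^ 2) (fun _ _ => sq_nonneg _) hl
        _ ≤ n * b ^ 2 := hQ
        _ ≤ n ^ 2 * b ^ 2 := by gcongr
        _ = _ := by ring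
    obtain ⟨r, hr'⟩ : ∃ r, r = g / b ^ 2 - y ⬝ᵥ v l := ⟨_, rfl⟩
    rw [← hr'] at hr
    have hyv : y ⬝ᵥ v l = g / b ^ 2 - r := by rw [hr']; ring
    rw [mul_pow, sq_abs, hyv]
    have hid : (g / b ^ 2 - r) * e l - (g / b ^ 2 - r) ^ 2 * b ^ 2 / 2 =
        e l * g / b ^ 2 - g ^ 2 / (2 * b ^ 2) - r * e l + g * r - r ^ 2 * b ^ 2 / 2 := by
      field_simp
      ring
    rw [hid]
    have h1 : r * e l ≤ ρ * b := by
      refine (le_abs_self _).trans ?_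
      rw [abs_mul]
      exact mul_le_mul hr (he l hl) (abs_nonneg _) hρ0
    have h2 : -(g * r) ≤ b * n * ρ := by
      refine (neg_le_abs _).trans ?_
      rw [abs_mul]
      exact mul_le_mul hgn hr (abs_nonneg _) (mul_nonneg hb0.le hn0)
    have h3 : r ^ 2 * b ^ 2 ≤ ρ ^ 2 * b ^ 2 := by
      have : r ^ 2 ≤ ρ ^ 2 := sq_le_sq' (abs_le.mp hr).1 (abs_le.mp hr).2
      gcongr
    nlinarith
  have hsum := Finset.sum_le_sum hterm
  rw [Finset.sum_sub_distrib, Finset.sum_sub_distrib, Finset.sum_const, nsmul_eq_mul,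
    ← Finset.sum_div, ← Finset.sum_div, ← hq, ← hn] at hsum
  -- The energy identity bounds the sum of squares by q, so the exponent at u/b² is at least
  -- q/(2b²).
  have h4 : (∑ l ∈ I, (u ⬝ᵥ v l) ^ 2) / (2 * b ^ 2) ≤ q / (2 * b ^ 2) := by
    gcongr; linarith
  have h5 : q / b ^ 2 - q / (2 * b ^ 2) = q / (2 * b ^ 2) := by field_simp; ring
  have h6 : q / (2 * b ^ 2) ≤ t + 1 := by nlinarith
  rw [div_le_iff₀ (by positivity)] at h6
  linarith

end RidgeBounded

namespace LinearMDP

/-! ### Drift within an epoch and the error of the ridge estimate -/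

section Deterministic

theorem mem_epoch {K L τ k : ℕ} : k ∈ epoch K L τ ↔ τ ≤ k ∧ k < τ + L ∧ k < K := by
  simp [epoch]

/-- The triangle inequality along the increments l + 1, …, k, all of which lie in the epoch after
its first episode. -/
theorem norm_sub_le_sum_epoch {E : Type*} [NormedAddCommGroup E] {K L τ k l : ℕ}
    (hk : k ∈ epoch K L τ) (hl : l ∈ Finset.Ico τ k) (g : ℕ → E) (c : ℕ → ℝ)
    (hc : ∀ j ∈ (epoch K L τ).erase τ, ‖g j - g (j - 1)‖ ≤ c j) :
    ‖g l - g k‖ ≤ ∑ j ∈ (epoch K L τ).erase τ, c j := by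
  rw [mem_epoch] at hk
  rw [Finset.mem_Ico] at hl
  have h1 := dist_le_Ico_sum_dist g hl.2.le
  rw [dist_eq_norm] at h1
  have h2 : ∑ i ∈ Finset.Ico l k, dist (g i) (g (i + 1)) =
      ∑ j ∈ Finset.Ico (l + 1) (k + 1), ‖g j - g (j - 1)‖ := by
    rw [← Finset.sum_Ico_add' (fun j => ‖g j - g (j - 1)‖) l k 1]
    refine Finset.sum_congr rfl fun i _ => ?_
    rw [dist_comm, dist_eq_norm, Nat.add_sub_cancel]
  rw [h2] at h1
  have hsub : Finset.Ico (l + 1) (k + 1) ⊆ (epoch K L τ).erase τ := by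
    intro j hj
    rw [Finset.mem_Ico] at hj
    rw [Finset.mem_erase, mem_epoch]
    omega
  calc _ ≤ _ := h1
    _ ≤ ∑ j ∈ (epoch K L τ).erase τ, ‖g j - g (j - 1)‖ :=
      Finset.sum_le_sum_of_subset_of_nonneg hsub fun _ _ _ => norm_nonneg _
    _ ≤ _ := Finset.sum_le_sum hc

variable {S A : Type*} [MeasurableSpace S] [MeasurableSpace A] {d H K : ℕ}
  (M : LinearMDP S A d H K)

theorem tvNorm_nonneg (ν : Fin d → SignedMeasure S) : 0 ≤ tvNorm ν := norm_nonneg _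

theorem localVarθ_nonneg (L τ : ℕ) : 0 ≤ M.localVarθ L τ :=
  Finset.sum_nonneg fun _ _ => Finset.sum_nonneg fun _ _ => norm_nonneg _

theorem localVarμ_nonneg (L τ : ℕ) : 0 ≤ M.localVarμ L τ :=
  Finset.sum_nonneg fun _ _ => Finset.sum_nonneg fun _ _ => tvNorm_nonneg _

theorem norm_θ_sub_le {L τ k l h : ℕ} (hk : k ∈ epoch K L τ) (hl : l ∈ Finset.Ico τ k)
    (hh : h < H) : ‖M.θ l h - M.θ k h‖ ≤ M.localVarθ L τ :=
  norm_sub_le_sum_epoch hk hl (fun j => M.θ j h) _ fun j _ =>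
    Finset.single_le_sum (f := fun h => ‖M.θ j h - M.θ (j - 1) h‖) (fun _ _ => norm_nonneg _)
      (Finset.mem_range.mpr hh)

theorem norm_signedIntegralVec_μ_sub_le {L τ k l h : ℕ} (hk : k ∈ epoch K L τ)
    (hl : l ∈ Finset.Ico τ k) (hh : h < H) {V : S → ℝ} (hV : Measurable V) {b : ℝ} (hb0 : 0 ≤ b)
    (hb : ∀ x, |V x| ≤ b) :
    ‖signedIntegralVec (M.μ l h) V - signedIntegralVec (M.μ k h) V‖ ≤ b * M.localVarμ L τ := by
  rw [localVarμ, Finset.mul_sum]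
  refine norm_sub_le_sum_epoch hk hl (fun j => signedIntegralVec (M.μ j h) V) _ fun j _ => ?_
  rw [← signedIntegralVec_sub _ _ hV hb]
  refine (norm_signedIntegralVec_le _ hb0 hb).trans ?_
  gcongr
  exact Finset.single_le_sum (f := fun h => tvNorm (M.μ j h - M.μ (j - 1) h))
    (fun _ _ => tvNorm_nonneg _) (Finset.mem_range.mpr hh)

theorem inner_eq_dotProduct (x y : EuclideanSpace ℝ (Fin d)) : inner ℝ x y = x.ofLp ⬝ᵥ y.ofLp := by
  simp [EuclideanSpace.inner_eq_star_dotProduct, dotProduct_comm]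

theorem norm_eq_sqrt_dotProduct (x : EuclideanSpace ℝ (Fin d)) :
    ‖x‖ = Real.sqrt (x.ofLp ⬝ᵥ x.ofLp) := by
  rw [← inner_eq_dotProduct, real_inner_self_eq_norm_sq, Real.sqrt_sq (norm_nonneg _)]

/-- The parameter of the Bellman backup of `V`. -/
noncomputable def backupParam (k h : ℕ) (V : S → ℝ) : EuclideanSpace ℝ (Fin d) :=
  M.θ k h + signedIntegralVec (M.μ k h) V

/-- The linear structure of the kernel passes from sets to bounded functions; this is what makes
linear regression on φ meaningful. -/
theorem inner_backupParam {k h : ℕ} (hk : k < K) (hh : h < H) {V : S → ℝ} (hV : Measurable V)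
    {b : ℝ} (hb : ∀ x, |V x| ≤ b) (x : S) (a : A) :
    inner ℝ (M.φ x a) (M.backupParam k h V) =
      M.reward k h x a + ∫ y, V y ∂M.P k h (x, a) := by
  have := M.markov k hk h hh
  rw [backupParam, inner_add_right, reward, integral_eq_sum_mul_signedIntegral
    (M.P k h (x, a)) (M.φ x a).ofLp (M.μ k h) (M.transition_eq k hk h hh x a) hV hb,
    inner_eq_dotProduct (M.φ x a) (signedIntegralVec _ _)]
  rfl

theorem norm_backupParam_le {k h : ℕ} (hk : k < K) (hh : h < H) {V : S → ℝ}
    {b : ℝ} (hb0 : 0 ≤ b) (hb : ∀ x, |V x| ≤ b) :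
    ‖M.backupParam k h V‖ ≤ (1 + b) * Real.sqrt d := by
  calc _ ≤ ‖M.θ k h‖ + ‖signedIntegralVec (M.μ k h) V‖ := norm_add_le _ _
    _ ≤ Real.sqrt d + b * Real.sqrt d := by
      refine add_le_add (M.norm_θ_le k hk h hh) ((norm_signedIntegralVec_le _ hb0 hb).trans ?_)
      gcongr
      exact M.norm_μ_le k hk h hh
    _ = _ := by ring

theorem norm_backupParam_sub_le {L τ k l h : ℕ} (hk : k ∈ epoch K L τ)
    (hl : l ∈ Finset.Ico τ k) (hh : h < H) {V : S → ℝ} (hV : Measurable V) {b : ℝ} (hb0 : 0 ≤ b)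
    (hb : ∀ x, |V x| ≤ b) :
    ‖M.backupParam l h V - M.backupParam k h V‖ ≤ M.localVarθ L τ + b * M.localVarμ L τ := by
  have h1 : M.backupParam l h V - M.backupParam k h V = (M.θ l h - M.θ k h) +
      (signedIntegralVec (M.μ l h) V - signedIntegralVec (M.μ k h) V) := by
    simp only [backupParam]; abel
  rw [h1]
  exact (norm_add_le _ _).trans (add_le_add (M.norm_θ_sub_le hk hl hh)
    (M.norm_signedIntegralVec_μ_sub_le hk hl hh hV hb0 hb))

/-- The deviation of the sampled next-step value from its conditional mean. -/
noncomputable def noise (s : ℕ → ℕ → S) (a : ℕ → ℕ → A) (f : S → ℝ) (l h : ℕ) : ℝ :=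
  f (s l (h + 1)) - ∫ y, f y ∂M.P l h (s l h, a l h)

theorem abs_integral_P_le {k h : ℕ} (hk : k < K) (hh : h < H) {f : S → ℝ} {b : ℝ}
    (hb : ∀ x, |f x| ≤ b) (q : S × A) : |∫ y, f y ∂M.P k h q| ≤ b := by
  have := M.markov k hk h hh
  simpa using norm_integral_le_of_norm_le_const (μ := M.P k h q) (f := f) (C := b)
    (Filter.Eventually.of_forall hb)

theorem abs_noise_le_two_mul {k h : ℕ} (hk : k < K) (hh : h < H) (s : ℕ → ℕ → S) (a : ℕ → ℕ → A)
    {f : S → ℝ} {b : ℝ} (hb : ∀ x, |f x| ≤ b) : |M.noise s a f k h| ≤ 2 * b := by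
  refine (abs_sub _ _).trans ?_
  linarith [hb (s k (h + 1)), M.abs_integral_P_le hk hh hb (s k h, a k h)]

/-- Both terms lie in [0, b], so no factor 2 is lost. This is one use of clipping the function class
at zero. -/
theorem abs_noise_le {k h : ℕ} (hk : k < K) (hh : h < H) (s : ℕ → ℕ → S) (a : ℕ → ℕ → A)
    {f : S → ℝ} {b : ℝ} (hf0 : ∀ x, 0 ≤ f x) (hfb : ∀ x, f x ≤ b) :
    |M.noise s a f k h| ≤ b := by
  have h1 := M.abs_integral_P_le hk hh (f := f) (b := b)
    (fun x => abs_le.mpr ⟨by linarith [hf0 x, hfb x], hfb x⟩) (s k h, a k h)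
  have h2 : 0 ≤ ∫ y, f y ∂M.P k h (s k h, a k h) := integral_nonneg hf0
  rw [abs_of_nonneg h2] at h1
  rw [noise, abs_le]
  constructor <;> linarith [hf0 (s k (h + 1)), hfb (s k (h + 1))]

theorem noise_add_noise {k h : ℕ} (hk : k < K) (hh : h < H) (s : ℕ → ℕ → S) (a : ℕ → ℕ → A)
    {f g : S → ℝ} (hf : Measurable f) (hg : Measurable g) {b : ℝ} (hfb : ∀ x, |f x| ≤ b)
    (hgb : ∀ x, |g x| ≤ b) :
    M.noise s a f k h = M.noise s a g k h + M.noise s a (fun x => f x - g x) k h := by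
  have := M.markov k hk h hh
  simp only [noise]
  rw [integral_sub (integrable_of_abs_le hf hfb) (integrable_of_abs_le hg hgb)]
  ring

/-- The error of the ridge regression estimate of the Bellman backup of `V`, in terms of the
self-normalized noise of a function `f` which approximates `V`. -/
theorem abs_weight_dotProduct_sub_le {L τ k h : ℕ} (hk : k ∈ epoch K L τ) (hh : h < H)
    (s : ℕ → ℕ → S) (a : ℕ → ℕ → A) {V f : S → ℝ} (hV : Measurable V) (hf : Measurable f)
    {b : ℝ} (hb0 : 0 ≤ b) (hVb : ∀ x, |V x| ≤ b) (hfb : ∀ x, |f x| ≤ b) {η Γ : ℝ} (hη0 : 0 ≤ η)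
    (hη : ∀ x, |V x - f x| ≤ η)
    (hΓ : weightedNorm (M.gram s a τ k h)⁻¹
      (∑ l ∈ Finset.Ico τ k, M.noise s a f l h • (M.φ (s l h) (a l h)).ofLp) ≤ Γ) (x : S) (c : A) :
    |M.weight s a τ k h V ⬝ᵥ (M.φ x c).ofLp
        - (M.reward k h x c + ∫ y, V y ∂M.P k h (x, c))| ≤
      ((1 + b) * Real.sqrt d + Γ + (M.localVarθ L τ + b * M.localVarμ L τ + 2 * η)
        * Real.sqrt (d * (k - τ : ℕ)))
        * weightedNorm (M.gram s a τ k h)⁻¹ (M.φ x c).ofLp := by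
  have hk' := mem_epoch.mp hk
  rw [← M.inner_backupParam hk'.2.2 hh hV hVb, inner_eq_dotProduct, gram_eq_ridgeGram] at *
  set I := Finset.Ico τ k with hI
  set v : ℕ → Fin d → ℝ := fun l => (M.φ (s l h) (a l h)).ofLp with hv
  set z := (M.φ x c).ofLp with hz
  set p := M.backupParam k h V with hp
  -- Two deterministic perturbations of the targets are pooled: the drift of the backup parameter
  -- from episode l to k, and the noise of V - f, at most 2η.
  set e : ℕ → ℝ := fun l =>
    v l ⬝ᵥ (M.backupParam l h V - p).ofLp + M.noise s a (fun x => V x - f x) l h with he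
  set Sf := ∑ l ∈ I, M.noise s a f l h • v l with hSf
  have hl' : ∀ l ∈ I, l < K := fun l hl => by
    have := (Finset.mem_Ico.mp hl).2; omega
  -- Each target is ⟨v l, p⟩ + e l plus the noise of f. The terms ⟨v l, p⟩ • v l sum to Λp - p, and
  -- the -p is the regularization bias.
  have htarget : ∑ l ∈ I, (M.reward l h (s l h) (a l h) + V (s l (h + 1))) • v l =
      (ridgeGram I v *ᵥ p.ofLp - p.ofLp) + (∑ l ∈ I, e l • v l + Sf) := by
    rw [ridgeGram_mulVec, add_sub_cancel_left, hSf, ← Finset.sum_add_distrib,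
      ← Finset.sum_add_distrib]
    refine Finset.sum_congr rfl fun l hl => ?_
    rw [← add_smul, ← add_smul]
    congr 1
    have h1 := M.inner_backupParam (hl' l hl) hh hV hVb (s l h) (a l h)
    rw [inner_eq_dotProduct] at h1
    have h2 := M.noise_add_noise (hl' l hl) hh s a hV hf hVb hfb
    have h3 : v l ⬝ᵥ (M.backupParam l h V - p).ofLp =
        v l ⬝ᵥ (M.backupParam l h V).ofLp - v l ⬝ᵥ p.ofLp := by
      rw [WithLp.ofLp_sub, dotProduct_sub]
    simp only [he]
    have h4 : M.noise s a V l h = V (s l (h + 1)) - ∫ y, V y ∂M.P l h (s l h, a l h) := rfl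
    rw [h3, h1]
    linarith
  have hw : M.weight s a τ k h V = p.ofLp - (ridgeGram I v)⁻¹ *ᵥ p.ofLp
      + ((ridgeGram I v)⁻¹ *ᵥ ∑ l ∈ I, e l • v l + (ridgeGram I v)⁻¹ *ᵥ Sf) := by
    have : M.weight s a τ k h V = (ridgeGram I v)⁻¹ *ᵥ
      ∑ l ∈ I, (M.reward l h (s l h) (a l h) + V (s l (h + 1))) • v l := rfl
    rw [this, htarget, Matrix.mulVec_add, Matrix.mulVec_sub, ridgeGram_inv_mulVec_mulVec,
      Matrix.mulVec_add]
  have hdiff : M.weight s a τ k h V ⬝ᵥ z - z ⬝ᵥ p.ofLp =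
      - (z ⬝ᵥ ((ridgeGram I v)⁻¹ *ᵥ p.ofLp)) + z ⬝ᵥ ((ridgeGram I v)⁻¹ *ᵥ ∑ l ∈ I, e l • v l)
        + z ⬝ᵥ ((ridgeGram I v)⁻¹ *ᵥ Sf) := by
    rw [dotProduct_comm, hw, dotProduct_add, dotProduct_sub, dotProduct_add]
    ring
  rw [hdiff]
  set N := weightedNorm (ridgeGram I v)⁻¹ with hN
  have hNz : 0 ≤ N z := weightedNorm_nonneg _ _
  have hps := ridgeGram_inv_posSemidef I v
  have h1 : |z ⬝ᵥ ((ridgeGram I v)⁻¹ *ᵥ p.ofLp)| ≤ N z * ((1 + b) * Real.sqrt d) := by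
    refine (abs_dotProduct_mulVec_le_weightedNorm hps _ _).trans ?_
    gcongr
    refine (weightedNorm_ridgeGram_inv_le _ _ _).trans ?_
    rw [← norm_eq_sqrt_dotProduct]
    exact M.norm_backupParam_le hk'.2.2 hh hb0 hVb
  have h2 : |z ⬝ᵥ ((ridgeGram I v)⁻¹ *ᵥ Sf)| ≤ N z * Γ := by
    refine (abs_dotProduct_mulVec_le_weightedNorm hps _ _).trans ?_
    gcongr
  have he' : ∀ l ∈ I, |e l| ≤ M.localVarθ L τ + b * M.localVarμ L τ + 2 * η := by
    intro l hl
    refine (abs_add_le _ _).trans (add_le_add ?_ (M.abs_noise_le_two_mul (hl' l hl) hh s a hη))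
    rw [hv, ← inner_eq_dotProduct]
    refine (abs_real_inner_le_norm _ _).trans ?_
    calc _ ≤ 1 * ‖M.backupParam l h V - p‖ := by gcongr; exact M.norm_φ_le _ _
      _ = _ := one_mul _
      _ ≤ _ := M.norm_backupParam_sub_le hk hl hh hV hb0 hVb
  have h3 := abs_dotProduct_ridgeGram_inv_sum_smul_le I v z e he' (by
    have := M.localVarθ_nonneg L τ
    have := M.localVarμ_nonneg L τ
    positivity)
  rw [hI, Nat.card_Ico, ← hI] at h3
  calc _ ≤ |z ⬝ᵥ ((ridgeGram I v)⁻¹ *ᵥ p.ofLp)|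
        + |z ⬝ᵥ ((ridgeGram I v)⁻¹ *ᵥ ∑ l ∈ I, e l • v l)|
        + |z ⬝ᵥ ((ridgeGram I v)⁻¹ *ᵥ Sf)| := by
        refine (abs_add_le _ _).trans (add_le_add_left ((abs_add_le _ _).trans ?_) _)
        rw [abs_neg]
    _ ≤ _ := add_le_add (add_le_add h1 h3) h2
    _ = _ := by ring

/-- Fixes the radius of the grid for the weight vectors. -/
theorem abs_weight_apply_le {τ k h : ℕ} (hk : k ≤ K) (hh : h < H) (s : ℕ → ℕ → S)
    (a : ℕ → ℕ → A) {V : S → ℝ} {b : ℝ} (hb : 1 ≤ b) (hVb : ∀ x, |V x| ≤ b) (i : Fin d) :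
    |M.weight s a τ k h V i| ≤ b * (k - τ : ℕ) := by
  have h1 := ridge_dotProduct_self_le (Finset.Ico τ k) (fun l => (M.φ (s l h) (a l h)).ofLp)
    (fun l => M.reward l h (s l h) (a l h) + V (s l (h + 1))) (b := 2 * b) (fun l hl => by
      have := (Finset.mem_Ico.mp hl).2
      refine (abs_add_le _ _).trans ?_
      linarith [M.abs_reward_le_one (show l < K by omega) hh (s l h) (a l h),
        hVb (s l (h + 1))])
  refine (abs_apply_le_sqrt_dotProduct_self _ i).trans ?_
  rw [Real.sqrt_le_left (by positivity)]
  refine h1.trans ?_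
  rw [Nat.card_Ico]
  have : ((k - τ : ℕ) : ℝ) ≤ ((k - τ : ℕ) : ℝ) ^ 2 := by
    rw [← Nat.cast_pow, Nat.cast_le]; exact Nat.le_self_pow (by norm_num) _
  nlinarith [sq_nonneg b]

end Deterministic

/-! ### Bellman errors and optimism -/

section Optimism

variable {S A : Type*} [MeasurableSpace S] [MeasurableSpace A] {d H K : ℕ}
  (M : LinearMDP S A d H K)

/-- The vector of the grid of spacing `ε` with integer coordinates `z`. -/
def gridVec (ε : ℝ) (z : Fin d → ℤ) : Fin d → ℝ := fun i => ε * (z i : ℝ)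

/-- The matrix of the grid of spacing `ε` with integer coordinates `Z`. -/
def gridMat (ε : ℝ) (Z : Fin d → Fin d → ℤ) : Matrix (Fin d) (Fin d) ℝ :=
  Matrix.of fun i j => ε * (Z i j : ℝ)

/-- The exponent of the exponential supermartingale for the direction `z` and the function of the
class with parameters `w`, `Z`. -/
noncomputable def gridExponent (s : ℕ → ℕ → S) (a : ℕ → ℕ → A) (β ε : ℝ) (τ k h : ℕ)
    (z w : Fin d → ℤ) (Z : Fin d → Fin d → ℤ) : ℝ :=
  ∑ l ∈ Finset.Ico τ k,
    ((gridVec ε z ⬝ᵥ (M.φ (s l h) (a l h)).ofLp)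
        * M.noise s a (M.classValue β (gridVec ε w) (gridMat ε Z)) l h
      - (|gridVec ε z ⬝ᵥ (M.φ (s l h) (a l h)).ofLp| * H) ^ 2 / 2)

/-- The Bellman error of the estimates of step `h` is bounded by the bonus. -/
def BellmanErrorLe (s : ℕ → ℕ → S) (a : ℕ → ℕ → A) (β : ℝ) (τ k h : ℕ) : Prop :=
  ∀ (x : S) (c : A), |M.weight s a τ k h (M.estV s a β τ k (h + 1)) ⬝ᵥ (M.φ x c).ofLp
      - (M.reward k h x c + ∫ y, M.estV s a β τ k (h + 1) y ∂M.P k h (x, c))| ≤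
    β * weightedNorm (M.gram s a τ k h)⁻¹ (M.φ x c).ofLp

theorem estV_le [Finite A] [Nonempty A] (s : ℕ → ℕ → S) (a : ℕ → ℕ → A) (β : ℝ) (τ k : ℕ) {h : ℕ}
    (hh : h ≤ H) (x : S) : M.estV s a β τ k h x ≤ H := by
  rcases hh.lt_or_eq with hlt | rfl
  · rw [M.estV_eq_iSup s a β τ k hlt]
    exact ciSup_le fun b => min_le_right _ _
  · rw [estV_self]; exact Nat.cast_nonneg _

/-- The bonus covers the Bellman error, and truncation at H is harmless since values are at most H.
Comparing with one policy at a time avoids constructing an optimal policy. -/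
theorem value_le_estV_of_succ [Finite A] {k h : ℕ} (hk : k < K) (hh : h < H)
    {s : ℕ → ℕ → S} {a : ℕ → ℕ → A} {β : ℝ} {τ : ℕ} (hB : M.BellmanErrorLe s a β τ k h)
    {b : ℝ} (hVb : ∀ x, |M.estV s a β τ k (h + 1) x| ≤ b) {π : ℕ → S → A}
    (hπ : ∀ i < H, Measurable (π i))
    (hle : ∀ x, M.value k π (h + 1) x ≤ M.estV s a β τ k (h + 1) x) (x : S) :
    M.value k π h x ≤ M.estV s a β τ k h x := by
  have := M.markov k hk h hh
  rw [M.estV_eq_iSup s a β τ k hh]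
  refine le_trans ?_ (le_ciSup (Set.Finite.bddAbove (Set.finite_range _)) (π h x))
  refine le_min ?_ (M.value_le hk hπ h x)
  rw [M.value_eq hk hπ hh]
  have h1 := (abs_le.mp (hB x (π h x))).1
  have h2 : ∫ y, M.value k π (h + 1) y ∂M.P k h (x, π h x) ≤
      ∫ y, M.estV s a β τ k (h + 1) y ∂M.P k h (x, π h x) :=
    integral_mono (integrable_of_abs_le (M.measurable_value hk hπ _) (M.abs_value_le hk hπ _))
      (integrable_of_abs_le (M.measurable_estV s a β τ k _) hVb) hle
  linarith

theorem estV_eq_classValue [Finite A] {k h τ : ℕ} (hh : h < H) {s : ℕ → ℕ → S}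
    {a : ℕ → ℕ → A} {β : ℝ} (h0 : ∀ x, 0 ≤ M.estV s a β τ k h x) (x : S) :
    M.estV s a β τ k h x = M.classValue β (M.weight s a τ k h (M.estV s a β τ k (h + 1)))
      (M.gram s a τ k h)⁻¹ x := by
  rw [classValue, eq_comm]
  have h1 := M.estV_eq_iSup s a β τ k hh x
  simp only [estQ, qStep] at h1
  rw [← h1]
  exact max_eq_right (h0 x)

/-- The estimate depends on the same data as the noise, so it is replaced by a deterministic
function with rounded parameters, to which the tail bounds apply. The replacement costs η per
target. -/
theorem bellmanErrorLe_of_classValue [Finite A] [Nonempty A] {L τ k h : ℕ}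
    (hk : k ∈ epoch K L τ) (hH : 0 < H) (hh : h < H) {s : ℕ → ℕ → S} {a : ℕ → ℕ → A}
    {β ε t η : ℝ} {N : ℕ} (hβ0 : 0 ≤ β) (hε : 0 < ε) (hN : (L * H : ℝ) / ε + 1 ≤ N)
    (hsmall : L * (d * ε) * (H + H * L + (H : ℝ) ^ 2 * (d * ε) / 2) ≤ 1)
    (hη : d * ε + β * (d * Real.sqrt ε) ≤ η)
    (hβ : (1 + H) * Real.sqrt d + H * Real.sqrt (2 * (t + 1))
      + (M.localVarθ L τ + H * M.localVarμ L τ + 2 * η) * Real.sqrt (d * (k - τ : ℕ)) ≤ β)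
    (hgood : ∀ z w : Fin d → ℤ, ∀ Z : Fin d → Fin d → ℤ, (∀ i, |z i| ≤ N) → (∀ i, |w i| ≤ N) →
      (∀ i j, |Z i j| ≤ N) → M.gridExponent s a β ε τ k h z w Z ≤ t)
    (h0 : ∀ x, 0 ≤ M.estV s a β τ k (h + 1) x)
    {w : Fin d → ℝ} {B : Matrix (Fin d) (Fin d) ℝ} (hw : ∀ i, |w i| ≤ L * H)
    (hB : ∀ i j, |B i j| ≤ L * H)
    (hV : ∀ x, M.estV s a β τ k (h + 1) x = M.classValue β w B x) :
    M.BellmanErrorLe s a β τ k h := by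
  have hk' := mem_epoch.mp hk
  have hH1 : (1 : ℝ) ≤ H := by exact_mod_cast hH
  have hcard : ((k - τ : ℕ) : ℝ) ≤ L := by
    have : k - τ ≤ L := by omega
    exact_mod_cast this
  choose wz hwz hwz' using fun i => exists_int_grid_approx hε hN (hw i)
  choose Bz hBz hBz' using fun i => fun j => exists_int_grid_approx hε hN (hB i j)
  set f := M.classValue β (gridVec ε wz) (gridMat ε Bz) with hf
  have hf0 : ∀ x, 0 ≤ f x := M.classValue_nonneg _ _ _
  have hfH : ∀ x, f x ≤ H := M.classValue_le _ _ _
  have hVH : ∀ x, |M.estV s a β τ k (h + 1) x| ≤ H := fun x =>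
    abs_le.mpr ⟨by linarith [h0 x], M.estV_le s a β τ k (by omega) x⟩
  have hVf : ∀ x, |M.estV s a β τ k (h + 1) x - f x| ≤ η := fun x => by
    rw [hV x]
    exact (M.abs_classValue_sub_le hβ0 hwz' hBz' x).trans hη
  have hself := sq_weightedNorm_sum_le_of_grid (Finset.Ico τ k)
    (fun l => (M.φ (s l h) (a l h)).ofLp) (fun l => M.noise s a f l h) (b := H) (ε := ε) (t := t)
    hH1 (fun l hl => by
      have := (Finset.mem_Ico.mp hl).2
      exact M.abs_noise_le (by omega) hh s a hf0 hfH)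
    (fun l => M.dotProduct_φ_self_le _ _) hε (N := N) (by
      rw [Nat.card_Ico]
      refine le_trans ?_ hN
      gcongr
      nlinarith [(Nat.cast_nonneg L : (0 : ℝ) ≤ L)]) (by
      rw [Nat.card_Ico]
      refine le_trans ?_ hsmall
      gcongr)
    (fun z hz => hgood z wz Bz hz hwz hBz)
  intro x c
  refine (M.abs_weight_dotProduct_sub_le hk hh s a (M.measurable_estV s a β τ k (h + 1))
    (M.measurable_classValue β (gridVec ε wz) (gridMat ε Bz)) (Nat.cast_nonneg H) hVH
    (fun x => abs_le.mpr ⟨by linarith [hf0 x], hfH x⟩)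
    ((abs_nonneg _).trans (hVf x)) hVf (Γ := H * Real.sqrt (2 * (t + 1))) ?_ x c).trans ?_
  · rw [← Real.sqrt_sq (weightedNorm_nonneg _ _), ← Real.sqrt_sq (Nat.cast_nonneg H : (0 : ℝ) ≤ H),
      ← Real.sqrt_mul (by positivity)]
    refine Real.sqrt_le_sqrt (hself.trans_eq ?_)
    ring
  · gcongr
    exact weightedNorm_nonneg _ _

/-- On the event that all grid exponents are small, the estimates are optimistic. -/
theorem optimism_of_gridExponent_le [Finite A] [Nonempty A] {L τ k : ℕ}
    (hk : k ∈ epoch K L τ) (hH : 0 < H) {s : ℕ → ℕ → S} {a : ℕ → ℕ → A}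
    {β ε t η : ℝ} {N : ℕ} (hβ0 : 0 ≤ β) (hε : 0 < ε) (hN : (L * H : ℝ) / ε + 1 ≤ N)
    (hsmall : L * (d * ε) * (H + H * L + (H : ℝ) ^ 2 * (d * ε) / 2) ≤ 1)
    (hη : d * ε + β * (d * Real.sqrt ε) ≤ η)
    (hβ : (1 + H) * Real.sqrt d + H * Real.sqrt (2 * (t + 1))
      + (M.localVarθ L τ + H * M.localVarμ L τ + 2 * η) * Real.sqrt (d * (k - τ : ℕ)) ≤ β)
    (hgood : ∀ h < H, ∀ z w : Fin d → ℤ, ∀ Z : Fin d → Fin d → ℤ, (∀ i, |z i| ≤ N) →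
      (∀ i, |w i| ≤ N) → (∀ i j, |Z i j| ≤ N) → M.gridExponent s a β ε τ k h z w Z ≤ t)
    (n : ℕ) :
    -- The claims feed each other: nonnegativity and class membership at h + 1 bound the Bellman
    -- error at h, which yields optimism at h, then nonnegativity, then class membership at h.
    ∀ h, h + n = H → (∀ x, 0 ≤ M.estV s a β τ k h x) ∧
      (∀ π : ℕ → S → A, (∀ i < H, Measurable (π i)) → ∀ x,
        M.value k π h x ≤ M.estV s a β τ k h x) ∧
      (∃ (w : Fin d → ℝ) (B : Matrix (Fin d) (Fin d) ℝ), (∀ i, |w i| ≤ L * H) ∧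
        (∀ i j, |B i j| ≤ L * H) ∧ ∀ x, M.estV s a β τ k h x = M.classValue β w B x) ∧
      (h < H → M.BellmanErrorLe s a β τ k h) := by
  have hk' := mem_epoch.mp hk
  have hL : 1 ≤ L := by omega
  have hH1 : (1 : ℝ) ≤ H := by exact_mod_cast hH
  have hL1 : (1 : ℝ) ≤ L := by exact_mod_cast hL
  induction n with
  | zero =>
    intro h hh
    obtain rfl : h = H := by omega
    refine ⟨fun x => (M.estV_self s a β τ k x).ge, fun π _ x => ?_,
      ⟨0, 0, fun i => ?_, fun i j => ?_, fun x => ?_⟩, fun hlt => absurd hlt (lt_irrefl _)⟩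
    · rw [M.value_self, M.estV_self]
    · simp only [Pi.zero_apply, abs_zero]; positivity
    · simp only [Matrix.zero_apply, abs_zero]; positivity
    · rw [M.estV_self, classValue]
      simp [weightedNorm]
  | succ n ih =>
    intro h hh
    obtain ⟨ih0, ihπ, ⟨w, B, hw, hB, hV⟩, -⟩ := ih (h + 1) (by omega)
    have hlt : h < H := by omega
    have hVH : ∀ x, |M.estV s a β τ k (h + 1) x| ≤ H := fun x =>
      abs_le.mpr ⟨by linarith [ih0 x], M.estV_le s a β τ k (by omega) x⟩
    have hBell := M.bellmanErrorLe_of_classValue hk hH hlt hβ0 hε hN hsmall hη hβ (hgood h hlt)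
      ih0 hw hB hV
    have hopt : ∀ π : ℕ → S → A, (∀ i < H, Measurable (π i)) → ∀ x,
        M.value k π h x ≤ M.estV s a β τ k h x := fun π hπ =>
      M.value_le_estV_of_succ hk'.2.2 hlt hBell hVH hπ (ihπ π hπ)
    -- The algorithm does not clip at zero; nonnegativity comes from dominating the value of a
    -- constant policy.
    have h0 : ∀ x, 0 ≤ M.estV s a β τ k h x := fun x =>
      (M.value_nonneg hk'.2.2 h x).trans
        (hopt (fun _ _ => Classical.arbitrary A) (fun _ _ => measurable_const) x)
    refine ⟨h0, hopt, ⟨_, _, fun i => ?_, fun i j => ?_, M.estV_eq_classValue hlt h0⟩,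
      fun _ => hBell⟩
    · refine (M.abs_weight_apply_le (by omega) hlt s a hH1 hVH i).trans ?_
      have : ((k - τ : ℕ) : ℝ) ≤ L := by
        have : k - τ ≤ L := by omega
        exact_mod_cast this
      nlinarith
    · rw [gram_eq_ridgeGram]
      refine (abs_ridgeGram_inv_apply_le _ _ i j).trans ?_
      nlinarith

/-! ### Regret decomposition -/

/-- The gap between the value estimate, clipped from below, and the value of `π`. -/
noncomputable def gap (s : ℕ → ℕ → S) (a : ℕ → ℕ → A) (β : ℝ) (τ k : ℕ) (π : ℕ → S → A) (h : ℕ)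
    (x : S) : ℝ :=
  max 0 (M.estV s a β τ k h x) - M.value k π h x

/-- Thanks to the clipping this holds on every trajectory, not only on the good event, as the
exponential supermartingale requires. -/
theorem abs_gap_le [Finite A] [Nonempty A] (s : ℕ → ℕ → S) (a : ℕ → ℕ → A) (β : ℝ) (τ : ℕ) {k : ℕ}
    (hk : k < K) {π : ℕ → S → A} (hπ : ∀ i < H, Measurable (π i)) {h : ℕ} (hh : h ≤ H) (x : S) :
    |M.gap s a β τ k π h x| ≤ H := by
  have h1 := M.value_nonneg (π := π) hk h x
  have h2 := M.value_le hk hπ h x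
  have h3 : max 0 (M.estV s a β τ k h x) ≤ H :=
    max_le (Nat.cast_nonneg H) (M.estV_le s a β τ k hh x)
  have h4 : 0 ≤ max 0 (M.estV s a β τ k h x) := le_max_left _ _
  rw [gap, abs_le]
  constructor <;> linarith

/-- One bonus is contained in the greedy Q value, the other bounds the Bellman error; hence the
factor 2. -/
theorem gap_le_of_greedy [Finite A] [Nonempty A] {k h τ : ℕ} (hk : k < K) (hh : h < H)
    {s : ℕ → ℕ → S} {a : ℕ → ℕ → A} {β : ℝ} (hB : M.BellmanErrorLe s a β τ k h)
    (h0 : ∀ x, 0 ≤ M.estV s a β τ k h x)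
    (h0' : ∀ x, 0 ≤ M.estV s a β τ k (h + 1) x) {π : ℕ → S → A} (hπ : ∀ i < H, Measurable (π i))
    (hgreedy : ∀ x c, M.estQ s a β τ k h x c ≤ M.estQ s a β τ k h x (π h x)) (x : S) :
    M.gap s a β τ k π h x ≤ 2 * β * weightedNorm (M.gram s a τ k h)⁻¹ (M.φ x (π h x)).ofLp
      + ∫ y, M.gap s a β τ k π (h + 1) y ∂M.P k h (x, π h x) := by
  have := M.markov k hk h hh
  have hVH : ∀ x, |M.estV s a β τ k (h + 1) x| ≤ H := fun x =>
    abs_le.mpr ⟨by linarith [h0' x, (Nat.cast_nonneg H : (0 : ℝ) ≤ H)],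
      M.estV_le s a β τ k (by omega) x⟩
  have hint : ∫ y, M.gap s a β τ k π (h + 1) y ∂M.P k h (x, π h x) =
      ∫ y, M.estV s a β τ k (h + 1) y ∂M.P k h (x, π h x)
        - ∫ y, M.value k π (h + 1) y ∂M.P k h (x, π h x) := by
    rw [← integral_sub (integrable_of_abs_le (M.measurable_estV s a β τ k _) hVH)
      (integrable_of_abs_le (M.measurable_value hk hπ _) (M.abs_value_le hk hπ _))]
    refine integral_congr_ae (Filter.Eventually.of_forall fun y => ?_)
    simp only [gap, max_eq_right (h0' y)]
  have h1 : M.estV s a β τ k h x ≤ M.weight s a τ k h (M.estV s a β τ k (h + 1)) ⬝ᵥ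
      (M.φ x (π h x)).ofLp + β * weightedNorm (M.gram s a τ k h)⁻¹ (M.φ x (π h x)).ofLp := by
    rw [M.estV_eq_iSup s a β τ k hh]
    refine (ciSup_le fun c => hgreedy x c).trans (min_le_left _ _)
  have h2 := (abs_le.mp (hB x (π h x))).2
  rw [hint, gap, max_eq_right (h0 x), M.value_eq hk hπ hh]
  linarith

/-- Unrolls the recursion along the trajectory: replacing the expected next gap by the sampled one
subtracts its noise. -/
theorem gap_le_sum [Finite A] [Nonempty A] {k τ : ℕ} (hk : k < K)
    {s : ℕ → ℕ → S} {a : ℕ → ℕ → A} {β : ℝ} (hB : ∀ h < H, M.BellmanErrorLe s a β τ k h)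
    (h0 : ∀ h ≤ H, ∀ x, 0 ≤ M.estV s a β τ k h x) {π : ℕ → S → A}
    (hπ : ∀ i < H, Measurable (π i)) (ha : ∀ h < H, a k h = π h (s k h))
    (hgreedy : ∀ h < H, ∀ x c, M.estQ s a β τ k h x c ≤ M.estQ s a β τ k h x (π h x)) {n : ℕ}
    (hn : n ≤ H) :
    M.gap s a β τ k π 0 (s k 0) ≤
      ∑ h ∈ Finset.range n, (2 * β * weightedNorm (M.gram s a τ k h)⁻¹
          (M.φ (s k h) (a k h)).ofLp - M.noise s a (M.gap s a β τ k π (h + 1)) k h)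
        + M.gap s a β τ k π n (s k n) := by
  induction n with
  | zero => simp
  | succ n ih =>
    refine (ih (by omega)).trans ?_
    have h1 := M.gap_le_of_greedy hk (by omega) (hB n (by omega)) (h0 n (by omega))
      (h0 (n + 1) hn) hπ (hgreedy n (by omega)) (s k n)
    rw [← ha n (by omega)] at h1
    rw [Finset.sum_range_succ]
    simp only [noise]
    linarith

theorem optValue_sub_value_le [Finite A] [Nonempty A] {k τ : ℕ} (hk : k < K)
    {s : ℕ → ℕ → S} {a : ℕ → ℕ → A} {β : ℝ} (hB : ∀ h < H, M.BellmanErrorLe s a β τ k h)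
    (h0 : ∀ h ≤ H, ∀ x, 0 ≤ M.estV s a β τ k h x)
    (hopt : ∀ π : ℕ → S → A, (∀ i < H, Measurable (π i)) → ∀ x,
        M.value k π 0 x ≤ M.estV s a β τ k 0 x) {π : ℕ → S → A}
    (hπ : ∀ i < H, Measurable (π i)) (ha : ∀ h < H, a k h = π h (s k h))
    (hgreedy : ∀ h < H, ∀ x c, M.estQ s a β τ k h x c ≤ M.estQ s a β τ k h x (π h x)) :
    M.optValue k 0 (s k 0) - M.value k π 0 (s k 0) ≤
      ∑ h ∈ Finset.range H, 2 * β * weightedNorm (M.gram s a τ k h)⁻¹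
          (M.φ (s k h) (a k h)).ofLp
        + ∑ h ∈ Finset.range H, -M.noise s a (M.gap s a β τ k π (h + 1)) k h := by
  have h1 := M.gap_le_sum hk hB h0 hπ ha hgreedy le_rfl
  have h2 : M.gap s a β τ k π H (s k H) = 0 := by
    simp [gap, M.estV_self, M.value_self]
  have : Nonempty {π : ℕ → S → A // ∀ i, Measurable (π i)} :=
    ⟨⟨fun _ _ => Classical.arbitrary A, fun _ => measurable_const⟩⟩
  have h3 : M.optValue k 0 (s k 0) ≤ M.estV s a β τ k 0 (s k 0) :=
    ciSup_le fun π => hopt π.1 (fun i _ => π.2 i) _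
  rw [h2, add_zero, Finset.sum_sub_distrib] at h1
  rw [gap, max_eq_right (h0 0 (by omega) _)] at h1
  rw [Finset.sum_neg_distrib]
  linarith

end Optimism

end LinearMDP

/-! ### Compensated increments of exponential supermartingales -/

section ExpIncrement

open scoped ENNReal

/-- The centred increment `g (ω, Y ω)` minus half of the square of its bound `u`, where `P (Z ω)` is
the conditional law of `Y`. -/
noncomputable def expIncrement {Ω S T : Type*} [MeasurableSpace S] [MeasurableSpace T]
    (P : Kernel T S) (Y : Ω → S) (Z : Ω → T) (g : Ω × S → ℝ) (u : Ω → ℝ) (ω : Ω) : ℝ :=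
  g (ω, Y ω) - ∫ y, g (ω, y) ∂P (Z ω) - u ω ^ 2 / 2

theorem measurable_integral_kernel_comp {Ω S T : Type*} [MeasurableSpace Ω] [MeasurableSpace S]
    [MeasurableSpace T] (P : Kernel T S) [IsMarkovKernel P] {Z : Ω → T} (hZ : Measurable Z)
    {g : Ω × S → ℝ} (hg : Measurable g) : Measurable fun ω => ∫ y, g (ω, y) ∂P (Z ω) :=
  (hg.stronglyMeasurable.integral_kernel_prod_right' (κ := P.comap Z hZ)).measurable

theorem measurable_expIncrement {Ω S T : Type*} {m m' : MeasurableSpace Ω} (hm : m ≤ m')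
    [MeasurableSpace S] [MeasurableSpace T] (P : Kernel T S) [IsMarkovKernel P] {Y : Ω → S}
    (hY : Measurable[m'] Y) {Z : Ω → T} (hZ : Measurable[m] Z) {g : Ω × S → ℝ}
    (hg : Measurable[m.prod inferInstance] g) {u : Ω → ℝ} (hu : Measurable[m] u) :
    Measurable[m'] (expIncrement P Y Z g u) := by
  have hg' : Measurable[m'.prod inferInstance] g :=
    hg.mono (sup_le_sup (MeasurableSpace.comap_mono hm) le_rfl) le_rfl
  have h1 : Measurable[m'] fun ω => g (ω, Y ω) := hg'.comp (measurable_id.prodMk hY)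
  have h2 : Measurable[m'] fun ω => ∫ y, g (ω, y) ∂P (Z ω) :=
    (@measurable_integral_kernel_comp _ _ _ m _ _ P _ Z hZ g hg).mono hm le_rfl
  have h3 : Measurable[m'] u := hu.mono hm le_rfl
  exact (h1.sub h2).sub ((h3.pow_const 2).div_const 2)

theorem measurable_mul_prod {Ω S : Type*} [MeasurableSpace Ω] [MeasurableSpace S] {c : Ω → ℝ}
    {f : S → ℝ} (hc : Measurable c) (hf : Measurable f) :
    Measurable fun q : Ω × S => c q.1 * f q.2 :=
  (hc.comp measurable_fst).mul (hf.comp measurable_snd)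

end ExpIncrement

namespace LinearMDP

/-! ### The run of the algorithm as an adapted process -/

section Run

variable {S A Ω : Type*} [MeasurableSpace S] [MeasurableSpace A] {mΩ : MeasurableSpace Ω}
  {d H K W : ℕ} {M : LinearMDP S A d H K} {c p : ℝ} {Pr : Measure Ω}
  {F : Filtration ℕ mΩ} {s : ℕ → ℕ → Ω → S} {π : ℕ → ℕ → Ω → S → A}

namespace IsRun

theorem measurable_action (hrun : M.IsRun W c p Pr F s π) {k h : ℕ} (hk : k < K) (hh : h < H) :
    Measurable[F (k * (H + 1) + h)] fun ω => π k h ω (s k h ω) := by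
  have h1 := hrun.measurable_policy k hk h hh
  have h2 := hrun.adapted k hk h hh.le
  have h3 : @Measurable Ω (Ω × S) (F (k * (H + 1) + h)) ((F (k * (H + 1))).prod inferInstance)
      fun ω => (ω, s k h ω) := by
    refine Measurable.prodMk (fun t ht => ?_) h2
    exact F.mono (Nat.le_add_right _ _) t ht
  exact h1.comp h3

theorem measurable_stateAction (hrun : M.IsRun W c p Pr F s π) {k h : ℕ} (hk : k < K)
    (hh : h < H) : Measurable[F (k * (H + 1) + h)] fun ω => (s k h ω, π k h ω (s k h ω)) :=
  Measurable.prodMk (hrun.adapted k hk h hh.le) (hrun.measurable_action hk hh)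

theorem measurable_policy_section (hrun : M.IsRun W c p Pr F s π) {k : ℕ} (hk : k < K) (ω : Ω) :
    ∀ i < H, Measurable (π k i ω) := by
  intro i hi
  have h1 := hrun.measurable_policy k hk i hi
  have h2 : @Measurable S (Ω × S) _ ((F (k * (H + 1))).prod inferInstance) fun x => (ω, x) :=
    Measurable.prodMk measurable_const measurable_id
  exact h1.comp h2

theorem measurable_expIncrement_run (hrun : M.IsRun W c p Pr F s π) {k h : ℕ} (hk : k < K)
    (hh : h < H) {g : Ω × S → ℝ}
    (hg : Measurable[(F (k * (H + 1) + h)).prod inferInstance] g) {u : Ω → ℝ}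
    (hu : Measurable[F (k * (H + 1) + h)] u) :
    Measurable[F (k * (H + 1) + h + 1)] (expIncrement (M.P k h) (s k (h + 1))
      (fun ω => (s k h ω, π k h ω (s k h ω))) g u) := by
  have := M.markov k hk h hh
  exact measurable_expIncrement (F.mono (Nat.le_succ _)) _ (hrun.adapted k hk (h + 1) hh)
    (hrun.measurable_stateAction hk hh) hg hu

theorem measurable_sum_expIncrement (hrun : M.IsRun W c p Pr F s π) {g : ℕ → ℕ → Ω × S → ℝ}
    {u : ℕ → ℕ → Ω → ℝ}
    (hg : ∀ k < K, ∀ h < H, Measurable[(F (k * (H + 1) + h)).prod inferInstance] (g k h))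
    (hu : ∀ k < K, ∀ h < H, Measurable[F (k * (H + 1) + h)] (u k h)) {τ n : ℕ} (hn : n ≤ K) :
    Measurable fun ω => ∑ k ∈ Finset.Ico τ n, ∑ h ∈ Finset.range H,
      expIncrement (M.P k h) (s k (h + 1)) (fun ω => (s k h ω, π k h ω (s k h ω)))
        (g k h) (u k h) ω := by
  refine Finset.measurable_fun_sum _ fun k hk => Finset.measurable_fun_sum _ fun h hh => ?_
  have hk' := (Finset.mem_Ico.mp hk).2
  have hh' := Finset.mem_range.mp hh
  exact (hrun.measurable_expIncrement_run (by omega) hh' (hg k (by omega) h hh')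
    (hu k (by omega) h hh')).mono (F.le _) le_rfl

theorem lintegral_exp_sum_expIncrement_le_one [IsProbabilityMeasure Pr]
    (hrun : M.IsRun W c p Pr F s π)
    {g : ℕ → ℕ → Ω × S → ℝ} {u : ℕ → ℕ → Ω → ℝ}
    (hg : ∀ k < K, ∀ h < H, Measurable[(F (k * (H + 1) + h)).prod inferInstance] (g k h))
    (hu : ∀ k < K, ∀ h < H, Measurable[F (k * (H + 1) + h)] (u k h))
    (hgu : ∀ k < K, ∀ h < H, ∀ ω y, |g k h (ω, y)| ≤ u k h ω) {τ n : ℕ} (hn : n ≤ K) :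
    ∫⁻ ω, ENNReal.ofReal (Real.exp (∑ k ∈ Finset.Ico τ n, ∑ h ∈ Finset.range H,
      expIncrement (M.P k h) (s k (h + 1)) (fun ω => (s k h ω, π k h ω (s k h ω)))
        (g k h) (u k h) ω)) ∂Pr ≤ 1 := by
  refine lintegral_exp_sum_sum_le_one F _ (fun k hk h hh =>
    hrun.measurable_expIncrement_run hk hh (hg k hk h hh) (hu k hk h hh))
    (fun k hk h hh G hG => ?_) hn
  have := M.markov k hk h hh
  exact lintegral_mul_exp_le_of_condExp (F.le _)
    ((hrun.adapted k hk (h + 1) hh).mono (F.le _) le_rfl) (M.P k h)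
    (hrun.measurable_stateAction hk hh) (hrun.transition k hk h hh) (hg k hk h hh) (hu k hk h hh)
    (hgu k hk h hh) hG

/-! ### Uniform concentration over the grid -/

section Grid

variable (M s π) in
/-- The grid exponent of the trajectory `ω`. -/
noncomputable def trajGridExponent (β ε : ℝ) (τ k h : ℕ) (z w : Fin d → ℤ)
    (Z : Fin d → Fin d → ℤ) (ω : Ω) : ℝ :=
  M.gridExponent (fun l i => s l i ω) (fun l i => π l i ω (s l i ω)) β ε τ k h z w Z

variable (M s π) in
/-- The projection of the feature of step `h` of episode `l` to the direction `z`, or zero at a step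
other than `h`. -/
noncomputable def stepCoeff (ε : ℝ) (h : ℕ) (z : Fin d → ℤ) (l i : ℕ) (ω : Ω) : ℝ :=
  if i = h then gridVec ε z ⬝ᵥ (M.φ (s l i ω) (π l i ω (s l i ω))).ofLp else 0

theorem measurable_stepCoeff (hrun : M.IsRun W c p Pr F s π) (ε : ℝ) (h : ℕ) (z : Fin d → ℤ)
    {l i : ℕ} (hl : l < K) (hi : i < H) :
    Measurable[F (l * (H + 1) + i)] (stepCoeff M s π ε h z l i) := by
  unfold stepCoeff
  split_ifs
  · simp only [dotProduct]
    refine Finset.measurable_fun_sum (m := F (l * (H + 1) + i)) _ fun j _ => ?_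
    have h1 := (M.measurable_φ_apply j).comp (hrun.measurable_stateAction hl hi)
    exact Measurable.const_mul h1 _
  · exact measurable_const

/-- The exponent involves step h only. Zero coefficients at the other steps extend it to a sum over
all steps, as the row-wise supermartingale bound expects. -/
theorem trajGridExponent_eq (β ε : ℝ) (τ k : ℕ) {h : ℕ} (hh : h < H) (z w : Fin d → ℤ)
    (Z : Fin d → Fin d → ℤ) (ω : Ω) :
    trajGridExponent M s π β ε τ k h z w Z ω =
      ∑ l ∈ Finset.Ico τ k, ∑ i ∈ Finset.range H,
        expIncrement (M.P l i) (s l (i + 1)) (fun ω => (s l i ω, π l i ω (s l i ω)))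
          (fun q => stepCoeff M s π ε h z l i q.1
            * M.classValue β (gridVec ε w) (gridMat ε Z) q.2)
          (fun ω => |stepCoeff M s π ε h z l i ω| * H) ω := by
  rw [trajGridExponent, gridExponent]
  refine Finset.sum_congr rfl fun l _ => ?_
  rw [Finset.sum_eq_single h]
  · simp only [expIncrement, stepCoeff, if_true, noise]
    rw [integral_const_mul]
    ring
  · intro i _ hi
    simp [expIncrement, stepCoeff, hi]
  · intro hnot
    exact absurd (Finset.mem_range.mpr hh) hnot

theorem measurable_trajGridExponent [Finite A] (hrun : M.IsRun W c p Pr F s π) (β ε : ℝ)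
    {τ k h : ℕ} (hk : k ≤ K) (hh : h < H) (z w : Fin d → ℤ) (Z : Fin d → Fin d → ℤ) :
    Measurable (trajGridExponent M s π β ε τ k h z w Z) := by
  have heq := funext (trajGridExponent_eq (M := M) (s := s) (π := π) β ε τ k hh z w Z)
  rw [heq]
  refine hrun.measurable_sum_expIncrement (fun l hl i hi => ?_) (fun l hl i hi => ?_) hk
  · exact @measurable_mul_prod _ _ (F (l * (H + 1) + i)) _ _ _
      (hrun.measurable_stepCoeff ε h z hl hi) (M.measurable_classValue _ _ _)
  · exact Measurable.mul_const
      (continuous_abs.measurable.comp (hrun.measurable_stepCoeff ε h z hl hi)) _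

theorem lintegral_exp_trajGridExponent_le_one [Finite A] [Nonempty A]
    [IsProbabilityMeasure Pr]
    (hrun : M.IsRun W c p Pr F s π) (β ε : ℝ) {τ k h : ℕ} (hk : k ≤ K) (hh : h < H)
    (z w : Fin d → ℤ) (Z : Fin d → Fin d → ℤ) :
    ∫⁻ ω, ENNReal.ofReal (Real.exp (trajGridExponent M s π β ε τ k h z w Z ω)) ∂Pr ≤ 1 := by
  simp only [trajGridExponent_eq β ε τ k hh]
  refine hrun.lintegral_exp_sum_expIncrement_le_one (fun l hl i hi => ?_) (fun l hl i hi => ?_)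
    (fun l hl i hi ω y => ?_) hk
  · exact @measurable_mul_prod _ _ (F (l * (H + 1) + i)) _ _ _
      (hrun.measurable_stepCoeff ε h z hl hi) (M.measurable_classValue _ _ _)
  · exact Measurable.mul_const
      (continuous_abs.measurable.comp (hrun.measurable_stepCoeff ε h z hl hi)) _
  · rw [abs_mul, abs_of_nonneg (M.classValue_nonneg _ _ _ y)]
    gcongr
    exact M.classValue_le _ _ _ y

/-- The finite set of integer vectors with coordinates bounded by `N`. -/
noncomputable def intBox (ι : Type*) [Fintype ι] [DecidableEq ι] (N : ℕ) : Finset (ι → ℤ) :=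
  Fintype.piFinset fun _ => Finset.Icc (-(N : ℤ)) N

theorem mem_intBox {ι : Type*} [Fintype ι] [DecidableEq ι] {N : ℕ} {z : ι → ℤ} :
    z ∈ intBox ι N ↔ ∀ i, |z i| ≤ N := by
  simp [intBox, abs_le]

theorem card_intBox (ι : Type*) [Fintype ι] [DecidableEq ι] (N : ℕ) :
    (intBox ι N).card = (2 * N + 1) ^ Fintype.card ι := by
  rw [intBox, Fintype.card_piFinset, Finset.prod_const, Int.card_Icc, Finset.card_univ]
  congr 1
  omega

theorem measure_exists_trajGridExponent_gt_le [Finite A] [Nonempty A]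
    [IsProbabilityMeasure Pr]
    (hrun : M.IsRun W c p Pr F s π) (β : ℕ → ℝ) (ε : ℝ) (L τ N : ℕ) (hd : 0 < d) {t δ : ℝ}
    (hδ : (L * H : ℝ) * (2 * N + 1) ^ (3 * d ^ 2) * Real.exp (-t) ≤ δ) :
    Pr {ω | ∃ k ∈ epoch K L τ, ∃ h < H, ∃ z w : Fin d → ℤ, ∃ Z : Fin d → Fin d → ℤ,
      (∀ i, |z i| ≤ N) ∧ (∀ i, |w i| ≤ N) ∧ (∀ i j, |Z i j| ≤ N) ∧
      t < trajGridExponent M s π (β k) ε τ k h z w Z ω} ≤ ENNReal.ofReal δ := by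
  let I : Finset ((ℕ × ℕ) × ((Fin d → ℤ) × (Fin d → ℤ)) × (Fin d × Fin d → ℤ)) :=
    (epoch K L τ ×ˢ Finset.range H) ×ˢ (intBox (Fin d) N ×ˢ intBox (Fin d) N)
      ×ˢ intBox (Fin d × Fin d) N
  have hI : ∀ i ∈ I, i.1.1 < K ∧ i.1.2 < H := by
    intro i hi
    simp only [I, Finset.mem_product, Finset.mem_range, mem_epoch] at hi
    exact ⟨hi.1.1.2.2, hi.1.2⟩
  have hcard : (I.card : ℝ) ≤ (L * H : ℝ) * (2 * N + 1) ^ (3 * d ^ 2) := by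
    have h1 : (epoch K L τ).card ≤ L := by
      rw [epoch, Nat.card_Ico]; omega
    have h2 : I.card ≤ (L * H) * (2 * N + 1) ^ (3 * d ^ 2) := by
      simp only [I, Finset.card_product, card_intBox, Finset.card_range, Fintype.card_fin,
        Fintype.card_prod]
      rw [← pow_add, ← pow_add]
      -- Direction, weight and bonus matrix have d + d + d² ≤ 3d² coordinates.
      refine Nat.mul_le_mul (Nat.mul_le_mul_right _ h1) (Nat.pow_le_pow_right (by omega) ?_)
      nlinarith
    exact_mod_cast h2
  have key := measure_exists_lt_le_of_lintegral_exp_le_one (Pr := Pr) I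
    (fun i => trajGridExponent M s π (β i.1.1) ε τ i.1.1 i.1.2 i.2.1.1 i.2.1.2
      (fun j j' => i.2.2 (j, j')))
    (fun i hi => hrun.measurable_trajGridExponent _ _ (hI i hi).1.le (hI i hi).2 _ _ _)
    (fun i hi => hrun.lintegral_exp_trajGridExponent_le_one _ _ (hI i hi).1.le (hI i hi).2 _ _ _)
    (t := t) (δ := δ) (le_trans (by gcongr) hδ)
  refine le_trans (measure_mono ?_) key
  rintro ω ⟨k, hk, h, hh, z, w, Z, hz, hw, hZ, hlt⟩
  refine ⟨((k, h), (z, w), fun j => Z j.1 j.2), ?_, hlt⟩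
  simp only [I, Finset.mem_product, Finset.mem_range, mem_intBox]
  exact ⟨⟨hk, hh⟩, ⟨hz, hw⟩, fun j => hZ j.1 j.2⟩

end Grid

/-! ### The martingale part of the regret -/

section Gap

variable (M s π) in
/-- The gap between value estimate and value of the trajectory `ω`. -/
noncomputable def trajGap (β : ℕ → ℝ) (τ k h : ℕ) (ω : Ω) : S → ℝ :=
  M.gap (fun l i => s l i ω) (fun l i => π l i ω (s l i ω)) (β k) τ k (fun h => π k h ω) h

/-- The estimate uses earlier episodes only and the policy is fixed at the start of the episode. The
gap is therefore predictable, and its noise a martingale difference. -/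
theorem measurable_trajGap [Finite A] (hrun : M.IsRun W c p Pr F s π) (β : ℕ → ℝ) (τ : ℕ)
    {k h : ℕ} (hk : k < K) (hh : h ≤ H) :
    Measurable[(F (k * (H + 1))).prod inferInstance]
      fun q : Ω × S => trajGap M s π β τ k h q.1 q.2 := by
  have hs : ∀ l ∈ Finset.Ico τ k, ∀ h ≤ H, Measurable[F (k * (H + 1))] (s l h) := by
    intro l hl h hh
    have := (Finset.mem_Ico.mp hl).2
    exact (hrun.adapted l (by omega) h hh).mono (F.mono (by nlinarith)) le_rfl
  have ha : ∀ l ∈ Finset.Ico τ k, ∀ h < H,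
      Measurable[F (k * (H + 1))] fun ω => π l h ω (s l h ω) := by
    intro l hl h hh
    have := (Finset.mem_Ico.mp hl).2
    exact (hrun.measurable_action (by omega) hh).mono (F.mono (by nlinarith)) le_rfl
  have h1 := @measurable_estVRemaining S A _ _ d H K M Ω (F (k * (H + 1))) s
    (fun l h ω => π l h ω (s l h ω)) τ k _ hs ha (β k) (H - h) (Nat.sub_le _ _)
  have h2 := @measurable_value_uncurry S A _ _ d H K M k Ω (F (k * (H + 1))) hk (π k)
    (hrun.measurable_policy k hk) (H - h) h (by omega)
  exact Measurable.sub (Measurable.max measurable_const h1) h2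

/-- Azuma–Hoeffding with a free parameter: each of at most LH increments, scaled by `lam`, costs
(lam·H)²/2. Predictability of the gap makes a grid unnecessary. -/
theorem measure_sum_noise_trajGap_gt_le [Finite A] [Nonempty A] [IsProbabilityMeasure Pr]
    (hrun : M.IsRun W c p Pr F s π)
    (β : ℕ → ℝ) (L τ : ℕ) {lam t δ : ℝ} (hlam : 0 < lam) (hδ : Real.exp (-t) ≤ δ) :
    Pr {ω | t + L * H * ((lam * H) ^ 2 / 2) < lam * ∑ k ∈ epoch K L τ, ∑ h ∈ Finset.range H,
      -M.noise (fun l i => s l i ω) (fun l i => π l i ω (s l i ω))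
        (trajGap M s π β τ k (h + 1) ω) k h} ≤ ENNReal.ofReal δ := by
  have hg : ∀ k < K, ∀ h < H, Measurable[(F (k * (H + 1) + h)).prod inferInstance]
      fun q : Ω × S => -lam * trajGap M s π β τ k (h + 1) q.1 q.2 := by
    intro k hk h hh
    refine Measurable.const_mul ?_ _
    exact (hrun.measurable_trajGap β τ hk hh).mono
      (sup_le_sup (MeasurableSpace.comap_mono (F.mono (Nat.le_add_right _ _))) le_rfl) le_rfl
  have hu : ∀ k < K, ∀ h < H, Measurable[F (k * (H + 1) + h)] fun _ : Ω => lam * H :=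
    fun _ _ _ _ => measurable_const
  have hgu : ∀ k < K, ∀ h < H, ∀ (ω : Ω) (y : S),
      |-lam * trajGap M s π β τ k (h + 1) ω y| ≤ lam * H := by
    intro k hk h hh ω y
    rw [abs_mul, abs_neg, abs_of_pos hlam]
    gcongr
    exact M.abs_gap_le _ _ _ τ hk (hrun.measurable_policy_section hk ω) hh y
  have hn : min (τ + L) K ≤ K := min_le_right _ _
  have key := measure_exists_lt_le_of_lintegral_exp_le_one (Pr := Pr) (Finset.univ : Finset Unit)
    _ (fun _ _ => hrun.measurable_sum_expIncrement hg hu (τ := τ) hn)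
    (fun _ _ => hrun.lintegral_exp_sum_expIncrement_le_one hg hu hgu hn)
    (t := t) (δ := δ) (by simpa using hδ)
  refine le_trans (measure_mono ?_) key
  intro ω hω
  refine ⟨(), Finset.mem_univ _, ?_⟩
  have heq : ∀ k h, expIncrement (M.P k h) (s k (h + 1)) (fun ω => (s k h ω, π k h ω (s k h ω)))
      (fun q : Ω × S => -lam * trajGap M s π β τ k (h + 1) q.1 q.2) (fun _ => lam * H) ω =
      lam * -M.noise (fun l i => s l i ω) (fun l i => π l i ω (s l i ω))
        (trajGap M s π β τ k (h + 1) ω) k h - (lam * H) ^ 2 / 2 := by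
    intro k h
    simp only [expIncrement, noise]
    rw [integral_const_mul]
    ring
  simp only [heq, Finset.sum_sub_distrib, Finset.sum_const, Finset.card_range, nsmul_eq_mul,
    ← Finset.mul_sum]
  have hcard : ((Finset.Ico τ (min (τ + L) K)).card : ℝ) ≤ L := by
    rw [Nat.card_Ico]
    have : min (τ + L) K - τ ≤ L := by omega
    exact_mod_cast this
  have h2 : ((Finset.Ico τ (min (τ + L) K)).card : ℝ) * (H * ((lam * H) ^ 2 / 2)) ≤
      L * (H * ((lam * H) ^ 2 / 2)) := by gcongr
  have h3 : t + L * H * ((lam * H) ^ 2 / 2) < lam * ∑ k ∈ Finset.Ico τ (min (τ + L) K),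
      ∑ h ∈ Finset.range H, -M.noise (fun l i => s l i ω) (fun l i => π l i ω (s l i ω))
        (trajGap M s π β τ k (h + 1) ω) k h := hω
  linarith

end Gap

end IsRun

end Run

/-! ### Choice of grid spacing, grid size and threshold -/

section Constants

theorem log_ge_of_two_le {X : ℝ} (hX : 2 ≤ X) : (0.69 : ℝ) ≤ Real.log X := by
  have h1 := Real.log_two_gt_d9
  have h2 := Real.log_le_log (by norm_num) hX
  linarith

variable {d h l X c r : ℝ}

/-- The grid spacing will be ε = r², so that √ε = r; it beats every power of X that occurs. -/
theorem spacing_sq_mul_pow_le_one (hX : 2 ≤ X) (hc : 40 ≤ c) (hr : 0 < r)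
    (hrX : r * ((c + 1) * X ^ 4) = 1) {n : ℕ} (hn : n ≤ 8) : r ^ 2 * X ^ n ≤ 1 := by
  have hr1 : r * X ^ 4 ≤ 1 := by
    have : 0 < r * X ^ 4 := by positivity
    nlinarith
  calc r ^ 2 * X ^ n ≤ r ^ 2 * X ^ 8 := by gcongr; linarith
    _ = (r * X ^ 4) ^ 2 := by ring
    _ ≤ 1 := pow_le_one₀ (by positivity) hr1

theorem direction_error_le_one (hd : 1 ≤ d) (hh : 1 ≤ h) (hl : 1 ≤ l) (hX : 2 * (d * (l * h)) ≤ X)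
    (hc : 40 ≤ c) (hr : 0 < r) (hrX : r * ((c + 1) * X ^ 4) = 1) :
    l * (d * r ^ 2) * (h + h * l + h ^ 2 * (d * r ^ 2) / 2) ≤ 1 := by
  have hlh : 1 ≤ l * h := by nlinarith
  have hX0 : 2 ≤ X := by nlinarith
  have hlX : l ≤ l * h := by nlinarith
  have hhX : h ≤ l * h := by nlinarith
  have hdX : d ≤ X := by nlinarith
  have hlhX : 2 * (l * h) ≤ X := by nlinarith
  have hdε : d * r ^ 2 ≤ 1 := by
    calc d * r ^ 2 ≤ X * r ^ 2 := by gcongr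
      _ = r ^ 2 * X ^ 1 := by ring
      _ ≤ 1 := spacing_sq_mul_pow_le_one hX0 hc hr hrX (by norm_num)
  have h2 : h ^ 2 * (d * r ^ 2) / 2 ≤ h ^ 2 := by
    have : h ^ 2 * (d * r ^ 2) ≤ h ^ 2 * 1 := by gcongr
    linarith [sq_nonneg h]
  have h1 : l * (h + h * l + h ^ 2 * (d * r ^ 2) / 2) ≤ X * X := by
    calc l * (h + h * l + h ^ 2 * (d * r ^ 2) / 2) ≤ l * (h + h * l + h ^ 2) := by gcongr
      _ = (l * h) * (1 + l + h) := by ring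
      _ ≤ (l * h) * (3 * (l * h)) := by gcongr; linarith
      _ = 3 / 4 * (2 * (l * h)) * (2 * (l * h)) := by ring
      _ ≤ 3 / 4 * X * X := by gcongr
      _ ≤ X * X := by nlinarith
  calc l * (d * r ^ 2) * (h + h * l + h ^ 2 * (d * r ^ 2) / 2)
      = d * r ^ 2 * (l * (h + h * l + h ^ 2 * (d * r ^ 2) / 2)) := by ring
    _ ≤ X * r ^ 2 * (X * X) := by gcongr
    _ = r ^ 2 * X ^ 3 := by ring
    _ ≤ 1 := spacing_sq_mul_pow_le_one hX0 hc hr hrX (by norm_num)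

theorem sqrt_le_self_of_one_le {x : ℝ} (hx : 1 ≤ x) : Real.sqrt x ≤ x := by
  rw [Real.sqrt_le_left (by positivity)]; nlinarith

theorem sqrt_log_le (hX : 2 ≤ X) : Real.sqrt (Real.log X) ≤ X := by
  have h1 : Real.log X ≤ X := (Real.log_le_sub_one_of_pos (by linarith)).trans (by linarith)
  exact (Real.sqrt_le_sqrt h1).trans (sqrt_le_self_of_one_le (by linarith))

/-- The bonus term dictates r: since β ≤ (c + 1)X², multiplying β·d·r by 2lh costs two more powers
of X, and (c + 1)X⁴r = 1 is exactly enough. -/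
theorem approximation_error_le (hd : 1 ≤ d) (hh : 1 ≤ h) (hl : 1 ≤ l)
    (hX : 2 * (d * (l * h)) ≤ X) (hc : 40 ≤ c) (hr : 0 < r) (hrX : r * ((c + 1) * X ^ 4) = 1)
    {β : ℝ} (hβ : β ≤ c * d * h * Real.sqrt (Real.log X) + (1 + h) * Real.sqrt (d * l)) :
    d * r ^ 2 + β * (d * r) ≤ 1 / (l * h) := by
  have hlh : 1 ≤ l * h := by nlinarith
  have hdl : 1 ≤ d * l := by nlinarith
  have hdh : 1 ≤ d * h := by nlinarith
  have hX0 : 2 ≤ X := by nlinarith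
  have hdX : d ≤ X := by nlinarith
  have hdhX : d * h ≤ X := by nlinarith
  have hlhX : 2 * (l * h) ≤ X := by nlinarith
  have h1 : β ≤ (c + 1) * X ^ 2 := by
    have h2 : c * d * h * Real.sqrt (Real.log X) ≤ c * (X * X) := by
      calc c * d * h * Real.sqrt (Real.log X) = c * ((d * h) * Real.sqrt (Real.log X)) := by ring
        _ ≤ c * (X * X) := by
          gcongr
          exact sqrt_log_le hX0
    have h3 : (1 + h) * Real.sqrt (d * l) ≤ X := by
      calc (1 + h) * Real.sqrt (d * l) ≤ (2 * h) * (d * l) := by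
            gcongr
            · linarith
            · exact sqrt_le_self_of_one_le hdl
        _ = 2 * (d * (l * h)) := by ring
        _ ≤ X := hX
    nlinarith
  have h4 : d * r ^ 2 * (2 * (l * h)) ≤ 1 := by
    calc d * r ^ 2 * (2 * (l * h)) ≤ X * r ^ 2 * X := by gcongr
      _ = r ^ 2 * X ^ 2 := by ring
      _ ≤ 1 := spacing_sq_mul_pow_le_one hX0 hc hr hrX (by norm_num)
  have h5 : β * (d * r) * (2 * (l * h)) ≤ 1 := by
    calc β * (d * r) * (2 * (l * h)) ≤ (c + 1) * X ^ 2 * (X * r) * X := by gcongr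
      _ = r * ((c + 1) * X ^ 4) := by ring
      _ = 1 := hrX
  rw [le_div_iff₀ (by positivity)]
  linarith

/-- The grid size is polynomial in c and X, so its logarithm is of order c + log X. -/
theorem log_grid_size_le (hh : 1 ≤ h) (hl : 1 ≤ l) (hX : 2 * (l * h) ≤ X) (hc : 40 ≤ c)
    (hr : 0 < r) (hrX : r * ((c + 1) * X ^ 4) = 1) :
    Real.log (2 * (⌈l * h / r ^ 2 + 1⌉₊ : ℕ) + 1) ≤ 2 * c + 12 * Real.log X := by
  have hlh : 1 ≤ l * h := by nlinarith
  have hX0 : 2 ≤ X := by linarith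
  have h1 : ((⌈l * h / r ^ 2 + 1⌉₊ : ℕ) : ℝ) ≤ l * h / r ^ 2 + 1 + 1 :=
    (Nat.ceil_lt_add_one (by positivity)).le
  have h2 : l * h / r ^ 2 = l * h * ((c + 1) ^ 2 * X ^ 8) := by
    rw [div_eq_iff (by positivity)]
    calc l * h = l * h * (r * ((c + 1) * X ^ 4)) ^ 2 := by rw [hrX]; ring
      _ = _ := by ring
  have h3 : 2 * ((⌈l * h / r ^ 2 + 1⌉₊ : ℕ) : ℝ) + 1 ≤ (c + 1) ^ 2 * X ^ 12 := by
    have h5 : (1 : ℝ) ≤ (c + 1) ^ 2 * X ^ 9 :=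
      one_le_mul_of_one_le_of_one_le (one_le_pow₀ (by linarith)) (one_le_pow₀ (by linarith))
    have h6 : (8 : ℝ) ≤ X ^ 3 := by
      calc (8 : ℝ) = 2 ^ 3 := by norm_num
        _ ≤ X ^ 3 := by gcongr
    calc 2 * ((⌈l * h / r ^ 2 + 1⌉₊ : ℕ) : ℝ) + 1
        ≤ 2 * (l * h) * ((c + 1) ^ 2 * X ^ 8) + 5 := by rw [h2] at h1 ⊢; linarith
      _ ≤ X * ((c + 1) ^ 2 * X ^ 8) + 5 * ((c + 1) ^ 2 * X ^ 9) := by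
        gcongr
        linarith
      _ = 6 * ((c + 1) ^ 2 * X ^ 9) := by ring
      _ ≤ X ^ 3 * ((c + 1) ^ 2 * X ^ 9) := by gcongr; linarith
      _ = _ := by ring
  calc _ ≤ Real.log ((c + 1) ^ 2 * X ^ 12) := Real.log_le_log (by positivity) h3
    _ = 2 * Real.log (c + 1) + 12 * Real.log X := by
      rw [Real.log_mul (by positivity) (by positivity), Real.log_pow, Real.log_pow]
      norm_num
    _ ≤ _ := by
      have := Real.log_le_sub_one_of_pos (show 0 < c + 1 by linarith)
      linarith

/-- The threshold grows linearly in c, its square root only like √c. The left side therefore loses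
once (c - 5)² ≥ 24c + 78, which holds for c ≥ 40. -/
theorem sqrt_two_mul_threshold_le (hd : 1 ≤ d) (hX : 2 ≤ X) (hc : 40 ≤ c) {y : ℝ}
    (hy : y ≤ 2 * c + 12 * Real.log X) :
    Real.sqrt (2 * (Real.log X + 3 * d ^ 2 * y + 1)) ≤ (c - 5) * d * Real.sqrt (Real.log X) := by
  have hι := log_ge_of_two_le hX
  set ι := Real.log X
  have hd2 : 1 ≤ d ^ 2 := one_le_pow₀ hd
  rw [Real.sqrt_le_left (mul_nonneg (mul_nonneg (by linarith) (by linarith)) (by positivity)),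
    mul_pow, mul_pow, Real.sq_sqrt (by linarith)]
  have h2 : ι + 1 ≤ d ^ 2 * (3 * ι) := by nlinarith
  have h3 : y ≤ (4 * c + 12) * ι := by nlinarith
  have h4 : 3 * d ^ 2 * y ≤ 3 * d ^ 2 * ((4 * c + 12) * ι) := by gcongr
  have h5 : 78 + 24 * c ≤ (c - 5) ^ 2 := by nlinarith
  calc 2 * (ι + 3 * d ^ 2 * y + 1) ≤ (78 + 24 * c) * (d ^ 2 * ι) := by linarith
    _ ≤ (c - 5) ^ 2 * (d ^ 2 * ι) := by gcongr
    _ = _ := by ring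

/-- The reserve 5dh√(log X) ≥ 4dh pays for the regularization bias and the approximation error, at
most 2dh each. -/
theorem bonus_dominates (hd : 1 ≤ d) (hh : 1 ≤ h) (hl : 1 ≤ l) (hX : 2 ≤ X) {q : ℝ}
    (hq : q ≤ (c - 5) * d * Real.sqrt (Real.log X)) :
    (1 + h) * Real.sqrt d + h * q + 2 * (1 / (l * h)) * Real.sqrt (d * l) ≤
      c * d * h * Real.sqrt (Real.log X) := by
  have hsqrtι : 0.8 ≤ Real.sqrt (Real.log X) := by
    apply Real.le_sqrt_of_sq_le
    have := log_ge_of_two_le hX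
    norm_num
    linarith
  have h1 : (1 + h) * Real.sqrt d ≤ 2 * (d * h) := by
    calc (1 + h) * Real.sqrt d ≤ (2 * h) * d := by
          gcongr
          · linarith
          · exact sqrt_le_self_of_one_le hd
      _ = _ := by ring
  have h2 : 2 * (1 / (l * h)) * Real.sqrt (d * l) ≤ 2 * (d * h) := by
    calc 2 * (1 / (l * h)) * Real.sqrt (d * l) ≤ 2 * (1 / (l * h)) * (d * l) := by
          gcongr
          exact sqrt_le_self_of_one_le (by nlinarith)
      _ = 2 * (d / h) := by field_simp
      _ ≤ 2 * (d * h) := by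
        gcongr
        exact (div_le_self (by linarith) hh).trans (le_mul_of_one_le_right (by linarith) hh)
  have h3 : h * q ≤ h * ((c - 5) * d * Real.sqrt (Real.log X)) := by gcongr
  have h4 : 5 * (d * h) * 0.8 ≤ 5 * (d * h) * Real.sqrt (Real.log X) := by gcongr
  linarith

theorem exists_grid_parameters {d H L : ℕ} (hd : 0 < d) (hH : 0 < H) (hL : 0 < L) {p c : ℝ}
    (hp : 0 < p) (hp1 : p < 1) (hc : 40 ≤ c) {X : ℝ} (hX : X = 2 * d * (L * H) / p) :
    ∃ (ε t : ℝ) (N : ℕ), 0 < ε ∧ (L * H : ℝ) / ε + 1 ≤ N ∧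
      L * (d * ε) * (H + H * L + (H : ℝ) ^ 2 * (d * ε) / 2) ≤ 1 ∧
      (∀ β : ℝ, 0 ≤ β → β ≤ c * d * H * Real.sqrt (Real.log X) + (1 + H) * Real.sqrt (d * L) →
        d * ε + β * (d * Real.sqrt ε) ≤ 1 / (L * H)) ∧
      (1 + H) * Real.sqrt d + H * Real.sqrt (2 * (t + 1))
        + 2 * (1 / (L * H)) * Real.sqrt (d * L) ≤ c * d * H * Real.sqrt (Real.log X) ∧
      (L * H : ℝ) * (2 * N + 1) ^ (3 * d ^ 2) * Real.exp (-t) ≤ p / 2 := by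
  have hd1 : (1 : ℝ) ≤ d := by exact_mod_cast hd
  have hH1 : (1 : ℝ) ≤ H := by exact_mod_cast hH
  have hL1 : (1 : ℝ) ≤ L := by exact_mod_cast hL
  have hlh : (1 : ℝ) ≤ L * H := by nlinarith
  have hdlh : (1 : ℝ) ≤ d * (L * H) := by nlinarith
  have hX2 : 2 * (d * (L * H)) ≤ X := by
    rw [hX, le_div_iff₀ hp]; nlinarith
  have hX0 : 2 ≤ X := by linarith
  have hlhX : 2 * (L * H : ℝ) ≤ X := by nlinarith
  obtain ⟨r, hr⟩ : ∃ r : ℝ, r = 1 / ((c + 1) * X ^ 4) := ⟨_, rfl⟩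
  have hr0 : 0 < r := by rw [hr]; positivity
  have hrX : r * ((c + 1) * X ^ 4) = 1 := by rw [hr]; field_simp
  have hlog := log_grid_size_le hH1 hL1 hlhX hc hr0 hrX
  -- The threshold makes e⁻ᵗ equal to 1/X divided by the number (2N + 1)^(3d²), so the union bound
  -- leaves LH/X = p/(2d) ≤ p/2.
  refine ⟨r ^ 2, Real.log X + 3 * d ^ 2 * Real.log (2 * (⌈L * H / r ^ 2 + 1⌉₊ : ℕ) + 1),
    ⌈L * H / r ^ 2 + 1⌉₊, by positivity, Nat.le_ceil _,
    direction_error_le_one hd1 hH1 hL1 hX2 hc hr0 hrX, fun β _ hβ => ?_,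
    bonus_dominates hd1 hH1 hL1 hX0 (sqrt_two_mul_threshold_le hd1 hX0 hc hlog), ?_⟩
  · rw [Real.sqrt_sq hr0.le]
    exact approximation_error_le hd1 hH1 hL1 hX2 hc hr0 hrX hβ
  · set m : ℝ := 2 * (⌈L * H / r ^ 2 + 1⌉₊ : ℕ) + 1 with hm
    have hm0 : 0 < m := by positivity
    have h1 : Real.exp (-(Real.log X + 3 * d ^ 2 * Real.log m)) =
        X⁻¹ * (m ^ (3 * d ^ 2))⁻¹ := by
      rw [neg_add, Real.exp_add, Real.exp_neg, Real.exp_log (by linarith), Real.exp_neg]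
      congr 2
      rw [show (3 * (d : ℝ) ^ 2 * Real.log m) = ((3 * d ^ 2 : ℕ) : ℝ) * Real.log m by push_cast; ring,
        ← Real.log_pow, Real.exp_log (by positivity)]
    rw [h1]
    have h2 : L * H * m ^ (3 * d ^ 2) * (X⁻¹ * (m ^ (3 * d ^ 2))⁻¹) = L * H / X := by
      field_simp
    rw [h2, div_le_iff₀ (by linarith), hX]
    have h3 : p / 2 * (2 * d * (L * H) / p) = d * (L * H) := by field_simp
    rw [h3]
    nlinarith

end Constants

/-! ### Assembling the regret bound -/

section Final

/-- Everything is expressed through the square roots of d, h, l and ι. The constants come from 2√2 ≤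
3 and √ι ≤ 2ι, the latter because ι is bounded away from zero. -/
theorem main_term_le {d h l c ι bθ bμ : ℝ} (hd : 1 ≤ d) (hh : 1 ≤ h) (hl : 1 ≤ l) (hc : 0 ≤ c)
    (hι : 0.69 ≤ ι) (hbθ : 0 ≤ bθ) (hbμ : 0 ≤ bμ) :
    2 * (c * d * h * Real.sqrt ι + bθ * Real.sqrt (d * l) + bμ * h * Real.sqrt (d * l))
        * (h * Real.sqrt (l * (2 * (d * ι)))) + 3 / 2 * (h * Real.sqrt (l * h * ι)) ≤
      (3 * c + 6) * ι * (h ^ (3 / 2 : ℝ) * d ^ (3 / 2 : ℝ) * (l * h) ^ (1 / 2 : ℝ)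
        + bθ * d * (l * h) + bμ * d * h * (l * h)) := by
  have hpow : ∀ x : ℝ, 1 ≤ x → x ^ (3 / 2 : ℝ) = x * Real.sqrt x := by
    intro x hx
    rw [show (3 / 2 : ℝ) = 1 + 1 / 2 by norm_num, Real.rpow_add (by linarith), Real.rpow_one,
      ← Real.sqrt_eq_rpow]
  rw [hpow h hh, hpow d hd, ← Real.sqrt_eq_rpow,
    Real.sqrt_mul (by positivity) (2 * (d * ι)), Real.sqrt_mul (by norm_num) (d * ι),
    Real.sqrt_mul (by positivity) ι, Real.sqrt_mul (by positivity) l,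
    Real.sqrt_mul (by positivity) ι, Real.sqrt_mul (by positivity) h]
  have e1 := Real.sq_sqrt (show 0 ≤ d by linarith)
  have e2 := Real.sq_sqrt (show 0 ≤ h by linarith)
  have e3 := Real.sq_sqrt (show 0 ≤ l by linarith)
  have e4 := Real.sq_sqrt (show 0 ≤ ι by linarith)
  have g1 : 1 ≤ Real.sqrt d := Real.one_le_sqrt.mpr hd
  have g2 : 1 ≤ Real.sqrt h := Real.one_le_sqrt.mpr hh
  have g3 : 1 ≤ Real.sqrt l := Real.one_le_sqrt.mpr hl
  have g4 : 0.8 ≤ Real.sqrt ι := Real.le_sqrt_of_sq_le (by norm_num; linarith)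
  have g5 : Real.sqrt 2 ≤ 3 / 2 := by
    rw [Real.sqrt_le_left (by norm_num)]; norm_num
  have g6 : Real.sqrt ι ≤ 2 * ι := by nlinarith
  generalize Real.sqrt d = x at *
  generalize Real.sqrt h = y at *
  generalize Real.sqrt l = z at *
  generalize Real.sqrt ι = w at *
  have hx : d = x ^ 2 := e1.symm
  have hy : h = y ^ 2 := e2.symm
  have hz : l = z ^ 2 := e3.symm
  have hw : ι = w ^ 2 := e4.symm
  have t1 : 2 * (c * d * h * w) * (h * (z * (Real.sqrt 2 * (x * w)))) ≤
      3 * c * ι * (h * y * (d * x) * (z * y)) := by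
    calc 2 * (c * d * h * w) * (h * (z * (Real.sqrt 2 * (x * w))))
        = 2 * Real.sqrt 2 * (c * d * h * h * z * x * w ^ 2) := by ring
      _ ≤ 3 * (c * d * h * h * z * x * w ^ 2) := by gcongr; linarith
      _ = 3 * c * w ^ 2 * (h * y * (d * x) * (z * y)) := by rw [hy]; ring
      _ = _ := by rw [← hw]
  have t2 : ∀ b : ℝ, 0 ≤ b → 2 * (b * (x * z)) * (h * (z * (Real.sqrt 2 * (x * w)))) ≤
      6 * ι * (b * d * (l * h)) := by
    intro b hb
    calc 2 * (b * (x * z)) * (h * (z * (Real.sqrt 2 * (x * w))))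
        = 2 * Real.sqrt 2 * w * (b * x ^ 2 * (z ^ 2 * h)) := by ring
      _ ≤ 2 * (3 / 2) * (2 * ι) * (b * x ^ 2 * (z ^ 2 * h)) := by gcongr
      _ = 6 * ι * (b * d * (l * h)) := by rw [← hx, ← hz]; ring
  have t3 : 3 / 2 * (h * (z * y * w)) ≤ 6 * ι * (h * y * (d * x) * (z * y)) := by
    have : h * (z * y) ≤ h * y * (d * x) * (z * y) := by
      calc h * (z * y) = h * 1 * (1 * 1) * (z * y) := by ring
        _ ≤ h * y * (d * x) * (z * y) := by gcongr
    calc 3 / 2 * (h * (z * y * w)) = 3 / 2 * w * (h * (z * y)) := by ring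
      _ ≤ 3 / 2 * (2 * ι) * (h * y * (d * x) * (z * y)) := by gcongr
      _ ≤ _ := by
        have : 0 ≤ ι * (h * y * (d * x) * (z * y)) := by positivity
        linarith
  have t4 := t2 bθ hbθ
  have t5 := t2 (bμ * h) (by positivity)
  have t6 : 0 ≤ 3 * c * ι * (bθ * d * (l * h)) := by positivity
  have t7 : 0 ≤ 3 * c * ι * (bμ * d * h * (l * h)) := by positivity
  linarith

variable {S A Ω : Type*} [MeasurableSpace S] [MeasurableSpace A] {mΩ : MeasurableSpace Ω}
  {d H K W : ℕ} {M : LinearMDP S A d H K} {c p : ℝ} {Pr : Measure Ω}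
  {F : Filtration ℕ mΩ} {s : ℕ → ℕ → Ω → S} {π : ℕ → ℕ → Ω → S → A}

theorem epochStart_of_mem {L j k : ℕ} (hk : k ∈ epoch K L (j * L)) :
    epochStart L k = j * L := by
  rw [mem_epoch] at hk
  rw [epochStart, Nat.div_eq_of_lt_le hk.1 (by rw [Nat.succ_mul]; exact hk.2.1)]

theorem bonus_eq {j k : ℕ} (hk : k ∈ epoch K (W / H) (j * (W / H))) :
    M.bonus W c p k = c * d * H * Real.sqrt (Real.log (2 * d * W / p))
      + (M.localVarθ (W / H) (j * (W / H)) + H * M.localVarμ (W / H) (j * (W / H)))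
        * Real.sqrt (d * (k - j * (W / H) : ℕ)) := by
  have h1 := (mem_epoch.mp hk).1
  rw [bonus, epochStart_of_mem hk, Nat.cast_sub h1]
  ring

theorem card_epoch_le (K L τ : ℕ) : (epoch K L τ).card ≤ L := by
  rw [epoch, Nat.card_Ico]; omega

/-- This trivial bound suffices when a local variation exceeds 1. -/
theorem epochRegret_le_mul [Nonempty A] (L τ : ℕ) (ω : Ω) : M.epochRegret L τ s π ω ≤ L * H := by
  have h1 : ∀ k ∈ epoch K L τ,
      M.optValue k 0 (s k 0 ω) - M.value k (fun h => π k h ω) 0 (s k 0 ω) ≤ H := by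
    intro k hk
    have hk' := (mem_epoch.mp hk).2.2
    have : Nonempty {π : ℕ → S → A // ∀ i, Measurable (π i)} :=
      ⟨⟨fun _ _ => Classical.arbitrary A, fun _ => measurable_const⟩⟩
    have h2 : M.optValue k 0 (s k 0 ω) ≤ H :=
      ciSup_le fun π => M.value_le hk' (fun i _ => π.2 i) 0 _
    have h3 := M.value_nonneg (π := fun h => π k h ω) hk' 0 (s k 0 ω)
    linarith
  refine (Finset.sum_le_sum h1).trans ?_
  rw [Finset.sum_const, nsmul_eq_mul]
  gcongr
  exact card_epoch_le K L τ

theorem cast_sub_le_of_mem_epoch {L τ k : ℕ} (hk : k ∈ epoch K L τ) : ((k - τ : ℕ) : ℝ) ≤ L := by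
  have := mem_epoch.mp hk
  have : k - τ ≤ L := by omega
  exact_mod_cast this

theorem bonus_nonneg (hc : 0 ≤ c) {j k : ℕ} (hk : k ∈ epoch K (W / H) (j * (W / H))) :
    0 ≤ M.bonus W c p k := by
  rw [bonus_eq hk]
  have h1 := M.localVarθ_nonneg (W / H) (j * (W / H))
  have h2 := M.localVarμ_nonneg (W / H) (j * (W / H))
  positivity

theorem bonus_le {j k : ℕ} (hk : k ∈ epoch K (W / H) (j * (W / H))) :
    M.bonus W c p k ≤ c * d * H * Real.sqrt (Real.log (2 * d * W / p))
      + M.localVarθ (W / H) (j * (W / H)) * Real.sqrt (d * (W / H : ℕ))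
      + M.localVarμ (W / H) (j * (W / H)) * H * Real.sqrt (d * (W / H : ℕ)) := by
  rw [bonus_eq hk]
  have h1 := M.localVarθ_nonneg (W / H) (j * (W / H))
  have h2 := M.localVarμ_nonneg (W / H) (j * (W / H))
  have h3 := cast_sub_le_of_mem_epoch hk
  have h4 : Real.sqrt (d * (k - j * (W / H) : ℕ)) ≤ Real.sqrt (d * (W / H : ℕ)) :=
    Real.sqrt_le_sqrt (mul_le_mul_of_nonneg_left h3 (Nat.cast_nonneg d))
  have h5 : 0 ≤ M.localVarθ (W / H) (j * (W / H)) + H * M.localVarμ (W / H) (j * (W / H)) := by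
    positivity
  have h6 := mul_le_mul_of_nonneg_left h4 h5
  linarith

/-- For each step separately, the elliptical potential lemma sums over the episodes; `B` stands for
a common upper bound of their bonus coefficients. -/
theorem sum_bonus_le {L τ : ℕ} (hd : 0 < d) (hK : τ < K) {X B : ℝ} (hX : (d : ℝ) + L ≤ X)
    (hB : 0 ≤ B) (s : ℕ → ℕ → S) (a : ℕ → ℕ → A) :
    ∑ k ∈ epoch K L τ, ∑ h ∈ Finset.range H, 2 * B *
      weightedNorm (M.gram s a τ k h)⁻¹ (M.φ (s k h) (a k h)).ofLp ≤
      2 * B * (H * Real.sqrt (L * (2 * (d * Real.log X)))) := by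
  have hell : ∀ h, ∑ k ∈ epoch K L τ, weightedNorm (M.gram s a τ k h)⁻¹
      (M.φ (s k h) (a k h)).ofLp ≤ Real.sqrt (L * (2 * (d * Real.log X))) := by
    intro h
    have hle : τ ≤ min (τ + L) K := by omega
    have hdiff : min (τ + L) K - τ ≤ L := by omega
    have hdiff' : ((min (τ + L) K - τ : ℕ) : ℝ) ≤ L := by exact_mod_cast hdiff
    have hd1 : (1 : ℝ) ≤ d := by exact_mod_cast hd
    refine (sum_weightedNorm_Ico_le (fun l => (M.φ (s l h) (a l h)).ofLp)
      (fun l => M.dotProduct_φ_self_le _ _) hle).trans (Real.sqrt_le_sqrt ?_)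
    have hlog : Real.log (d + (min (τ + L) K - τ : ℕ)) ≤ Real.log X :=
      Real.log_le_log (by positivity) (by linarith)
    have hlog0 : 0 ≤ Real.log (d + (min (τ + L) K - τ : ℕ)) :=
      Real.log_nonneg (by linarith [(Nat.cast_nonneg (min (τ + L) K - τ) : (0 : ℝ) ≤ _)])
    gcongr
  rw [Finset.sum_comm]
  simp only [← Finset.mul_sum]
  refine mul_le_mul_of_nonneg_left ?_ (by positivity)
  refine (Finset.sum_le_sum fun h _ => hell h).trans ?_
  simp

/-- The parameters of the grid, the threshold `t` and the number `X = 2dW/p` fit together. -/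
structure GridParameters (d H L : ℕ) (c X ε t : ℝ) (N : ℕ) : Prop where
  pos : 0 < ε
  size : (L * H : ℝ) / ε + 1 ≤ N
  small : L * (d * ε) * (H + H * L + (H : ℝ) ^ 2 * (d * ε) / 2) ≤ 1
  approx : ∀ β : ℝ, 0 ≤ β →
    β ≤ c * d * H * Real.sqrt (Real.log X) + (1 + H) * Real.sqrt (d * L) →
      d * ε + β * (d * Real.sqrt ε) ≤ 1 / (L * H)
  bonus : (1 + H) * Real.sqrt d + H * Real.sqrt (2 * (t + 1))
    + 2 * (1 / (L * H)) * Real.sqrt (d * L) ≤ c * d * H * Real.sqrt (Real.log X)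

theorem optimism_of_gridParameters [Finite A] [Nonempty A] {j k : ℕ}
    (hk : k ∈ epoch K (W / H) (j * (W / H))) (hH : 0 < H) (hc : 0 ≤ c)
    (hbθ : M.localVarθ (W / H) (j * (W / H)) ≤ 1) (hbμ : M.localVarμ (W / H) (j * (W / H)) ≤ 1)
    {ε t : ℝ} {N : ℕ} (hP : GridParameters d H (W / H) c (2 * d * W / p) ε t N)
    {s : ℕ → ℕ → S} {a : ℕ → ℕ → A}
    (hgood : ∀ h < H, ∀ z w : Fin d → ℤ, ∀ Z : Fin d → Fin d → ℤ, (∀ i, |z i| ≤ N) →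
      (∀ i, |w i| ≤ N) → (∀ i j, |Z i j| ≤ N) →
      M.gridExponent s a (M.bonus W c p k) ε (j * (W / H)) k h z w Z ≤ t) {h : ℕ} (hh : h ≤ H) :
    (∀ x, 0 ≤ M.estV s a (M.bonus W c p k) (j * (W / H)) k h x) ∧
      (∀ π : ℕ → S → A, (∀ i < H, Measurable (π i)) → ∀ x,
        M.value k π h x ≤ M.estV s a (M.bonus W c p k) (j * (W / H)) k h x) ∧
      (h < H → M.BellmanErrorLe s a (M.bonus W c p k) (j * (W / H)) k h) := by
  have hβ0 := bonus_nonneg (M := M) (p := p) hc hk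
  -- Here the variations must be at most 1: this caps the bonus coefficient, and hence the
  -- approximation error, independently of the MDP.
  have happrox := hP.approx _ hβ0 (by
    refine (bonus_le hk).trans ?_
    have hq := Real.sqrt_nonneg ((d : ℝ) * (W / H : ℕ))
    have h1 := mul_le_mul_of_nonneg_right hbθ hq
    have h2 := mul_le_mul_of_nonneg_right hbμ (mul_nonneg (Nat.cast_nonneg (α := ℝ) H) hq)
    linarith)
  have hbon : (1 + H) * Real.sqrt d + H * Real.sqrt (2 * (t + 1))
      + (M.localVarθ (W / H) (j * (W / H)) + H * M.localVarμ (W / H) (j * (W / H))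
        + 2 * (1 / ((W / H : ℕ) * H))) * Real.sqrt (d * (k - j * (W / H) : ℕ))
      ≤ M.bonus W c p k := by
    rw [bonus_eq hk]
    have h1 : 2 * (1 / ((W / H : ℕ) * H : ℝ)) * Real.sqrt (d * (k - j * (W / H) : ℕ)) ≤
        2 * (1 / ((W / H : ℕ) * H)) * Real.sqrt (d * (W / H : ℕ)) :=
      mul_le_mul_of_nonneg_left (Real.sqrt_le_sqrt
        (mul_le_mul_of_nonneg_left (cast_sub_le_of_mem_epoch hk) (Nat.cast_nonneg d)))
        (by positivity)
    linarith [hP.bonus]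
  obtain ⟨h0, h1, -, h2⟩ := M.optimism_of_gridExponent_le hk hH hβ0 hP.pos hP.size hP.small happrox
    hbon hgood (H - h) h (by omega)
  exact ⟨h0, h1, h2⟩

/-- The regret bound on the good event. -/
theorem IsRun.epochRegret_le_of_good [Finite A] [Nonempty A] (hrun : M.IsRun W c p Pr F s π)
    {j : ℕ} (hd : 0 < d) (hH : 0 < H) (hj : j * (W / H) < K) (hc : 0 ≤ c)
    (hX : (d : ℝ) + (W / H : ℕ) ≤ 2 * d * W / p)
    (hbθ : M.localVarθ (W / H) (j * (W / H)) ≤ 1) (hbμ : M.localVarμ (W / H) (j * (W / H)) ≤ 1)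
    {ε t : ℝ} {N : ℕ} (hP : GridParameters d H (W / H) c (2 * d * W / p) ε t N) (ω : Ω)
    (hgrid : ∀ k ∈ epoch K (W / H) (j * (W / H)), ∀ h < H, ∀ z w : Fin d → ℤ,
      ∀ Z : Fin d → Fin d → ℤ, (∀ i, |z i| ≤ N) → (∀ i, |w i| ≤ N) → (∀ i j, |Z i j| ≤ N) →
      IsRun.trajGridExponent M s π (M.bonus W c p k) ε (j * (W / H)) k h z w Z ω ≤ t) :
    M.epochRegret (W / H) (j * (W / H)) s π ω ≤
      2 * (c * d * H * Real.sqrt (Real.log (2 * d * W / p))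
        + M.localVarθ (W / H) (j * (W / H)) * Real.sqrt (d * (W / H : ℕ))
        + M.localVarμ (W / H) (j * (W / H)) * H * Real.sqrt (d * (W / H : ℕ)))
        * (H * Real.sqrt ((W / H : ℕ) * (2 * (d * Real.log (2 * d * W / p)))))
      + ∑ k ∈ epoch K (W / H) (j * (W / H)), ∑ h ∈ Finset.range H,
        -M.noise (fun l i => s l i ω) (fun l i => π l i ω (s l i ω))
          (IsRun.trajGap M s π (M.bonus W c p) (j * (W / H)) k (h + 1) ω) k h := by
  have hB0 : 0 ≤ c * d * H * Real.sqrt (Real.log (2 * d * W / p))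
      + M.localVarθ (W / H) (j * (W / H)) * Real.sqrt (d * (W / H : ℕ))
      + M.localVarμ (W / H) (j * (W / H)) * H * Real.sqrt (d * (W / H : ℕ)) := by
    have h1 := M.localVarθ_nonneg (W / H) (j * (W / H))
    have h2 := M.localVarμ_nonneg (W / H) (j * (W / H))
    positivity
  refine le_trans ?_ (add_le_add_left (sum_bonus_le (M := M) hd hj hX hB0
    (fun l i => s l i ω) (fun l i => π l i ω (s l i ω))) _)
  rw [← Finset.sum_add_distrib]
  refine Finset.sum_le_sum fun k hk => ?_
  have hkK := (mem_epoch.mp hk).2.2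
  have hopt : ∀ {h : ℕ}, h ≤ H → _ := fun {h} hh =>
    optimism_of_gridParameters (M := M) hk hH hc hbθ hbμ hP
      (s := fun l i => s l i ω) (a := fun l i => π l i ω (s l i ω)) (hgrid k hk) hh
  have h1 := M.optValue_sub_value_le (s := fun l i => s l i ω)
    (a := fun l i => π l i ω (s l i ω)) (β := M.bonus W c p k) (τ := j * (W / H)) hkK
    (fun h hh => (hopt hh.le).2.2 hh) (fun h hh => (hopt hh).1)
    (hopt (Nat.zero_le H)).2.1 (π := fun h => π k h ω)
    (hrun.measurable_policy_section hkK ω) (fun _ _ => rfl)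
    (fun h hh x c' => by
      have h2 := hrun.greedy k hkK h hh ω x c'
      rw [epochStart_of_mem hk] at h2
      exact h2)
  refine h1.trans (add_le_add_left (Finset.sum_le_sum fun h _ => ?_) _)
  exact mul_le_mul_of_nonneg_right (mul_le_mul_of_nonneg_left (bonus_le hk) zero_le_two)
    (weightedNorm_nonneg _ _)

/-- With the best parameter of the exponential supermartingale. -/
theorem azuma_rate_eq {l h ι : ℝ} (hl : 0 < l) (hh : 0 < h) (hι : 0 < ι) :
    (ι + l * h * ((Real.sqrt (ι / (l * h)) / h * h) ^ 2 / 2)) / (Real.sqrt (ι / (l * h)) / h) =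
      3 / 2 * (h * Real.sqrt (l * h * ι)) := by
  have h0 : 0 < Real.sqrt (ι / (l * h)) := Real.sqrt_pos.mpr (by positivity)
  rw [div_mul_cancel₀ _ hh.ne', Real.sq_sqrt (by positivity), div_eq_iff (by positivity)]
  have hq : Real.sqrt (l * h * ι) * Real.sqrt (ι / (l * h)) = ι := by
    rw [← Real.sqrt_mul (by positivity), show l * h * ι * (ι / (l * h)) = ι ^ 2 by field_simp]
    exact Real.sqrt_sq hι.le
  calc ι + l * h * (ι / (l * h) / 2) = 3 / 2 * ι := by field_simp; ring
    _ = 3 / 2 * (Real.sqrt (l * h * ι) * Real.sqrt (ι / (l * h))) := by rw [hq]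
    _ = _ := by field_simp

/-- The case of large variation: bθ + bμ ≥ 1 makes the variation terms at least W. -/
theorem mul_le_regret_bound {d h W c ι bθ bμ q : ℝ} (hd : 1 ≤ d) (hh : 1 ≤ h) (hW : 0 ≤ W)
    (hc : 40 ≤ c) (hι : 0.69 ≤ ι) (hbθ : 0 ≤ bθ) (hbμ : 0 ≤ bμ) (hb : 1 ≤ bθ + bμ) (hq : 0 ≤ q) :
    W ≤ (3 * c + 6) * ι * (q + bθ * d * W + bμ * d * h * W) := by
  have h1 : W ≤ q + bθ * d * W + bμ * d * h * W := by
    calc W ≤ (bθ + bμ) * W := le_mul_of_one_le_left hW hb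
      _ = 0 + bθ * 1 * W + bμ * 1 * 1 * W := by ring
      _ ≤ q + bθ * d * W + bμ * d * h * W := by gcongr
  have h3 : 1 ≤ (3 * c + 6) * ι := by nlinarith
  exact h1.trans (le_mul_of_one_le_left (hW.trans h1) h3)

/-- Subadditivity alone is used: the regret event involves a supremum over all policies, and its
measurability is not assumed. -/
theorem one_sub_le_measureReal_of_compl_le [IsProbabilityMeasure Pr] (hp : 0 ≤ p) {B : Set Ω}
    (hB : Pr Bᶜ ≤ ENNReal.ofReal p) : 1 - p ≤ Pr.real B := by
  have h1 : (1 : ENNReal) ≤ Pr B + Pr Bᶜ := by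
    rw [← measure_univ (μ := Pr), ← Set.union_compl_self B]
    exact measure_union_le _ _
  have h2 := ENNReal.toReal_mono (by finiteness) h1
  rw [ENNReal.toReal_one, ENNReal.toReal_add (by finiteness) (by finiteness)] at h2
  have h3 : (Pr Bᶜ).toReal ≤ p := ENNReal.toReal_le_of_le_ofReal hp hB
  rw [measureReal_def]
  linarith

/-- The probability that the regret exceeds the bound, when the local variation is at most one. -/
theorem IsRun.measure_compl_epochRegret_le [Finite A] [Nonempty A] [IsProbabilityMeasure Pr]
    (hc : 40 ≤ c) (hd : 0 < d) (hH : 0 < H) (hL0 : 0 < W / H) (hW : (W : ℝ) = (W / H : ℕ) * H)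
    (hp : 0 < p) (hp1 : p < 1) (hrun : M.IsRun W c p Pr F s π) {j : ℕ} (hj : j * (W / H) < K)
    (hX : (d : ℝ) + (W / H : ℕ) ≤ 2 * d * W / p) (hX2 : 2 ≤ 2 * d * W / p)
    (hbθ : M.localVarθ (W / H) (j * (W / H)) ≤ 1)
    (hbμ : M.localVarμ (W / H) (j * (W / H)) ≤ 1) :
    Pr {ω | M.epochRegret (W / H) (j * (W / H)) s π ω ≤
      (3 * c + 6) * Real.log (2 * d * W / p) *
        ((H : ℝ) ^ (3 / 2 : ℝ) * (d : ℝ) ^ (3 / 2 : ℝ) * (W : ℝ) ^ (1 / 2 : ℝ)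
          + M.localVarθ (W / H) (j * (W / H)) * d * W
          + M.localVarμ (W / H) (j * (W / H)) * d * H * W)}ᶜ ≤ ENNReal.ofReal p := by
  have hd1 : (1 : ℝ) ≤ d := by exact_mod_cast hd
  have hH1 : (1 : ℝ) ≤ H := by exact_mod_cast hH
  have hL1 : (1 : ℝ) ≤ (W / H : ℕ) := by exact_mod_cast hL0
  have hι := log_ge_of_two_le hX2
  obtain ⟨ε, t, N, hε, hN, hsmall, happrox, hbonus, hcount⟩ :=
    exists_grid_parameters hd hH hL0 hp hp1 hc (X := 2 * d * W / p) (by rw [← hW])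
  have hP : GridParameters d H (W / H) c (2 * d * W / p) ε t N :=
    ⟨hε, hN, hsmall, happrox, hbonus⟩
  -- 1/X = p/(2dW) ≤ p/2, so the threshold log X suffices for the martingale part.
  have hexp : Real.exp (-Real.log (2 * d * W / p)) ≤ p / 2 := by
    rw [Real.exp_neg, Real.exp_log (by linarith), inv_le_comm₀ (by linarith) (by linarith), inv_div]
    gcongr
    rw [hW]
    have : (1 : ℝ) ≤ d * ((W / H : ℕ) * H) :=
      one_le_mul_of_one_le_of_one_le hd1 (one_le_mul_of_one_le_of_one_le hL1 hH1)
    linarith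
  -- With this λ, (λH)²·LH = log X, so the accumulated variance penalty is half the threshold.
  have hlam0 : 0 < Real.sqrt (Real.log (2 * d * W / p) / ((W / H : ℕ) * H)) / H := by
    have : 0 < Real.log (2 * d * W / p) / ((W / H : ℕ) * H) := by
      apply div_pos <;> [linarith; positivity]
    exact div_pos (Real.sqrt_pos.mpr this) (by linarith)
  have hbad1 := hrun.measure_exists_trajGridExponent_gt_le (M.bonus W c p) ε (W / H)
    (j * (W / H)) N hd hcount
  have hbad2 := hrun.measure_sum_noise_trajGap_gt_le (M.bonus W c p) (W / H) (j * (W / H))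
    hlam0 hexp
  have hsum : ENNReal.ofReal (p / 2) + ENNReal.ofReal (p / 2) = ENNReal.ofReal p := by
    rw [← ENNReal.ofReal_add (by linarith) (by linarith), add_halves]
  rw [← hsum]
  refine le_trans (measure_mono ?_) ((measure_union_le _ _).trans (add_le_add hbad1 hbad2))
  intro ω hω
  by_contra hnot
  rw [Set.mem_union, not_or] at hnot
  apply hω
  have hreg := hrun.epochRegret_le_of_good hd hH hj (by linarith) hX hbθ hbμ hP ω
    (fun k hk h hh z w Z hz hw hZ => by
      by_contra hlt
      exact hnot.1 ⟨k, hk, h, hh, z, w, Z, hz, hw, hZ, not_le.mp hlt⟩)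
  have hnoise := (le_div_iff₀' hlam0).mpr (not_lt.mp hnot.2)
  rw [azuma_rate_eq (by linarith) (by linarith) (by linarith)] at hnoise
  have hmain := main_term_le hd1 hH1 hL1 (show 0 ≤ c by linarith) hι
    (M.localVarθ_nonneg (W / H) (j * (W / H))) (M.localVarμ_nonneg (W / H) (j * (W / H)))
  rw [← hW] at hmain hnoise
  exact (hreg.trans (add_le_add_right hnoise _)).trans hmain

end Final

end LinearMDP

theorem mainTheorem8 :
    ∃ c₀ : ℝ, 0 < c₀ ∧ ∀ c : ℝ, c₀ ≤ c → ∃ (C : ℝ) (m : ℕ), 0 < C ∧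
      ∀ (S A Ω : Type*) [MeasurableSpace S] [MeasurableSpace A] [MeasurableSingletonClass A]
        [Finite A] [mΩ : MeasurableSpace Ω] (d H K W : ℕ) (M : LinearMDP S A d H K)
        (p : ℝ) (Pr : Measure Ω) [IsProbabilityMeasure Pr] (F : Filtration ℕ mΩ)
        (s : ℕ → ℕ → Ω → S) (π : ℕ → ℕ → Ω → S → A),
        0 < d → 0 < H → 0 < W → H ∣ W → 0 < p → p < 1 →
        M.IsRun W c p Pr F s π →
        ∀ j : ℕ, j * (W / H) < K →
          1 - p ≤ Pr.real {ω | M.epochRegret (W / H) (j * (W / H)) s π ω ≤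
            C * Real.log (2 * d * W / p) ^ m *
              ((H : ℝ) ^ (3 / 2 : ℝ) * (d : ℝ) ^ (3 / 2 : ℝ) * (W : ℝ) ^ (1 / 2 : ℝ)
                + M.localVarθ (W / H) (j * (W / H)) * d * W
                + M.localVarμ (W / H) (j * (W / H)) * d * H * W)} := by
  -- 40 is what `sqrt_two_mul_threshold_le` needs, 3c + 6 is the constant of `main_term_le`, and a
  -- single logarithm suffices.
  refine ⟨40, by norm_num, fun c hc => ⟨3 * c + 6, 1, by linarith, ?_⟩⟩
  intro S A Ω _ _ _ _ mΩ d H K W M p Pr _ F s π hd hH hW hHW hp hp1 hrun j hj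
  obtain ⟨ω₀⟩ := nonempty_of_isProbabilityMeasure Pr
  have : Nonempty A := ⟨π 0 0 ω₀ (s 0 0 ω₀)⟩
  rw [pow_one]
  have hLH : W / H * H = W := Nat.div_mul_cancel hHW
  have hL0 : 0 < W / H := Nat.div_pos (Nat.le_of_dvd hW hHW) hH
  have hd1 : (1 : ℝ) ≤ d := by exact_mod_cast hd
  have hH1 : (1 : ℝ) ≤ H := by exact_mod_cast hH
  have hL1 : (1 : ℝ) ≤ (W / H : ℕ) := by exact_mod_cast hL0
  have hW' : (W : ℝ) = (W / H : ℕ) * H := by exact_mod_cast hLH.symm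
  have hW1 : (1 : ℝ) ≤ W := by exact_mod_cast hW
  have hLW : ((W / H : ℕ) : ℝ) ≤ W := by exact_mod_cast Nat.div_le_self W H
  have hXdW : 2 * d * (W : ℝ) ≤ 2 * d * W / p := le_div_self (by positivity) hp hp1.le
  have h1 : (d : ℝ) ≤ d * W := le_mul_of_one_le_right (by linarith) hW1
  have h2 : (W : ℝ) ≤ d * W := le_mul_of_one_le_left (by linarith) hd1
  have hX2 : 2 ≤ 2 * d * W / p := by linarith
  apply LinearMDP.one_sub_le_measureReal_of_compl_le hp.le
  -- If the variations are not both at most 1, the bound holds on every trajectory and the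
  -- exceptional set is empty.
  by_cases hcase : M.localVarθ (W / H) (j * (W / H)) ≤ 1 ∧ M.localVarμ (W / H) (j * (W / H)) ≤ 1
  · exact hrun.measure_compl_epochRegret_le hc hd hH hL0 hW' hp hp1 hj (by linarith) hX2
      hcase.1 hcase.2
  · refine le_of_eq_of_le ?_ (zero_le (a := ENNReal.ofReal p))
    have hbθ0 := M.localVarθ_nonneg (W / H) (j * (W / H))
    have hbμ0 := M.localVarμ_nonneg (W / H) (j * (W / H))
    have hall : ∀ ω, M.epochRegret (W / H) (j * (W / H)) s π ω ≤
        (3 * c + 6) * Real.log (2 * d * W / p) *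
          ((H : ℝ) ^ (3 / 2 : ℝ) * (d : ℝ) ^ (3 / 2 : ℝ) * (W : ℝ) ^ (1 / 2 : ℝ)
            + M.localVarθ (W / H) (j * (W / H)) * d * W
            + M.localVarμ (W / H) (j * (W / H)) * d * H * W) := fun ω => by
      refine (LinearMDP.epochRegret_le_mul (W / H) (j * (W / H)) ω).trans ?_
      rw [← hW']
      refine LinearMDP.mul_le_regret_bound hd1 hH1 (by linarith) hc
        (LinearMDP.log_ge_of_two_le hX2) hbθ0 hbμ0 ?_ (by positivity)
      by_contra hlt
      exact hcase ⟨by linarith, by linarith⟩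
    exact measure_mono_null (t := ∅) (fun ω hω => absurd (hall ω) hω) measure_empty
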